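/- Overlapping cycles shuffle. Let $n>m\ge 2$ be integers. Start with a deck of $n$ cards, card $i$ being initially in position $i\in\{1,\dots,n\}$ (position $1$ is the top). In each round flip an independent fair coin; on Heads move the card in position $m$ to the top of the deck, on Tails move the card in position $n$ to the top. Let $i_t$ be the position of card $i$ after $t$ rounds. For a position $x$ put $p(x)=x$ if $x\le m$ and $p(x)=x+(x-m)$ if $x>m$. For $\omega\in\mathbb R$ put $$\|\omega\|=\min\{|a|+|b|\sqrt n \;:\; a\in\mathbb R,\ b\in\mathbb Z,\ \omega\equiv a+bm \bmod (2n-m+1)\},$$ for $z\in\mathbb Z$ put $|z|_M=\min\{|a| : a\in\mathbb Z,\ z\equiv a \bmod (2n-m+1)\}$, and for real $\ell>0$ put $$\gamma=\gamma(\ell,n,m)=\Big|\Big\{\kappa\in\{0,1,2,\dots\} : |\kappa m|_M<\ell,\ \kappa<\tfrac{\ell}{\sqrt n}\Big\}\Big|.$$ For a card $i$ let $N_i$ be the set of positions $\omega$ such that $p(i)+a+bm\equiv p(\omega)\bmod (2n-m+1)$ for some integers $a,b$ with $|a|\le \ell$ and $|b|\le \ell/\sqrt n$. Proposition. For every $\epsilon\in(0,\tfrac12)$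 there are constants $C,D>0$, depending only on $\epsilon$, such that the following holds for all integers $n>m\ge2$ with $\epsilon<\frac mn<1-\epsilon$ and all real $\ell>C\sqrt n$. Let $i,j,k$ be cards with $$\|p(i)-p(j)\|,\ \|p(i)-p(k)\|,\ \|p(j)-p(k)\|>199\,\ell,$$ and let $T\in[\ell^2,\ell^2+4n]$ be an integer with $T-\lfloor \frac{T}{2n}\rfloor m\equiv 0 \bmod (2n-m+1)$. Then $$\mathbb P(i_T=f_i,\ j_T=f_j,\ k_T=f_k)\ \ge\ \frac{D\,\gamma^3\,n^{3/2}}{\ell^6}$$ for at least $\frac34$ of all triples $(f_i,f_j,f_k)\in N_i\times N_j\times N_k$. -/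

import Mathlib

open MeasureTheory

namespace OverlappingCycles

/-- The permutation `(1, 2, …, k)` of the positions of a deck of `n` cards: positions `1, …, k - 1`
move down by one and position `k` moves to the top.  Position `x ∈ {1, …, n}` is represented by
the element of `Fin n` with value `x - 1`.  (Only used for `1 ≤ k ≤ n`.) -/
def cycle (n k : ℕ) : Equiv.Perm (Fin n) :=
  if h : 1 ≤ k ∧ k ≤ n then Fin.cycleRange ⟨k - 1, by omega⟩ else 1

/-- One round of the shuffle: Heads (`true`) moves the `m`-th card to the top, Tails (`false`) moves
the `n`-th card to the top. -/
def step (n m : ℕ) (coin : Bool) : Equiv.Perm (Fin n) :=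
  if coin then cycle n m else cycle n n

/-- The deck after `t` rounds with the coins `c 0, c 1, …`:  `deck n m c t i` is the position `i_t`
of card `i` (the card that was originally in position `i`) after `t` rounds. -/
def deck (n m : ℕ) (c : ℕ → Bool) : ℕ → Equiv.Perm (Fin n)
  | 0 => 1
  | t + 1 => step n m (c t) * deck n m c t

/-- The law of an infinite sequence of independent fair coins. -/
noncomputable def coinLaw : Measure (ℕ → Bool) :=
  Measure.infinitePi fun _ : ℕ => (PMF.uniformOfFintype Bool).toMeasure

/-- The stretched position `p(x)`, which is `x` for `x ≤ m` and `x + (x - m)` for `x > m`, where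
`x ∈ {1, …, n}`. -/
def p {n : ℕ} (m : ℕ) (x : Fin n) : ℤ :=
  if (x : ℤ) + 1 ≤ m then (x : ℤ) + 1 else ((x : ℤ) + 1) + (((x : ℤ) + 1) - m)

/-- The modulus `2n - m + 1`. -/
def modulus (n m : ℕ) : ℤ := 2 * (n : ℤ) - (m : ℤ) + 1

/-- `‖ω‖ = min {|a| + |b| √n : a ∈ ℝ, b ∈ ℤ, ω ≡ a + b m mod (2n - m + 1)}`. -/
noncomputable def deckNorm (n m : ℕ) (ω : ℝ) : ℝ :=
  sInf {s : ℝ | ∃ (a : ℝ) (b q : ℤ),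
    ω = a + (b : ℝ) * (m : ℝ) + (q : ℝ) * (modulus n m : ℝ) ∧
      s = |a| + |(b : ℝ)| * Real.sqrt n}

/-- `|z|_M = min {|a| : a ∈ ℤ, z ≡ a mod (2n - m + 1)}`. -/
noncomputable def circAbs (n m : ℕ) (z : ℤ) : ℕ :=
  sInf {d : ℕ | ∃ a : ℤ, z ≡ a [ZMOD modulus n m] ∧ d = a.natAbs}

/-- `γ(ℓ, n, m)`, the number of `κ ∈ {0, 1, 2, …}` with `|κ m|_M < ℓ` and `κ < ℓ / √n`. -/
noncomputable def gamma (ℓ : ℝ) (n m : ℕ) : ℕ :=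
  Set.ncard {κ : ℕ | (circAbs n m ((κ : ℤ) * (m : ℤ)) : ℝ) < ℓ ∧ (κ : ℝ) < ℓ / Real.sqrt n}

/-- The neighbourhood `N_i` of all positions `ω` with `p(i) + a + b m ≡ p(ω) mod (2n - m + 1)` for
some integers `|a| ≤ ℓ` and `|b| ≤ ℓ / √n`. -/
def nbhd {n : ℕ} (m : ℕ) (ℓ : ℝ) (i : Fin n) : Set (Fin n) :=
  {ω | ∃ a b : ℤ, |(a : ℝ)| ≤ ℓ ∧ |(b : ℝ)| ≤ ℓ / Real.sqrt n ∧
    p m i + a + b * (m : ℤ) ≡ p m ω [ZMOD modulus n m]}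

/-- The probability that cards `i, j, k` are in positions `fi, fj, fk` after `T` rounds. -/
noncomputable def tripleProb {n : ℕ} (m T : ℕ) (i j k fi fj fk : Fin n) : ℝ :=
  coinLaw.real {c | deck n m c T i = fi ∧ deck n m c T j = fj ∧ deck n m c T k = fk}

end OverlappingCycles

/-! Suppose that more than a quarter of the triples in `N_i × N_j × N_k` had probability below the
bound, and let `A` be the set of these triples. The three cards would be in `A` at time `T` with
probability at most `|N_i| |N_j| |N_k|` times the bound. Every `κ` counted by `γ` gives a further
way to write a position of `N_i` as `p(i) + a + b m`, whence `|N_i| γ ≤ 25 ℓ² / √n`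
(`card_near_mul_le`), and the probability of `A` would be at most half of a constant. This
contradicts `le_Ex_mem`: every set that fills a quarter of the box of neighbourhoods is hit at time
`T` with at least that constant probability.

The cards get integer locations in which a card advances by `1` per round on average: in the lower
part of the deck by `0` or `2`, in the upper part by exactly `1`, and at position `m` a coin decides
whether it returns to the top or goes through the lower part. After `t` rounds the location is
`start + t + acc - m turn - 2 n V` (`st_eq`, `Rel`), where the fluctuation `acc` and the decision
excess `turn` are martingales of orders `√t` and `√(t/n)`. Since `2 n ≡ m - 1` modulo `2 n - m + 1`,
displacements have the form `a + b m`, with one unit of `b` weighing as much as `√n` units of `a`;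
this explains the norm. The congruence on `T` says that a typical card is back near its start.

For `le_Ex_mem` write `T = t₁ + t₂` with `t₂` about `θ ℓ²`, where `θ` is small, and let `v z` be the
probability to be in `A` after `t₂` rounds from `z`.

Reversal. A reflection of the deck turns the shuffle into its inverse (`Ex_eq_indicator`). Run
backwards from any point of `A`, the cards are likely to be in a box of comparable size, so some `z`
in that box has `v z` bounded below (`exists_le_Ex_of_return`).

Smoothness. `v` changes little when the cards move by `δ ℓ` (`abs_Ex_sub_le`). Two decks that differ
in one card are first run with the same coins until the card and its replacement have made
equivalent decisions (`abs_val_sub_le_of_chase`). Then a coupling lets them meet: while the card is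
alone in the lower part the other two ignore the coin, so the replacement may use the opposite one
(`abs_val_sub_le_of_close`). In both stages the distance is a stopped nonnegative martingale,
controlled by its quadratic variation (`Ex_active_le`). Separation keeps the other cards from
interfering.

Steering. In `t₁` rounds the cards come within `δ ℓ` of `z` with probability bounded below
(`le_Ex_close`). The six-dimensional martingale of fluctuations and excesses has quadratic variation
of full order in every direction, because each card is alone in the lower part for a positive
fraction of the time and decides a positive number of times in every `6 n` rounds
(`occ_alone_and_decision`). Second and fourth moments give progress in any direction, and blocks of
rounds are concatenated. -/

namespace OverlappingCycles

/-! ### Means and occupation times of coin-driven chains. -/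

section Expectation

variable {S S' : Type*}

/-- `Ex f t g s` is the mean of `g` after `t` steps, started at `s`, of the Markov chain that at each
step applies `f · b` with a fair coin `b`. -/
noncomputable def Ex (f : S → Bool → S) : ℕ → (S → ℝ) → S → ℝ
  | 0, g => g
  | t + 1, g => fun s => (Ex f t g (f s true) + Ex f t g (f s false)) / 2

/-- The sum of the means of `q` over the first `t` times. -/
noncomputable def occ (f : S → Bool → S) (q : S → ℝ) : ℕ → S → ℝ
  | 0 => fun _ => 0
  | t + 1 => fun s => q s + (occ f q t (f s true) + occ f q t (f s false)) / 2

variable {f : S → Bool → S}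

@[simp] theorem Ex_zero (g : S → ℝ) (s : S) : Ex f 0 g s = g s := rfl

theorem Ex_succ (t : ℕ) (g : S → ℝ) (s : S) :
    Ex f (t + 1) g s = (Ex f t g (f s true) + Ex f t g (f s false)) / 2 := rfl

theorem Ex_comp (t u : ℕ) (g : S → ℝ) (s : S) : Ex f (t + u) g s = Ex f t (Ex f u g) s := by
  induction t generalizing s with
  | zero => simp
  | succ t ih => rw [Nat.succ_add, Nat.succ_eq_add_one, Ex_succ, Ex_succ, ih, ih]

theorem Ex_succ_right (t : ℕ) (g : S → ℝ) (s : S) :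
    Ex f (t + 1) g s = Ex f t (fun s => (g (f s true) + g (f s false)) / 2) s :=
  Ex_comp t 1 g s

theorem Ex_mono_of_inv {I : S → Prop} (hI : ∀ s b, I s → I (f s b)) {g g' : S → ℝ}
    (h : ∀ s, I s → g s ≤ g' s) (t : ℕ) (s : S) (hs : I s) : Ex f t g s ≤ Ex f t g' s := by
  induction t generalizing s with
  | zero => exact h s hs
  | succ t ih =>
    rw [Ex_succ, Ex_succ]
    linarith [ih _ (hI s true hs), ih _ (hI s false hs)]

/-- The invariant may depend on the number of rounds played; this is needed for `Rel`, which
contains the time. -/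
theorem Ex_mono_of_clock {I : ℕ → S → Prop} (hI : ∀ k s b, I k s → I (k + 1) (f s b))
    {g g' : S → ℝ} (t k : ℕ) (h : ∀ s, I (k + t) s → g s ≤ g' s) (s : S) (hs : I k s) :
    Ex f t g s ≤ Ex f t g' s := by
  induction t generalizing s k with
  | zero => exact h s hs
  | succ t ih =>
    rw [Ex_succ, Ex_succ]
    have e : k + 1 + t = k + (t + 1) := by ring
    linarith [ih (k + 1) (by rwa [e]) _ (hI k s true hs),
      ih (k + 1) (by rwa [e]) _ (hI k s false hs)]

theorem Ex_congr_of_inv {I : S → Prop} (hI : ∀ s b, I s → I (f s b)) {g g' : S → ℝ}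
    (h : ∀ s, I s → g s = g' s) (t : ℕ) (s : S) (hs : I s) : Ex f t g s = Ex f t g' s :=
  le_antisymm (Ex_mono_of_inv hI (fun s hs => (h s hs).le) t s hs)
    (Ex_mono_of_inv hI (fun s hs => (h s hs).ge) t s hs)

theorem Ex_mono {g g' : S → ℝ} (h : ∀ s, g s ≤ g' s) (t : ℕ) (s : S) : Ex f t g s ≤ Ex f t g' s :=
  Ex_mono_of_inv (I := fun _ => True) (fun _ _ _ => trivial) (fun s _ => h s) t s trivial

theorem Ex_const (c : ℝ) (t : ℕ) (s : S) : Ex f t (fun _ => c) s = c := by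
  induction t generalizing s with
  | zero => rfl
  | succ t ih => rw [Ex_succ, ih, ih]; ring

theorem Ex_add (g g' : S → ℝ) (t : ℕ) (s : S) :
    Ex f t (fun s => g s + g' s) s = Ex f t g s + Ex f t g' s := by
  induction t generalizing s with
  | zero => rfl
  | succ t ih => rw [Ex_succ, Ex_succ, Ex_succ, ih, ih]; ring

theorem Ex_mul (c : ℝ) (g : S → ℝ) (t : ℕ) (s : S) :
    Ex f t (fun s => c * g s) s = c * Ex f t g s := by
  induction t generalizing s with
  | zero => rfl
  | succ t ih => rw [Ex_succ, Ex_succ, ih, ih]; ring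

theorem Ex_sub (g g' : S → ℝ) (t : ℕ) (s : S) :
    Ex f t (fun s => g s - g' s) s = Ex f t g s - Ex f t g' s := by
  have h := Ex_add (f := f) g (fun s => (-1) * g' s) t s
  rw [Ex_mul] at h
  have h2 : (fun s => g s - g' s) = fun s => g s + (-1) * g' s := by funext s; ring
  rw [h2, h]; ring

theorem Ex_sum {ι : Type*} (A : Finset ι) (g : ι → S → ℝ) (t : ℕ) (s : S) :
    Ex f t (fun s => ∑ x ∈ A, g x s) s = ∑ x ∈ A, Ex f t (g x) s := by
  classical
  induction A using Finset.induction_on with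
  | empty => simpa using Ex_const (f := f) 0 t s
  | insert x A hx ih => simp only [Finset.sum_insert hx]; rw [Ex_add, ih]

theorem Ex_nonneg {g : S → ℝ} (h : ∀ s, 0 ≤ g s) (t : ℕ) (s : S) : 0 ≤ Ex f t g s := by
  simpa [Ex_const] using Ex_mono (f := f) h t s

/-- Comparison principle: `W t` bounds the mean with `t` rounds to go. It does the work of optional
stopping, since maximal inequalities and moment bounds only require the right `W`. -/
theorem Ex_le_of_supersolution {I : S → Prop} (hI : ∀ s b, I s → I (f s b)) {g : S → ℝ}
    (W : ℕ → S → ℝ) (h0 : ∀ s, I s → g s ≤ W 0 s)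
    (h : ∀ t s, I s → (W t (f s true) + W t (f s false)) / 2 ≤ W (t + 1) s) (t : ℕ) (s : S)
    (hs : I s) : Ex f t g s ≤ W t s := by
  induction t generalizing s with
  | zero => exact h0 s hs
  | succ t ih =>
    rw [Ex_succ]
    linarith [ih _ (hI s true hs), ih _ (hI s false hs), h t s hs]

theorem Ex_ge_of_subsolution {I : S → Prop} (hI : ∀ s b, I s → I (f s b)) {g : S → ℝ}
    (W : ℕ → S → ℝ) (h0 : ∀ s, I s → W 0 s ≤ g s)
    (h : ∀ t s, I s → W (t + 1) s ≤ (W t (f s true) + W t (f s false)) / 2) (t : ℕ) (s : S)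
    (hs : I s) : W t s ≤ Ex f t g s := by
  induction t generalizing s with
  | zero => exact h0 s hs
  | succ t ih =>
    rw [Ex_succ]
    linarith [ih _ (hI s true hs), ih _ (hI s false hs), h t s hs]

theorem Ex_map {f' : S' → Bool → S'} (π : S → S') (h : ∀ s b, π (f s b) = f' (π s) b)
    (g : S' → ℝ) (t : ℕ) (s : S) : Ex f t (fun s => g (π s)) s = Ex f' t g (π s) := by
  induction t generalizing s with
  | zero => rfl
  | succ t ih => rw [Ex_succ, Ex_succ, ih, ih, h, h]

theorem occ_succ (q : S → ℝ) (t : ℕ) (s : S) :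
    occ f q (t + 1) s = q s + (occ f q t (f s true) + occ f q t (f s false)) / 2 := rfl

theorem occ_map {f' : S' → Bool → S'} (π : S → S') (h : ∀ s b, π (f s b) = f' (π s) b)
    (q : S' → ℝ) (t : ℕ) (s : S) : occ f (fun s => q (π s)) t s = occ f' q t (π s) := by
  induction t generalizing s with
  | zero => rfl
  | succ t ih => rw [occ_succ, occ_succ, ih, ih, h, h]

theorem occ_eq_sum (q : S → ℝ) (t : ℕ) (s : S) :
    occ f q t s = ∑ u ∈ Finset.range t, Ex f u q s := by
  induction t generalizing s with
  | zero => simp [occ]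
  | succ t ih =>
    rw [occ_succ, ih, ih, Finset.sum_range_succ', ← Finset.sum_add_distrib, Finset.sum_div]
    simp only [Ex_succ, Ex_zero]; ring

theorem occ_add (q : S → ℝ) (t u : ℕ) (s : S) :
    occ f q (t + u) s = occ f q t s + Ex f t (occ f q u) s := by
  induction t generalizing s with
  | zero => simp [occ]
  | succ t ih =>
    rw [Nat.succ_add, Nat.succ_eq_add_one, occ_succ, ih, ih, occ_succ, Ex_succ]; ring

theorem occ_nonneg {q : S → ℝ} (hq : ∀ s, 0 ≤ q s) (t : ℕ) (s : S) : 0 ≤ occ f q t s := by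
  rw [occ_eq_sum]; exact Finset.sum_nonneg fun u _ => Ex_nonneg hq u s

theorem occ_le_occ {q : S → ℝ} (hq : ∀ s, 0 ≤ q s) {t u : ℕ} (h : t ≤ u) (s : S) :
    occ f q t s ≤ occ f q u s := by
  obtain ⟨k, rfl⟩ := Nat.exists_eq_add_of_le h
  rw [occ_add]
  linarith [Ex_nonneg (f := f) (occ_nonneg (f := f) hq k) t s]

theorem occ_le_of_potential {I : S → Prop} (hI : ∀ s b, I s → I (f s b)) {q : S → ℝ}
    (W : ℕ → S → ℝ) (h0 : ∀ s, I s → 0 ≤ W 0 s)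
    (h : ∀ t s b, I s → q s + W t (f s b) ≤ W (t + 1) s) (t : ℕ) (s : S)
    (hs : I s) : occ f q t s ≤ W t s := by
  induction t generalizing s with
  | zero => exact h0 s hs
  | succ t ih =>
    rw [occ_succ]
    linarith [ih _ (hI s true hs), ih _ (hI s false hs), h t s true hs, h t s false hs]

/-- The second moment of a process with fair increments. -/
theorem Ex_sq_eq_of_increment {I : S → Prop} (hI : ∀ s b, I s → I (f s b)) {h q : S → ℝ}
    (hh : ∀ s, I s → (h (f s true) ^ 2 + h (f s false) ^ 2) / 2 = h s ^ 2 + q s) (t : ℕ) (s : S)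
    (hs : I s) : Ex f t (fun s => h s ^ 2) s = h s ^ 2 + occ f q t s := by
  induction t generalizing s with
  | zero => simp [occ]
  | succ t ih =>
    rw [Ex_succ, occ_succ, ih _ (hI s true hs), ih _ (hI s false hs)]
    linarith [hh s hs]

/-- A stopped nonnegative martingale whose quadratic variation grows by at least `κ` in every `L`
steps is unlikely to be still active after many steps. -/
theorem Ex_active_le {I : S → Prop} (hI : ∀ s b, I s → I (f s b)) (act : S → Prop)
    [DecidablePred act] {h q : S → ℝ} {L : ℕ} {κ lam R : ℝ} (hκ : 0 < κ)
    (hrest : ∀ s b, I s → ¬ act s → ¬ act (f s b) ∧ h (f s b) = h s)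
    (hmart : ∀ s, I s → act s → (h (f s true) + h (f s false)) / 2 = h s)
    (hsq : ∀ s, I s → act s → h s ^ 2 + q s ≤ (h (f s true) ^ 2 + h (f s false) ^ 2) / 2)
    (hlam : ∀ s t, I s → t ≤ L → occ f q t s ≤ lam) (hκL : ∀ s, I s → act s → κ ≤ occ f q L s)
    (h0 : ∀ s, I s → 0 ≤ h s) (hR : ∀ s, I s → h s ≤ R) {Q : ℕ} (hQ : 0 < Q) {t : ℕ} (ht : Q * L ≤ t) (s : S) (hs : I s) :
    Ex f t (fun s => if act s then 1 else 0) s ≤ (R * h s + lam) / (κ * Q) := by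
  set ind : S → ℝ := fun s => if act s then 1 else 0 with hind
  -- A process that stops within a block misses some of its quadratic variation, at most `lam`. The
  -- bonus `lam` paid at the stop makes up for it, so `U` gains `κ` in every block begun in
  -- activity.
  set U : S → ℝ := fun s => h s ^ 2 + (if act s then 0 else lam) with hU
  have hlam0 : 0 ≤ lam := by simpa [occ] using hlam s 0 hs (Nat.zero_le _)
  have frozen : ∀ t s, I s → ¬ act s → Ex f t U s = h s ^ 2 + lam := by
    intro t
    induction t with
    | zero => intro s _ ha; simp [hU, ha]
    | succ t ih =>
      intro s hs ha
      have h1 := hrest s true hs ha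
      have h2 := hrest s false hs ha
      rw [Ex_succ, ih _ (hI _ _ hs) h1.1, ih _ (hI _ _ hs) h2.1, h1.2, h2.2]; ring
  have grow : ∀ t, t ≤ L → ∀ s, I s → h s ^ 2 + occ f q t s ≤ Ex f t U s := by
    intro t
    induction t with
    | zero => intro _ s _; simp only [occ, hU, Ex_zero]; split_ifs <;> linarith
    | succ t ih =>
      intro htL s hs
      by_cases ha : act s
      · rw [Ex_succ, occ_succ]
        linarith [ih (by omega) _ (hI s true hs), ih (by omega) _ (hI s false hs), hsq s hs ha]
      · rw [frozen _ s hs ha]; linarith [hlam s (t + 1) hs htL]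
  have block : ∀ s, I s → U s + κ * ind s ≤ Ex f L U s := by
    intro s hs
    by_cases ha : act s
    · have := grow L le_rfl s hs
      have := hκL s hs ha
      simp only [hU, hind, ha, if_true]; linarith
    · rw [frozen L s hs ha]; simp [hU, hind, ha]
  have indmono : ∀ t s, I s → Ex f t ind s ≤ ind s := by
    intro t
    induction t with
    | zero => intro s _; exact le_rfl
    | succ t ih =>
      intro s hs
      rw [Ex_succ]
      have h1 := ih _ (hI s true hs)
      have h2 := ih _ (hI s false hs)
      by_cases ha : act s
      · have e1 : ∀ s', ind s' ≤ 1 := fun s' => by simp only [hind]; split_ifs <;> norm_num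
        have := e1 (f s true); have := e1 (f s false)
        simp only [hind, ha, if_true] at *; linarith
      · have e1 : ind (f s true) = 0 := by simp [hind, (hrest s true hs ha).1]
        have e2 : ind (f s false) = 0 := by simp [hind, (hrest s false hs ha).1]
        simp only [hind, ha, if_false] at *; linarith
  have main : ∀ Q : ℕ, ∀ s, I s → U s + κ * (Q * Ex f (Q * L) ind s) ≤ Ex f (Q * L) U s := by
    intro Q
    induction Q with
    | zero => intro s _; simp
    | succ Q ih =>
      intro s hs
      have e : (Q + 1) * L = Q * L + L := by ring
      have e2 : (Q + 1) * L = L + Q * L := by ring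
      have h1 := ih s hs
      have h2 : Ex f (Q * L) (fun s => U s + κ * ind s) s ≤ Ex f (Q * L) (Ex f L U) s :=
        Ex_mono_of_inv hI block _ s hs
      rw [Ex_add, Ex_mul, ← Ex_comp, ← e] at h2
      have h3 : Ex f ((Q + 1) * L) ind s ≤ Ex f (Q * L) ind s := by
        rw [e, Ex_comp]; exact Ex_mono_of_inv hI (indmono L) _ s hs
      push_cast
      have h4 : κ * ((Q + 1) * Ex f ((Q + 1) * L) ind s) ≤ κ * ((Q + 1) * Ex f (Q * L) ind s) := by
        gcongr
      nlinarith
  have hmeanh : ∀ t s, I s → Ex f t h s = h s := by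
    intro t
    induction t with
    | zero => intro s _; rfl
    | succ t ih =>
      intro s hs
      rw [Ex_succ, ih _ (hI _ _ hs), ih _ (hI _ _ hs)]
      by_cases ha : act s
      · exact hmart s hs ha
      · rw [(hrest s true hs ha).2, (hrest s false hs ha).2]; ring
  -- `h ^ 2 ≤ R h` and `h` has constant mean, so `U` cannot grow beyond `R h + lam`; hence few
  -- blocks are begun in activity.
  have hup : Ex f (Q * L) U s ≤ R * h s + lam := by
    have : Ex f (Q * L) U s ≤ Ex f (Q * L) (fun s => R * h s + lam) s := by
      refine Ex_mono_of_inv hI (fun s hs => ?_) _ s hs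
      have := h0 s hs; have := hR s hs
      simp only [hU]; split_ifs <;> nlinarith
    rwa [Ex_add (fun s => R * h s) (fun _ => lam), Ex_mul, Ex_const, hmeanh _ _ hs] at this
  have hU0 : 0 ≤ U s := by simp only [hU]; split_ifs <;> positivity
  have htime : Ex f t ind s ≤ Ex f (Q * L) ind s := by
    obtain ⟨r, rfl⟩ := Nat.exists_eq_add_of_le ht
    rw [Ex_comp]
    exact Ex_mono_of_inv hI (indmono r) _ s hs
  refine htime.trans ?_
  rw [le_div_iff₀ (by positivity)]
  have := main Q s hs
  nlinarith

theorem Ex_eq_of_martingale {I : S → Prop} (hI : ∀ s b, I s → I (f s b)) {h : S → ℝ}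
    (hm : ∀ s, I s → (h (f s true) + h (f s false)) / 2 = h s) (t : ℕ) (s : S) (hs : I s) :
    Ex f t h s = h s := by
  induction t generalizing s with
  | zero => rfl
  | succ t ih => rw [Ex_succ, ih _ (hI _ _ hs), ih _ (hI _ _ hs), hm s hs]

end Expectation

end OverlappingCycles

/-! ### Locations of cards, time reversal and the count of decisions. -/

namespace OverlappingCycles

/-- The sign of a coin: heads counts `-1`, tails counts `1`. -/
def sgn (b : Bool) : ℤ := if b then -1 else 1

/-- One round, seen by a card at location `φ`.  Positions `x ≤ m` have location `x`, the positions
`n, n - 1, …, m + 1` have the locations `-1, -3, …`. -/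
def st (n m : ℤ) (b : Bool) (φ : ℤ) : ℤ :=
  if φ < 0 then (if b then φ else if φ = -1 then 1 else φ + 2)
  else if φ < m then φ + 1 else (if b then 1 else 2 * m + 1 - 2 * n)

/-- The locations of the positions of the deck. -/
def Valid (n m φ : ℤ) : Prop := (0 < φ ∧ φ ≤ m) ∨ (2 * m - 2 * n < φ ∧ φ < 0 ∧ φ % 2 = 1)

/-- The change of the fluctuation of a card in one round. -/
def dAcc (b : Bool) (φ : ℤ) : ℤ := if φ < 0 then sgn b else 0

/-- The change of the excess of heads over tails among the decisions of a card. -/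
def dTurn (m : ℤ) (b : Bool) (φ : ℤ) : ℤ := if φ = m then -sgn b else 0

/-- A card with its location, its fluctuation, and the excess of heads over tails among its
decisions at position `m`. -/
structure Card where
  loc : ℤ
  acc : ℤ
  turn : ℤ

/-- One round, seen by a tracked card. -/
def cst (n m : ℤ) (c : Card) (b : Bool) : Card :=
  ⟨st n m b c.loc, c.acc + dAcc b c.loc, c.turn + dTurn m b c.loc⟩

/-- One round, seen by a family of cards. -/
def stv {ι : Type*} (n m : ℤ) (Z : ι → ℤ) (b : Bool) : ι → ℤ := fun x => st n m b (Z x)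

/-- One round, seen by a family of tracked cards. -/
def cstv {ι : Type*} (n m : ℤ) (C : ι → Card) (b : Bool) : ι → Card := fun x => cst n m (C x) b

/-- The locations of a family of tracked cards. -/
def locs {ι : Type*} (C : ι → Card) : ι → ℤ := fun x => (C x).loc

theorem locs_cstv {ι : Type*} (n m : ℤ) (C : ι → Card) (b : Bool) :
    locs (cstv n m C b) = stv n m (locs C) b := rfl

section Single

variable {n m φ ψ : ℤ} {b : Bool}

theorem Valid.st (hm : 2 ≤ m) (hn : m < n) (h : Valid n m φ) (b : Bool) :
    Valid n m (st n m b φ) := by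
  unfold Valid OverlappingCycles.st at *; cases b <;> simp <;> split_ifs <;> omega

theorem st_injOn (hm : 2 ≤ m) (hn : m < n) (h : Valid n m φ) (h' : Valid n m ψ)
    (e : st n m b φ = st n m b ψ) : φ = ψ := by
  unfold Valid OverlappingCycles.st at *; cases b <;> simp at e <;> split_ifs at e <;> omega

/-- In these coordinates every round is a unit drift plus martingale increments. `V` is `1` exactly
when a card at `m` sees tails, that is, enters the lower part, and `0` otherwise. -/
theorem st_eq (hm : 2 ≤ m) (h : Valid n m φ) (b : Bool) :
    ∃ V : ℤ, st n m b φ = φ + 1 + dAcc b φ - m * dTurn m b φ - 2 * n * V := by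
  rcases lt_trichotomy φ m with h1 | h1 | h1
  · refine ⟨0, ?_⟩
    unfold Valid OverlappingCycles.st dAcc dTurn sgn at *
    cases b <;> simp <;> split_ifs <;> omega
  · subst h1
    cases b
    · refine ⟨1, ?_⟩
      have : ¬ φ < 0 := by omega
      simp [OverlappingCycles.st, dAcc, dTurn, sgn, this]; ring
    · refine ⟨0, ?_⟩
      have : ¬ φ < 0 := by omega
      simp [OverlappingCycles.st, dAcc, dTurn, sgn, this]
  · unfold Valid at h; omega

/-- The reflection of the deck that reverses time. -/
def rev (n m φ : ℤ) : ℤ := if φ < 0 then 2 * m - 2 * n - φ else m + 1 - φ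

theorem Valid.rev (h : Valid n m φ) : Valid n m (rev n m φ) := by
  unfold Valid OverlappingCycles.rev at *; split_ifs <;> omega

theorem rev_rev (h : Valid n m φ) : rev n m (rev n m φ) = φ := by
  unfold Valid OverlappingCycles.rev at *; split_ifs <;> omega

/-- For each coin, `rev` after a round is an involution of the locations. Thus `rev` conjugates a
round to its inverse with the same coin. -/
theorem st_eq_rev_iff (hm : 2 ≤ m) (hn : m < n) (h : Valid n m φ) (h' : Valid n m ψ) (b : Bool) :
    st n m b φ = rev n m ψ ↔ st n m b ψ = rev n m φ := by
  unfold Valid OverlappingCycles.rev OverlappingCycles.st at *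
  cases b <;> simp <;> split_ifs <;> omega

/-- `clear r φ`: for `r` rounds, the effect of the coins on a card at `φ` depends only on the
number of heads. -/
def clear (m r φ : ℤ) : Prop := (0 < φ ∧ φ + r ≤ m) ∨ (φ + 2 * r < 0)

theorem clear.st {r : ℤ} (hr : 1 ≤ r) (h : clear m r φ) (b : Bool) :
    clear m (r - 1) (st n m b φ) := by
  unfold clear OverlappingCycles.st at *; cases b <;> simp <;> split_ifs <;> omega

/-- No decision and no passage between the two parts falls into the window, so each round adds a
number that depends on its coin alone. -/
theorem clear.comm {r : ℤ} (hr : 2 ≤ r) (h : clear m r φ) (b d : Bool) :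
    OverlappingCycles.st n m b (OverlappingCycles.st n m d φ) =
      OverlappingCycles.st n m d (OverlappingCycles.st n m b φ) := by
  unfold clear OverlappingCycles.st at *; cases b <;> cases d <;> simp <;> split_ifs <;> omega

/-- Between two decisions a card must cross the `m` upper positions at unit speed; each decision
spends `m` units of this travel. -/
theorem max_st_add_le (hm : 2 ≤ m) (hn : m < n) (φ : ℤ) (b : Bool) :
    max (OverlappingCycles.st n m b φ) 0 + (if φ = m then m else 0) ≤ 1 + max φ 0 := by
  unfold OverlappingCycles.st; cases b <;> simp <;> split_ifs <;> omega

/-- The number of decisions of a card within `t` rounds is at most `potential m t φ`. -/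
noncomputable def potential (m : ℤ) (t : ℕ) (φ : ℤ) : ℝ := ((t : ℝ) + (max φ 0 : ℤ)) / m

theorem potential_nonneg (hm : 2 ≤ m) (t : ℕ) (φ : ℤ) : 0 ≤ potential m t φ := by
  have : (0 : ℝ) ≤ m := by exact_mod_cast (by omega : 0 ≤ m)
  have h2 : (0 : ℝ) ≤ (max φ 0 : ℤ) := by exact_mod_cast le_max_right _ _
  unfold potential; positivity

theorem potential_le (hm : 2 ≤ m) (h : Valid n m φ) (t : ℕ) :
    potential m t φ ≤ t / m + 1 := by
  have : (0 : ℝ) < m := by exact_mod_cast (by omega : 0 < m)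
  have h2 : ((max φ 0 : ℤ) : ℝ) ≤ m := by
    unfold Valid at h; exact_mod_cast (by omega : max φ 0 ≤ m)
  unfold potential
  rw [add_div]
  gcongr
  rw [div_le_one this]; exact h2

theorem potential_st (hm : 2 ≤ m) (hn : m < n) (h : Valid n m φ) (b : Bool) (t : ℕ) :
    (if φ = m then (1 : ℝ) else 0) + potential m t (OverlappingCycles.st n m b φ) ≤
      potential m (t + 1) φ := by
  have h0 : (0 : ℝ) < m := by exact_mod_cast (by omega : 0 < m)
  have h1 := max_st_add_le hm hn φ b
  have h2 : ((max (OverlappingCycles.st n m b φ) 0 : ℤ) : ℝ) + (if φ = m then (m : ℝ) else 0)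
      ≤ 1 + (max φ 0 : ℤ) := by exact_mod_cast h1
  unfold potential
  rw [← sub_nonneg]
  have : ((t + 1 : ℕ) + ((max φ 0 : ℤ) : ℝ)) / m - ((if φ = m then (1 : ℝ) else 0) +
      (t + ((max (OverlappingCycles.st n m b φ) 0 : ℤ) : ℝ)) / m) =
      (1 + ((max φ 0 : ℤ) : ℝ) - (((max (OverlappingCycles.st n m b φ) 0 : ℤ) : ℝ) +
        (if φ = m then (m : ℝ) else 0))) / m := by
    push_cast
    split_ifs <;> field_simp <;> ring
  rw [this]
  apply div_nonneg (by linarith) h0.le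

end Single

section Family

variable {ι : Type*} {n m : ℤ}

/-- A family of distinct cards of the deck. -/
def Good (n m : ℤ) (Z : ι → ℤ) : Prop := (∀ x, Valid n m (Z x)) ∧ Function.Injective Z

theorem Good.stv (hm : 2 ≤ m) (hn : m < n) {Z : ι → ℤ} (h : Good n m Z) (b : Bool) :
    Good n m (stv n m Z b) :=
  ⟨fun x => (h.1 x).st hm hn b, fun x y e => h.2 (st_injOn hm hn (h.1 x) (h.1 y) e)⟩

theorem occ_decision_le (hm : 2 ≤ m) (hn : m < n) {Z : ι → ℤ} (h : ∀ x, Valid n m (Z x)) (x : ι)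
    (t : ℕ) : occ (stv n m) (fun Z => if Z x = m then 1 else 0) t Z ≤ potential m t (Z x) :=
  occ_le_of_potential (I := fun Z => ∀ x, Valid n m (Z x)) (f := stv n m)
    (fun _ b hs y => (hs y).st hm hn b) (fun t Z => potential m t (Z x))
    (fun _ _ => potential_nonneg hm _ _) (fun t _ b hs => potential_st hm hn (hs x) b t) t Z h

end Family

end OverlappingCycles

namespace OverlappingCycles

/-! ### Every card is often alone in the lower part, and often decides. -/

section Alone

variable {n m : ℤ}

/-- A lower bound for the probability that all decisions in the next `t` rounds are heads. -/
noncomputable def weight (m : ℤ) (t : ℕ) (Z : Fin 3 → ℤ) : ℝ :=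
  (1 / 2 : ℝ) ^ (∑ x, potential m t (Z x))

theorem weight_pos (t : ℕ) (Z : Fin 3 → ℤ) : 0 < weight m t Z := by unfold weight; positivity

theorem weight_le_one (hm : 2 ≤ m) (t : ℕ) (Z : Fin 3 → ℤ) : weight m t Z ≤ 1 :=
  Real.rpow_le_one (by norm_num) (by norm_num)
    (Finset.sum_nonneg fun x _ => potential_nonneg hm _ _)

theorem weight_st (hm : 2 ≤ m) (hn : m < n) {Z : Fin 3 → ℤ} (h : Good n m Z) (t : ℕ) (b : Bool) :
    weight m (t + 1) Z ≤ weight m t (stv n m Z b) := by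
  apply Real.rpow_le_rpow_of_exponent_ge (by norm_num) (by norm_num)
  refine Finset.sum_le_sum fun x _ => ?_
  have := potential_st hm hn (h.1 x) b t
  refine le_trans ?_ this
  have : (0 : ℝ) ≤ if Z x = m then 1 else 0 := by split_ifs <;> norm_num
  simp only [stv]; linarith

/-- At a decision only the branch of heads is kept, which costs a factor `1/2`; the potential drops
by `1` to pay for it. -/
theorem weight_st_decision (hm : 2 ≤ m) (hn : m < n) {Z : Fin 3 → ℤ} (h : Good n m Z) (t : ℕ)
    (b : Bool) (hd : ∃ x, Z x = m) : weight m (t + 1) Z ≤ weight m t (stv n m Z b) / 2 := by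
  obtain ⟨x, hx⟩ := hd
  have e : weight m t (stv n m Z b) / 2 =
      (1 / 2 : ℝ) ^ (∑ x, potential m t (stv n m Z b x) + 1) := by
    rw [Real.rpow_add (by norm_num)]; simp [weight]; ring
  rw [e]
  apply Real.rpow_le_rpow_of_exponent_ge (by norm_num) (by norm_num)
  have h1 : ∑ y, ((if Z y = m then (1 : ℝ) else 0) + potential m t (stv n m Z b y)) ≤
      ∑ y, potential m (t + 1) (Z y) :=
    Finset.sum_le_sum fun y _ => potential_st hm hn (h.1 y) b t
  rw [Finset.sum_add_distrib] at h1
  have h2 : (1 : ℝ) ≤ ∑ y, (if Z y = m then (1 : ℝ) else 0) := by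
    calc (1 : ℝ) = if Z x = m then (1 : ℝ) else 0 := by simp [hx]
      _ ≤ _ := Finset.single_le_sum (f := fun y => if Z y = m then (1 : ℝ) else 0)
          (fun y _ => by positivity) (Finset.mem_univ x)
  linarith

theorem le_weight (hm : 2 ≤ m) {Z : Fin 3 → ℤ} (h : Good n m Z) {t : ℕ} {B : ℝ}
    (hB : (t : ℝ) / m ≤ B) : (1 / 2 : ℝ) ^ (3 * (B + 1)) ≤ weight m t Z := by
  apply Real.rpow_le_rpow_of_exponent_ge (by norm_num) (by norm_num)
  calc ∑ x, potential m t (Z x) ≤ ∑ _x : Fin 3, (B + 1) :=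
        Finset.sum_le_sum fun x _ => (potential_le hm (h.1 x) t).trans (by linarith)
    _ = 3 * (B + 1) := by simp; ring

open Classical in
-- If all decisions are heads, no card enters the lower part, and the cards already there leave it
-- after `n - m` tails. In `4 n` rounds fewer tails have probability at most `1 / n` by Chebyshev.
theorem upper_reached (hm : 2 ≤ m) (hn : m < n) {Z : Fin 3 → ℤ} (h : Good n m Z) {T : ℕ}
    (hT : (T : ℤ) = 4 * n) :
    weight m T Z - 1 / n ≤ Ex (stv n m) T (fun Z => if ∀ x, 0 < Z x then 1 else 0) Z := by
  -- The chain is enlarged by a counter of tails.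
  let F : (Fin 3 → ℤ) × ℤ → Bool → (Fin 3 → ℤ) × ℤ :=
    fun s b => (stv n m s.1 b, s.2 + if b then 0 else 1)
  rw [← Ex_map (f := F) Prod.fst (fun _ _ => rfl) (fun Z => if ∀ x, 0 < Z x then (1 : ℝ) else 0) T
    (Z, 0)]
  have hn0 : (0 : ℝ) < n := by exact_mod_cast (by omega : 0 < n)
  have hTr : (T : ℝ) = 4 * n := by exact_mod_cast hT
  let cond : (Fin 3 → ℤ) × ℤ → Prop := fun s => ∀ x, 0 < s.1 x ∨ 2 * m - 2 * n + 1 + 2 * s.2 ≤ s.1 x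
  -- The subtracted term is the mean square of `2 (tails) - T` at the end, over `4 n²`: variance `t`
  -- for the rounds to come, and the deviation so far. It is `1 / n` at the start and at least `1`
  -- at the end if there were at most `n` tails.
  let W : ℕ → (Fin 3 → ℤ) × ℤ → ℝ := fun t s =>
    (if cond s then weight m t s.1 else 0) - ((2 * s.2 + t - T) ^ 2 + t) / (4 * n ^ 2)
  have key := Ex_ge_of_subsolution (f := F) (I := fun s => Good n m s.1)
    (fun s b hs => hs.stv hm hn b)
    (g := fun s => if ∀ x, 0 < s.1 x then (1 : ℝ) else 0) W ?_ ?_ T (Z, 0) h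
  · refine le_trans (le_of_eq ?_) key
    have hc : cond (Z, 0) := by
      intro x; have := h.1 x; unfold Valid at this; simp only; omega
    simp only [W, hc, if_true]
    simp only [Int.cast_zero, mul_zero, zero_add, sub_self, hTr]
    field_simp; ring
  · intro s hs
    simp only [W]
    by_cases hc : cond s
    · by_cases hk : s.2 < n - m
      · have h1 : (1 : ℝ) ≤ ((2 * s.2 + (0 : ℕ) - T) ^ 2 + (0 : ℕ)) / (4 * n ^ 2) := by
          rw [le_div_iff₀ (by positivity)]
          have : (s.2 : ℝ) ≤ n := by exact_mod_cast (by omega : s.2 ≤ n)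
          rw [hTr]; push_cast; nlinarith
        have h2 := weight_le_one hm 0 s.1
        simp only [hc, if_true]
        split_ifs <;> linarith
      · have hu : ∀ x, 0 < s.1 x := by
          intro x
          rcases hc x with h1 | h1
          · exact h1
          · omega
        have h2 := weight_le_one hm 0 s.1
        have h3 : 0 ≤ ((2 * (s.2 : ℝ) + (0 : ℕ) - T) ^ 2 + (0 : ℕ)) / (4 * n ^ 2) := by positivity
        simp only [hc, hu, if_true, implies_true]; linarith
    · have h3 : 0 ≤ ((2 * (s.2 : ℝ) + (0 : ℕ) - T) ^ 2 + (0 : ℕ)) / (4 * n ^ 2) := by positivity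
      simp only [hc, if_false]
      split_ifs <;> linarith
  · intro t s hs
    have hch : (((2 * ((F s true).2 : ℝ) + t - T) ^ 2 + t) / (4 * n ^ 2) +
        ((2 * ((F s false).2 : ℝ) + t - T) ^ 2 + t) / (4 * n ^ 2)) / 2 =
        ((2 * (s.2 : ℝ) + (t + 1 : ℕ) - T) ^ 2 + (t + 1 : ℕ)) / (4 * n ^ 2) := by
      simp only [F, Bool.false_eq_true, if_true, if_false]
      push_cast; ring
    have hnn : ∀ b, 0 ≤ if cond (F s b) then weight m t (F s b).1 else 0 := by
      intro b; split_ifs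
      · exact (weight_pos _ _).le
      · exact le_rfl
    have hmain : (if cond s then weight m (t + 1) s.1 else 0) ≤
        ((if cond (F s true) then weight m t (F s true).1 else 0) +
          (if cond (F s false) then weight m t (F s false).1 else 0)) / 2 := by
      by_cases hc : cond s
      · have ct : cond (F s true) := by
          intro x
          have := hc x; have h1 := hs.1 x
          unfold Valid at h1
          simp only [F, stv, st]; simp; split_ifs <;> omega
        by_cases hd : ∃ x, s.1 x = m
        · have := weight_st_decision hm hn hs t true hd
          have h2 := hnn false
          simp only [hc, ct, if_true]
          simp only [F] at *
          linarith
        · push Not at hd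
          have cf : cond (F s false) := by
            intro x
            have := hc x; have h1 := hs.1 x; have h2 := hd x
            unfold Valid at h1
            simp only [F, stv, st]; simp; split_ifs <;> omega
          have h1 := weight_st hm hn hs t true
          have h2 := weight_st hm hn hs t false
          simp only [hc, ct, cf, if_true]
          simp only [F] at *
          linarith
      · have h1 := hnn true
        have h2 := hnn false
        simp only [hc, if_false]; linarith
    simp only [W]
    linarith

open Classical in
-- Upper cards move deterministically apart from decisions; if these are all heads, every card stays
-- in the upper part and card `x` is at `m` after exactly `m - Z x` rounds.
theorem decision_reached (hm : 2 ≤ m) (hn : m < n) {Z : Fin 3 → ℤ} (h : Good n m Z) (x : Fin 3)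
    (hZ : ∀ y, 0 < Z y) {u : ℕ} (hu : Z x + u = m) :
    weight m u Z ≤ Ex (stv n m) u (fun Z => if Z x = m ∧ ∀ y, 0 < Z y then 1 else 0) Z := by
  let W : ℕ → (Fin 3 → ℤ) → ℝ := fun t Z =>
    if Z x + t = m ∧ ∀ y, 0 < Z y then weight m t Z else 0
  have key := Ex_ge_of_subsolution (f := stv n m) (I := fun s => Good n m s)
    (fun s b hs => hs.stv hm hn b)
    (g := fun Z => if Z x = m ∧ ∀ y, 0 < Z y then (1 : ℝ) else 0) W ?_ ?_ u Z h
  · simpa only [W, hu, hZ, true_and, implies_true, if_true] using key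
  · intro s hs
    simp only [W, Nat.cast_zero, add_zero]
    split_ifs
    · exact weight_le_one hm _ _
    · exact le_rfl
  · intro t s hs
    have hnn : ∀ b, 0 ≤ W t (stv n m s b) := by
      intro b; simp only [W]; split_ifs
      · exact (weight_pos _ _).le
      · exact le_rfl
    by_cases hc : s x + (t + 1 : ℕ) = m ∧ ∀ y, 0 < s y
    · have hW : W (t + 1) s = weight m (t + 1) s := by simp only [W]; rw [if_pos hc]
      have step : ∀ b, (b = true ∨ ∀ y, s y ≠ m) → W t (stv n m s b) = weight m t (stv n m s b) := by
        intro b hb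
        simp only [W]; rw [if_pos]
        obtain ⟨h1, h2⟩ := hc
        push_cast at h1
        refine ⟨?_, fun y => ?_⟩
        · have := h2 x; simp only [stv, st]; split_ifs <;> omega
        · have := h2 y
          simp only [stv, st]
          rcases hb with rfl | hb
          · simp; split_ifs <;> omega
          · have := hb y; have h3 := hs.1 y; unfold Valid at h3; split_ifs <;> omega
      rw [hW]
      by_cases hd : ∃ y, s y = m
      · have := weight_st_decision hm hn hs t true hd
        rw [step true (Or.inl rfl)]
        have := hnn false
        linarith
      · push Not at hd
        rw [step true (Or.inl rfl), step false (Or.inr hd)]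
        linarith [weight_st hm hn hs t true, weight_st hm hn hs t false]
    · have hW : W (t + 1) s = 0 := by simp only [W]; rw [if_neg hc]
      rw [hW]; linarith [hnn true, hnn false]

open Classical in
-- Markov property: bring all cards up in `4 n` rounds, then let card `x` reach `m` in at most `m`
-- rounds. It reduces occupation bounds to states where `x` decides and all cards are in the upper
-- part.
theorem occ_ge_of_decision (hm : 2 ≤ m) (hn : m < n) {Z : Fin 3 → ℤ} (h : Good n m Z) (x : Fin 3)
    {T K : ℕ} (hT : (T : ℤ) = 4 * n) (hK : (K : ℤ) = m) {q : (Fin 3 → ℤ) → ℝ} (hq : ∀ Z, 0 ≤ q Z)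
    {β w : ℝ} (hβ : 0 ≤ β) (hw : ∀ Z, Good n m Z → ∀ t ≤ T, w ≤ weight m t Z) (hw0 : 0 ≤ w) (t : ℕ)
    (hocc : ∀ Z, Good n m Z → Z x = m → (∀ y, 0 < Z y) → β ≤ occ (stv n m) q t Z) :
    β * w * (w - 1 / n) ≤ occ (stv n m) q (T + (K + t)) Z := by
  have up : ∀ Z, Good n m Z → (∀ y, 0 < Z y) → β * w ≤ occ (stv n m) q (K + t) Z := by
    intro Z hZ hpos
    have h1 := hZ.1 x
    have h2 := hpos x
    obtain ⟨u, hu⟩ : ∃ u : ℕ, Z x + u = m := ⟨(m - Z x).toNat, by unfold Valid at h1; omega⟩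
    calc β * w ≤ β * weight m u Z := by
          gcongr; exact hw Z hZ u (by omega)
      _ ≤ β * Ex (stv n m) u (fun Z => if Z x = m ∧ ∀ y, 0 < Z y then 1 else 0) Z := by
          gcongr; exact decision_reached hm hn hZ x hpos hu
      _ = Ex (stv n m) u (fun Z => β * if Z x = m ∧ ∀ y, 0 < Z y then 1 else 0) Z :=
          (Ex_mul _ _ _ _).symm
      _ ≤ Ex (stv n m) u (occ (stv n m) q t) Z := by
          refine Ex_mono_of_inv (I := Good n m) (fun s b hs => Good.stv hm hn hs b) (fun s hs => ?_) u Z hZ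
          split_ifs with hc
          · simpa using hocc s hs hc.1 hc.2
          · simpa using occ_nonneg hq t s
      _ ≤ occ (stv n m) q (u + t) Z := by
          rw [occ_add]; linarith [occ_nonneg (f := stv n m) hq u Z]
      _ ≤ occ (stv n m) q (K + t) Z := occ_le_occ hq (by omega) Z
  calc β * w * (w - 1 / n) ≤
        β * w * Ex (stv n m) T (fun Z => if ∀ x, 0 < Z x then 1 else 0) Z := by
        gcongr
        exact le_trans (by linarith [hw Z h T le_rfl]) (upper_reached hm hn h hT)
    _ = Ex (stv n m) T (fun Z => β * w * if ∀ x, 0 < Z x then 1 else 0) Z :=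
        (Ex_mul _ _ _ _).symm
    _ ≤ Ex (stv n m) T (occ (stv n m) q (K + t)) Z := by
        refine Ex_mono_of_inv (I := Good n m) (fun s b hs => Good.stv hm hn hs b) (fun s hs => ?_) T Z h
        split_ifs with hc
        · simpa using up s hs hc
        · simpa using occ_nonneg hq _ s
    _ ≤ _ := by rw [occ_add]; linarith [occ_nonneg (f := stv n m) hq T Z]

open Classical in
/-- Card `x` is in the lower part of the deck and the other cards are strictly above position
`m`. -/
noncomputable def alone (m : ℤ) (x : Fin 3) (Z : Fin 3 → ℤ) : ℝ :=
  if Z x < 0 ∧ ∀ y, y ≠ x → 0 < Z y ∧ Z y < m then 1 else 0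

theorem alone_nonneg (x : Fin 3) (Z : Fin 3 → ℤ) : 0 ≤ alone m x Z := by
  unfold alone; split_ifs <;> norm_num

theorem alone_le_one (x : Fin 3) (Z : Fin 3 → ℤ) : alone m x Z ≤ 1 := by
  unfold alone; split_ifs <;> norm_num

open Classical in
-- Card `x` is too low to leave, since it climbs at most `2` per round; the others stay up as long
-- as their decisions are heads.
theorem lower_remains (hm : 2 ≤ m) (hn : m < n) {Z : Fin 3 → ℤ} (h : Good n m Z) (x : Fin 3)
    (hZ : ∀ y, y ≠ x → 0 < Z y) {t : ℕ} (ht : Z x + 2 * t < 0) :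
    weight m t Z ≤
      Ex (stv n m) t (fun Z => if Z x < 0 ∧ ∀ y, y ≠ x → 0 < Z y then 1 else 0) Z := by
  let W : ℕ → (Fin 3 → ℤ) → ℝ := fun t Z =>
    if Z x + 2 * t < 0 ∧ ∀ y, y ≠ x → 0 < Z y then weight m t Z else 0
  have key := Ex_ge_of_subsolution (f := stv n m) (I := fun s => Good n m s)
    (fun s b hs => hs.stv hm hn b)
    (g := fun Z => if Z x < 0 ∧ ∀ y, y ≠ x → 0 < Z y then (1 : ℝ) else 0) W ?_ ?_ t Z h
  · simp only [W] at key; rwa [if_pos ⟨ht, hZ⟩] at key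
  · intro s hs
    simp only [W, Nat.cast_zero, mul_zero, add_zero]
    split_ifs
    · exact weight_le_one hm _ _
    · exact le_rfl
  · intro t s hs
    have hnn : ∀ b, 0 ≤ W t (stv n m s b) := by
      intro b; simp only [W]; split_ifs
      · exact (weight_pos _ _).le
      · exact le_rfl
    by_cases hc : s x + 2 * (t + 1 : ℕ) < 0 ∧ ∀ y, y ≠ x → 0 < s y
    · have hW : W (t + 1) s = weight m (t + 1) s := by simp only [W]; rw [if_pos hc]
      have step : ∀ b, (b = true ∨ ∀ y, s y ≠ m) → W t (stv n m s b) = weight m t (stv n m s b) := by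
        intro b hb
        simp only [W]; rw [if_pos]
        obtain ⟨h1, h2⟩ := hc
        push_cast at h1
        refine ⟨?_, fun y hy => ?_⟩
        · simp only [stv, st]; split_ifs <;> omega
        · have := h2 y hy
          simp only [stv, st]
          rcases hb with rfl | hb
          · simp; split_ifs <;> omega
          · have := hb y; have h3 := hs.1 y; unfold Valid at h3; split_ifs <;> omega
      rw [hW]
      by_cases hd : ∃ y, s y = m
      · have := weight_st_decision hm hn hs t true hd
        rw [step true (Or.inl rfl)]
        have := hnn false
        linarith
      · push Not at hd
        rw [step true (Or.inl rfl), step false (Or.inr hd)]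
        linarith [weight_st hm hn hs t true, weight_st hm hn hs t false]
    · have hW : W (t + 1) s = 0 := by simp only [W]; rw [if_neg hc]
      rw [hW]; linarith [hnn true, hnn false]

open Classical in
theorem occ_alone_of_bottom (hm : 2 ≤ m) (hn : m < n) {Z : Fin 3 → ℤ} (h : Good n m Z) (x : Fin 3)
    (hx : Z x = 2 * m + 1 - 2 * n) (hZ : ∀ y, y ≠ x → 0 < Z y) {K : ℕ} (hK : (K : ℤ) = n - m)
    {w : ℝ} (hw : ∀ Z, Good n m Z → ∀ t ≤ K, w ≤ weight m t Z) :
    K * w - 3 * (K / m + 1) ≤ occ (stv n m) (alone m x) K Z := by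
  -- Being alone also requires the other cards to be off position `m`. The exceptional rounds are
  -- charged to the number of decisions, which is bounded.
  have h1 : ∀ Z, (if Z x < 0 ∧ ∀ y, y ≠ x → 0 < Z y then (1 : ℝ) else 0) -
      ∑ y, (if Z y = m then (1 : ℝ) else 0) ≤ if Good n m Z then alone m x Z else 1 := by
    intro Z
    have hs : 0 ≤ ∑ y, (if Z y = m then (1 : ℝ) else 0) :=
      Finset.sum_nonneg fun y _ => by positivity
    split_ifs with hc hg hg
    · by_cases hd : ∃ y, Z y = m
      · obtain ⟨y, hy⟩ := hd
        have h2 : (1 : ℝ) ≤ ∑ y, (if Z y = m then (1 : ℝ) else 0) := by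
          calc (1 : ℝ) = if Z y = m then (1 : ℝ) else 0 := by simp [hy]
            _ ≤ _ := Finset.single_le_sum (f := fun y => if Z y = m then (1 : ℝ) else 0)
                (fun y _ => by positivity) (Finset.mem_univ y)
        linarith [alone_nonneg (m := m) x Z]
      · push Not at hd
        have : alone m x Z = 1 := by
          unfold alone; rw [if_pos]
          refine ⟨hc.1, fun y hy => ⟨hc.2 y hy, ?_⟩⟩
          have := hg.1 y; have := hd y; have := hc.2 y hy
          unfold Valid at *; omega
        rw [this]; linarith
    · linarith
    · linarith [alone_nonneg (m := m) x Z]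
    · linarith
  have h2 : ∑ u ∈ Finset.range K, (Ex (stv n m) u
      (fun Z => if Z x < 0 ∧ ∀ y, y ≠ x → 0 < Z y then (1 : ℝ) else 0) Z -
      ∑ y, Ex (stv n m) u (fun Z => if Z y = m then (1 : ℝ) else 0) Z) ≤
      ∑ u ∈ Finset.range K, Ex (stv n m) u (alone m x) Z := by
    refine Finset.sum_le_sum fun u _ => ?_
    rw [← Ex_sum, ← Ex_sub]
    refine Ex_mono_of_inv (I := Good n m) (fun s b hs => Good.stv hm hn hs b) (fun s hs => ?_) u Z h
    simpa [hs] using h1 s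
  rw [← occ_eq_sum, Finset.sum_sub_distrib, Finset.sum_comm] at h2
  have h3 : (K : ℝ) * w ≤ ∑ u ∈ Finset.range K, Ex (stv n m) u
      (fun Z => if Z x < 0 ∧ ∀ y, y ≠ x → 0 < Z y then (1 : ℝ) else 0) Z := by
    calc (K : ℝ) * w = ∑ u ∈ Finset.range K, w := by simp
      _ ≤ _ := by
        refine Finset.sum_le_sum fun u hu => ?_
        have hu := Finset.mem_range.1 hu
        exact (hw Z h u hu.le).trans (lower_remains hm hn h x hZ (by omega))
  have h4 : ∑ y, ∑ u ∈ Finset.range K, Ex (stv n m) u (fun Z => if Z y = m then (1 : ℝ) else 0) Z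
      ≤ 3 * (K / m + 1) := by
    calc _ ≤ ∑ _y : Fin 3, ((K : ℝ) / m + 1) := by
          refine Finset.sum_le_sum fun y _ => ?_
          rw [← occ_eq_sum]
          exact (occ_decision_le hm hn h.1 y K).trans (potential_le hm (h.1 y) K)
      _ = _ := by simp; ring
  linarith

/-- The number of times that one card is alone in the lower part, and the number of decisions of a
card, within `6 n` rounds. -/
theorem occ_alone_and_decision (ε : ℝ) (hε : 0 < ε) : ∃ κ : ℝ, 0 < κ ∧ ∃ n₀ : ℝ, ∀ n m : ℤ, 2 ≤ m →
    m < n → ε * n ≤ m → ε * n ≤ n - m → n₀ ≤ n → ∀ L : ℕ, (L : ℤ) = 6 * n → ∀ Z, Good n m Z →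
    ∀ x, κ * n ≤ occ (stv n m) (alone m x) L Z ∧
      κ ≤ occ (stv n m) (fun Z => if Z x = m then 1 else 0) L Z := by
  -- At most `4 n / m ≤ 4 / ε` rounds per unit of `m`, hence at most `4 / ε + 1` decisions for each
  -- of three cards.
  set w : ℝ := (1 / 2 : ℝ) ^ (3 * (4 / ε + 1)) with hw
  have hw0 : 0 < w := by positivity
  refine ⟨min (ε * w ^ 3 / 8) (w ^ 2 / 2), by positivity,
    max (2 / w) (6 * (4 / ε + 1) / (ε * w)), ?_⟩
  intro n m hm hn h1 h2 hn0 L hL Z hZ x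
  have hmr : (0 : ℝ) < m := by exact_mod_cast (by omega : 0 < m)
  have hnr : (0 : ℝ) < n := by exact_mod_cast (by omega : 0 < n)
  have hm1 : (n : ℝ) / m ≤ 1 / ε := by
    rw [div_le_div_iff₀ hmr hε]; linarith
  obtain ⟨T, hT⟩ : ∃ T : ℕ, (T : ℤ) = 4 * n := ⟨(4 * n).toNat, by omega⟩
  obtain ⟨M, hM⟩ : ∃ T : ℕ, (T : ℤ) = m := ⟨m.toNat, by omega⟩
  obtain ⟨K, hK⟩ : ∃ T : ℕ, (T : ℤ) = n - m := ⟨(n - m).toNat, by omega⟩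
  have hTr : (T : ℝ) = 4 * n := by exact_mod_cast hT
  have hKr : (K : ℝ) = n - m := by exact_mod_cast hK
  have hwt : ∀ Z, Good n m Z → ∀ t ≤ T, w ≤ weight m t Z := by
    intro Z hZ t ht
    refine le_weight hm hZ ?_
    calc (t : ℝ) / m ≤ T / m := by gcongr
      _ = 4 * (n / m) := by rw [hTr]; ring
      _ ≤ 4 * (1 / ε) := by gcongr
      _ = 4 / ε := by ring
  have hwn : w / 2 ≤ w - 1 / n := by
    have h3 : 2 / w ≤ n := (le_max_left _ _).trans hn0
    have : 1 / (n : ℝ) ≤ w / 2 := by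
      rw [div_le_div_iff₀ hnr (by norm_num)]
      rw [div_le_iff₀ hw0] at h3; linarith
    linarith
  constructor
  -- Tails at the decision of `x` puts it at the bottom of its passage through the lower part, where
  -- it stays for at least `n - m` rounds.
  · have hocc : ∀ Z, Good n m Z → Z x = m → (∀ y, 0 < Z y) →
        ε * w * n / 4 ≤ occ (stv n m) (alone m x) (1 + K) Z := by
      intro Z hZ hx hpos
      have hg := hZ.stv hm hn false
      have hb := occ_alone_of_bottom hm hn hg x (K := K) (w := w) ?_ ?_ hK
        (fun Z hZ t ht => hwt Z hZ t (by omega))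
      · have e : occ (stv n m) (alone m x) (1 + K) Z = alone m x Z +
            (occ (stv n m) (alone m x) K (stv n m Z true) +
              occ (stv n m) (alone m x) K (stv n m Z false)) / 2 := by
          rw [add_comm, occ_succ]
        rw [e]
        have h3 := alone_nonneg (m := m) x Z
        have h4 := occ_nonneg (f := stv n m) (alone_nonneg (m := m) x) K (stv n m Z true)
        have h5 : 6 * (4 / ε + 1) / (ε * w) ≤ n := (le_max_right _ _).trans hn0
        rw [div_le_iff₀ (by positivity)] at h5
        have h6 : (K : ℝ) / m ≤ 4 / ε := by
          calc (K : ℝ) / m ≤ n / m := by gcongr; linarith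
            _ ≤ 1 / ε := hm1
            _ ≤ 4 / ε := by gcongr; norm_num
        have h7 : ε * n * w ≤ K * w := by rw [hKr]; gcongr
        linarith
      · have : ¬ m < 0 := by omega
        simp [stv, st, hx, this]
      · intro y hy
        have h8 := hpos y
        have h9 : Z y ≠ m := fun e => hy (hZ.2 (e.trans hx.symm))
        have := hZ.1 y
        unfold Valid at this
        simp only [stv, st]; split_ifs <;> omega
    have key := occ_ge_of_decision hm hn hZ x hT hM (alone_nonneg x) (by positivity) hwt hw0.le
      (1 + K) hocc
    have hle : occ (stv n m) (alone m x) (T + (M + (1 + K))) Z ≤ occ (stv n m) (alone m x) L Z :=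
      occ_le_occ (alone_nonneg x) (by omega) Z
    calc min (ε * w ^ 3 / 8) (w ^ 2 / 2) * n ≤ ε * w ^ 3 / 8 * n := by gcongr; exact min_le_left _ _
      _ = ε * w * n / 4 * w * (w / 2) := by ring
      _ ≤ ε * w * n / 4 * w * (w - 1 / n) := by gcongr
      _ ≤ _ := key.trans hle
  · have hq : ∀ Z : Fin 3 → ℤ, (0 : ℝ) ≤ if Z x = m then 1 else 0 := fun Z => by
      split_ifs <;> norm_num
    have key := occ_ge_of_decision hm hn hZ x hT hM hq (β := 1) (by norm_num) hwt hw0.le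
      1 (fun Z _ hx _ => by simp [occ, hx])
    have hle := occ_le_occ (f := stv n m) hq (by omega : T + (M + 1) ≤ L) Z
    calc min (ε * w ^ 3 / 8) (w ^ 2 / 2) ≤ w ^ 2 / 2 := min_le_right _ _
      _ = 1 * w * (w / 2) := by ring
      _ ≤ 1 * w * (w - 1 / n) := by gcongr
      _ ≤ _ := key.trans hle

end Alone

end OverlappingCycles

namespace OverlappingCycles

/-! ### Tracked cards, maximal inequality and persistence of separation. -/

section Tracks

variable {ι : Type*} {n m : ℤ}

/-- The locations, fluctuations and decision excesses `C` can be reached from locations `Z` in `t`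
rounds. -/
def Rel (n m : ℤ) (Z : ι → ℤ) (t : ℤ) (C : ι → Card) : Prop :=
  ∀ x, ∃ V : ℤ, (C x).loc = Z x + t + (C x).acc - m * (C x).turn - 2 * n * V

theorem Rel.step (hm : 2 ≤ m) {Z : ι → ℤ} {t : ℤ} {C : ι → Card} (h : Rel n m Z t C)
    (hv : ∀ x, Valid n m (C x).loc) (b : Bool) : Rel n m Z (t + 1) (cstv n m C b) := by
  intro x
  obtain ⟨V, hV⟩ := h x
  obtain ⟨V', hV'⟩ := st_eq hm (hv x) b
  refine ⟨V + V', ?_⟩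
  simp only [cstv, cst]
  rw [hV']; linear_combination hV

/-- The tracked cards at the beginning. -/
def fresh (Z : ι → ℤ) : ι → Card := fun x => ⟨Z x, 0, 0⟩

theorem rel_fresh (Z : ι → ℤ) : Rel n m Z 0 (fresh Z) := fun x => ⟨0, by simp [fresh]⟩

/-- Some card has a fluctuation above `α` or a decision excess above `υ`. -/
def Exceeds (α υ : ℝ) (C : ι → Card) : Prop :=
  ∃ x, α < |((C x).acc : ℝ)| ∨ υ < |((C x).turn : ℝ)|

/-- The tracked cards together with a flag for an excess in the past. -/
noncomputable def flagStep (n m : ℤ) (α υ : ℝ) (s : (ι → Card) × Bool) (b : Bool) :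
    (ι → Card) × Bool :=
  (cstv n m s.1 b, s.2 || @decide (Exceeds α υ (cstv n m s.1 b)) (Classical.dec _))

theorem acc_sq_step (b : Bool → Card) (c : Card) (h : ∀ d, b d = cst n m c d) :
    ((((b true).acc : ℝ)) ^ 2 + ((b false).acc : ℝ) ^ 2) / 2 =
      (c.acc : ℝ) ^ 2 + (if c.loc < 0 then 1 else 0) := by
  rw [h, h]
  by_cases hc : c.loc < 0 <;> simp [cst, dAcc, sgn, hc]
  ring

theorem turn_sq_step (b : Bool → Card) (c : Card) (h : ∀ d, b d = cst n m c d) :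
    ((((b true).turn : ℝ)) ^ 2 + ((b false).turn : ℝ) ^ 2) / 2 =
      (c.turn : ℝ) ^ 2 + (if c.loc = m then 1 else 0) := by
  rw [h, h]
  by_cases hc : c.loc = m <;> simp [cst, dTurn, sgn, hc]
  ring

open Classical in
-- A maximal inequality for the martingales `acc` and `turn`, whose quadratic variations are at most
-- the number of rounds and of decisions.
theorem Ex_flag_le [Fintype ι] (hm : 2 ≤ m) (hn : m < n) {α υ : ℝ} (hα : 0 < α) (hυ : 0 < υ)
    {Z : ι → ℤ} (hZ : ∀ x, Valid n m (Z x)) (t : ℕ) :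
    Ex (flagStep n m α υ) t (fun s => if s.2 = true then 1 else 0) (fresh Z, false) ≤
      Fintype.card ι * (t / α ^ 2 + (t / m + 1) / υ ^ 2) := by
  -- Squares so far plus the quadratic variation still to come: a supermartingale that is at least
  -- `1` whenever a threshold is exceeded.
  let P : ℕ → (ι → Card) → ℝ := fun t C =>
    ∑ x, (((C x).acc ^ 2 + t) / α ^ 2 + ((C x).turn ^ 2 + potential m t (C x).loc) / υ ^ 2)
  have hterm : ∀ t (C : ι → Card) x, 0 ≤ (((C x).acc : ℝ) ^ 2 + t) / α ^ 2 +
      (((C x).turn : ℝ) ^ 2 + potential m t (C x).loc) / υ ^ 2 := by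
    intro t C x
    have := potential_nonneg hm t (C x).loc
    positivity
  have hP0 : ∀ t C, 0 ≤ P t C := fun t C => Finset.sum_nonneg fun x _ => hterm t C x
  have hP1 : ∀ t C, Exceeds α υ C → 1 ≤ P t C := by
    rintro t C ⟨x, hx⟩
    refine le_trans ?_ (Finset.single_le_sum (fun y _ => hterm t C y) (Finset.mem_univ x))
    have h0 := potential_nonneg hm t (C x).loc
    rcases hx with hx | hx
    · have h1 : 1 ≤ (((C x).acc : ℝ) ^ 2 + t) / α ^ 2 := by
        rw [le_div_iff₀ (by positivity), ← sq_abs ((C x).acc : ℝ)]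
        nlinarith [Nat.cast_nonneg (α := ℝ) t]
      have : 0 ≤ (((C x).turn : ℝ) ^ 2 + potential m t (C x).loc) / υ ^ 2 := by positivity
      linarith
    · have h1 : 1 ≤ (((C x).turn : ℝ) ^ 2 + potential m t (C x).loc) / υ ^ 2 := by
        rw [le_div_iff₀ (by positivity), ← sq_abs ((C x).turn : ℝ)]
        nlinarith
      have : 0 ≤ (((C x).acc : ℝ) ^ 2 + t) / α ^ 2 := by positivity
      linarith
  have hPstep : ∀ t C, (∀ x, Valid n m (C x).loc) →
      (P t (cstv n m C true) + P t (cstv n m C false)) / 2 ≤ P (t + 1) C := by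
    intro t C hC
    simp only [P]
    rw [← Finset.sum_add_distrib, Finset.sum_div]
    refine Finset.sum_le_sum fun x _ => ?_
    have h1 := acc_sq_step (n := n) (m := m) (fun d => cstv n m C d x) (C x) (fun _ => rfl)
    have h2 := turn_sq_step (n := n) (m := m) (fun d => cstv n m C d x) (C x) (fun _ => rfl)
    have h3 := potential_st hm hn (hC x) true t
    have h4 := potential_st hm hn (hC x) false t
    have h5 : (if (C x).loc < 0 then (1 : ℝ) else 0) ≤ 1 := by split_ifs <;> norm_num
    have e1 : ((((cstv n m C true x).acc : ℝ) ^ 2 + t) + (((cstv n m C false x).acc : ℝ) ^ 2 + t)) / 2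
        ≤ ((C x).acc : ℝ) ^ 2 + (t + 1 : ℕ) := by push_cast; linarith
    have e2 : ((((cstv n m C true x).turn : ℝ) ^ 2 + potential m t (cstv n m C true x).loc) +
        (((cstv n m C false x).turn : ℝ) ^ 2 + potential m t (cstv n m C false x).loc)) / 2
        ≤ ((C x).turn : ℝ) ^ 2 + potential m (t + 1) (C x).loc := by
      simp only [cstv, cst] at *; linarith
    have := div_le_div_of_nonneg_right e1 (by positivity : 0 ≤ α ^ 2)
    have := div_le_div_of_nonneg_right e2 (by positivity : 0 ≤ υ ^ 2)
    calc _ = ((((cstv n m C true x).acc : ℝ) ^ 2 + t) + (((cstv n m C false x).acc : ℝ) ^ 2 + t)) / 2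
          / α ^ 2 + ((((cstv n m C true x).turn : ℝ) ^ 2 + potential m t (cstv n m C true x).loc) +
        (((cstv n m C false x).turn : ℝ) ^ 2 + potential m t (cstv n m C false x).loc)) / 2 / υ ^ 2 := by
          ring
      _ ≤ _ := by linarith
  have key := Ex_le_of_supersolution (f := flagStep n m α υ) (I := fun s => ∀ x, Valid n m (s.1 x).loc)
    (g := fun s => if s.2 = true then (1 : ℝ) else 0)
    (fun s b hs x => (hs x).st hm hn b)
    (fun t s => if s.2 = true then 1 else P t s.1) ?_ ?_ t (fresh Z, false) hZ
  · refine key.trans ?_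
    simp only [Bool.false_eq_true, if_false, P]
    rw [← nsmul_eq_mul, ← Finset.card_univ, ← Finset.sum_const]
    refine Finset.sum_le_sum fun x _ => ?_
    have := potential_le hm (hZ x) t
    simp only [fresh, Int.cast_zero]
    have e2 : ((0 : ℝ) ^ 2 + potential m t (Z x)) / υ ^ 2 ≤ (t / m + 1) / υ ^ 2 := by
      apply div_le_div_of_nonneg_right _ (by positivity); linarith
    have e1 : ((0 : ℝ) ^ 2 + t) / α ^ 2 = t / α ^ 2 := by ring
    linarith
  · intro s _
    split_ifs
    · exact le_rfl
    · exact hP0 0 s.1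
  · intro t s hs
    by_cases hb : s.2 = true
    · simp [flagStep, hb]
    · have h1 : ∀ b, (if (flagStep n m α υ s b).2 = true then 1 else P t (flagStep n m α υ s b).1) ≤
          P t (cstv n m s.1 b) := by
        intro b
        split_ifs with h
        · simp only [flagStep, hb, Bool.false_or, decide_eq_true_eq] at h
          apply hP1
          simpa [hb] using h
        · exact le_rfl
      have h2 := hPstep t s.1 hs
      rw [if_neg hb]
      linarith [h1 true, h1 false]

/-- `u` is at distance more than `ρ` from `0`. -/
def Sep (n m : ℤ) (ρ : ℝ) (u : ℤ) : Prop :=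
  ∀ a b q : ℤ, u = a + b * m + q * (2 * n - m + 1) → ρ < |(a : ℝ)| + |(b : ℝ)| * √n

/-- The loss of separation while fluctuations stay below `α` and decision excesses below `υ`. -/
noncomputable def loss (n : ℤ) (α υ : ℝ) : ℝ := 2 * α + 2 * υ * √n + (1 + √n) * (2 + α / n + υ)

theorem Valid.abs_le {φ : ℤ} (h : Valid n m φ) (hm : 2 ≤ m) (hn : m < n) : |φ| ≤ 2 * n := by
  unfold Valid at h; rw [_root_.abs_le]; omega

theorem Valid.abs_sub_lt {φ ψ : ℤ} (h : Valid n m φ) (h' : Valid n m ψ) (hm : 2 ≤ m)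
    (hn : m < n) : |φ - ψ| < 2 * n - m := by
  unfold Valid at h h'; rw [abs_lt]; omega

/-- A representation of the present difference turns into one of the initial difference by undoing
the bounded changes of `acc`, of `turn` and of the number of laps. -/
theorem Sep.of_rel (hm : 2 ≤ m) (hn : m < n) {Z : ι → ℤ} {t : ℤ} {C : ι → Card} {α υ ρ : ℝ}
    (h : Rel n m Z t C) (hZ : ∀ x, Valid n m (Z x)) (hC : ∀ x, Valid n m (C x).loc)
    (hE : ¬ Exceeds α υ C) {x y : ι} (hs : Sep n m ρ (Z x - Z y)) :
    Sep n m (ρ - loss n α υ) ((C x).loc - (C y).loc) := by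
  intro a b q e
  obtain ⟨V, hV⟩ := h x
  obtain ⟨V', hV'⟩ := h y
  simp only [Exceeds, not_exists, not_or, not_lt] at hE
  have hnr : (0 : ℝ) < n := by exact_mod_cast (by omega : 0 < n)
  have hmr : (0 : ℝ) < m := by exact_mod_cast (by omega : 0 < m)
  have hmn : (m : ℝ) ≤ n := by exact_mod_cast hn.le
  -- The laps enter through `2 n = (2 n - m + 1) + m - 1`: each one changes the three coefficients
  -- by `1`, `1` and `-1`.
  have key := hs (a - ((C x).acc - (C y).acc) - (V - V')) (b + ((C x).turn - (C y).turn) + (V - V'))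
    (q + (V - V')) (by linear_combination hV' - hV + e)
  push_cast at key
  obtain ⟨h1, h2⟩ := hE x
  obtain ⟨h3, h4⟩ := hE y
  have d1 : |(((Z x - Z y : ℤ)) : ℝ)| ≤ 2 * n := by
    have := (hZ x).abs_sub_lt (hZ y) hm hn
    exact_mod_cast (by omega : |Z x - Z y| ≤ 2 * n)
  have d2 : |((((C x).loc - (C y).loc : ℤ)) : ℝ)| ≤ 2 * n := by
    have := (hC x).abs_sub_lt (hC y) hm hn
    exact_mod_cast (by omega : |(C x).loc - (C y).loc| ≤ 2 * n)
  have hυ : 0 ≤ υ := (abs_nonneg _).trans h2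
  -- Locations differ by less than `2 n`, so the difference of the lap numbers is determined by the
  -- other terms up to a bounded error.
  have hVV : |((V : ℝ) - V')| ≤ 2 + α / n + υ := by
    have e1 : 2 * (n : ℝ) * (V - V') = ((Z x - Z y : ℤ) : ℝ) + ((C x).acc - (C y).acc) -
        m * ((C x).turn - (C y).turn) - (((C x).loc - (C y).loc : ℤ) : ℝ) := by
      have : 2 * n * (V - V') = (Z x - Z y) + ((C x).acc - (C y).acc) -
        m * ((C x).turn - (C y).turn) - ((C x).loc - (C y).loc) := by linear_combination hV - hV'
      have := congrArg (Int.cast : ℤ → ℝ) this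
      push_cast at this ⊢; linarith
    have e2 : |2 * (n : ℝ) * (V - V')| ≤ 2 * n + (α + α) + n * (υ + υ) + 2 * n := by
      rw [e1]
      have t1 := abs_sub ((C x).acc : ℝ) (C y).acc
      have t2 := abs_sub ((C x).turn : ℝ) (C y).turn
      have t3 : |(m : ℝ) * ((C x).turn - (C y).turn)| ≤ n * (υ + υ) := by
        rw [abs_mul, abs_of_pos hmr]
        have : |((C x).turn : ℝ) - (C y).turn| ≤ υ + υ := by linarith
        gcongr
      have t4 := abs_sub (((Z x - Z y : ℤ) : ℝ) + ((C x).acc - (C y).acc) -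
        m * ((C x).turn - (C y).turn)) (((C x).loc - (C y).loc : ℤ) : ℝ)
      have t5 := abs_sub (((Z x - Z y : ℤ) : ℝ) + ((C x).acc - (C y).acc))
        (m * ((C x).turn - (C y).turn))
      have t6 := abs_add_le (((Z x - Z y : ℤ) : ℝ)) (((C x).acc : ℝ) - (C y).acc)
      linarith
    rw [abs_mul, abs_of_pos (by positivity)] at e2
    have : 2 * (n : ℝ) * (2 + α / n + υ) = 2 * n + (α + α) + n * (υ + υ) + 2 * n := by
      field_simp; ring
    rw [← this] at e2
    exact le_of_mul_le_mul_left e2 (by positivity)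
  have hs0 := Real.sqrt_nonneg (n : ℝ)
  have f1 : |(a : ℝ) - ((C x).acc - (C y).acc) - (V - V')| ≤ |(a : ℝ)| + 2 * α + (2 + α / n + υ) := by
    have t1 := abs_sub ((C x).acc : ℝ) (C y).acc
    have t2 := abs_sub (a : ℝ) ((C x).acc - (C y).acc)
    have t3 := abs_sub ((a : ℝ) - ((C x).acc - (C y).acc)) (V - V')
    linarith
  have f2 : |(b : ℝ) + ((C x).turn - (C y).turn) + (V - V')| ≤
      |(b : ℝ)| + 2 * υ + (2 + α / n + υ) := by
    have t1 := abs_sub ((C x).turn : ℝ) (C y).turn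
    have t2 := abs_add_le (b : ℝ) ((C x).turn - (C y).turn)
    have t3 := abs_add_le ((b : ℝ) + ((C x).turn - (C y).turn)) (V - V')
    linarith
  have f3 := mul_le_mul_of_nonneg_right f2 hs0
  unfold loss
  nlinarith

end Tracks

end OverlappingCycles

namespace OverlappingCycles

/-! ### Coupling of a card with a nearby replacement. -/

section Coupling

variable {n m : ℤ}

theorem stv_vec (e j k : ℤ) (b : Bool) :
    stv n m ![e, j, k] b = ![st n m b e, st n m b j, st n m b k] := by
  funext x; fin_cases x <;> rfl

theorem vec_eta (Z : Fin 3 → ℤ) : ![Z 0, Z 1, Z 2] = Z := by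
  funext x; fin_cases x <;> rfl

/-- The mean of `F` after `t` rounds, for three cards at `e`, `j` and `k`. -/
noncomputable def val (n m : ℤ) (F : (Fin 3 → ℤ) → ℝ) (t : ℕ) (e j k : ℤ) : ℝ :=
  Ex (stv n m) t F ![e, j, k]

theorem val_succ (F : (Fin 3 → ℤ) → ℝ) (t : ℕ) (e j k : ℤ) :
    val n m F (t + 1) e j k = (val n m F t (st n m true e) (st n m true j) (st n m true k) +
      val n m F t (st n m false e) (st n m false j) (st n m false k)) / 2 := by
  simp only [val, Ex_succ, stv_vec]

/-- The mean of `F` when the first card will use the coin `d`, instead of the next coin, for its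
decision at position `m`. -/
noncomputable def pend (n m : ℤ) (F : (Fin 3 → ℤ) → ℝ) : ℕ → Bool → ℤ → ℤ → ℤ → ℝ
  | 0, _, e, j, k => F ![e, j, k]
  | t + 1, d, e, j, k =>
    if e = m then
      (val n m F t (st n m d m) (st n m true j) (st n m true k) +
        val n m F t (st n m d m) (st n m false j) (st n m false k)) / 2
    else
      (pend n m F t d (e + 1) (st n m true j) (st n m true k) +
        pend n m F t d (e + 1) (st n m false j) (st n m false k)) / 2

theorem pend_abs_le {F : (Fin 3 → ℤ) → ℝ} (hF : ∀ Z, 0 ≤ F Z ∧ F Z ≤ 1) (t : ℕ) (d : Bool)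
    (e j k : ℤ) : 0 ≤ pend n m F t d e j k ∧ pend n m F t d e j k ≤ 1 := by
  have hv : ∀ t e j k, 0 ≤ val n m F t e j k ∧ val n m F t e j k ≤ 1 := fun t e j k =>
    ⟨Ex_nonneg (fun Z => (hF Z).1) _ _, by
      simpa [Ex_const, val] using Ex_mono (f := stv n m) (fun Z => (hF Z).2) t ![e, j, k]⟩
  induction t generalizing e j k with
  | zero => exact hF _
  | succ t ih =>
    simp only [pend]
    split_ifs
    · have h1 := hv t (st n m d m) (st n m true j) (st n m true k)
      have h2 := hv t (st n m d m) (st n m false j) (st n m false k)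
      constructor <;> linarith [h1.1, h1.2, h2.1, h2.2]
    · have h1 := ih (e + 1) (st n m true j) (st n m true k)
      have h2 := ih (e + 1) (st n m false j) (st n m false k)
      constructor <;> linarith [h1.1, h1.2, h2.1, h2.2]

theorem st_upper {e : ℤ} (h : 0 < e) (h' : e < m) (b : Bool) : st n m b e = e + 1 := by
  unfold st; split_ifs <;> omega

/-- The coin of the present round and the coin of the decision of the first card can be swapped. -/
theorem val_eq_pend (F : (Fin 3 → ℤ) → ℝ) (t : ℕ) {e j k : ℤ} (he : 0 < e) (he' : e < m)
    (hj : clear m (m - e + 1) j) (hk : clear m (m - e + 1) k) :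
    val n m F (t + 1) e j k = (pend n m F t true (e + 1) (st n m true j) (st n m true k) +
      pend n m F t false (e + 1) (st n m false j) (st n m false k)) / 2 := by
  induction t generalizing e j k with
  | zero =>
    rw [val_succ]; simp [val, pend, st_upper he he']
  | succ t ih =>
    have cj := hj.comm (n := n) (by omega)
    have ck := hk.comm (n := n) (by omega)
    rw [val_succ, st_upper he he', st_upper he he']
    by_cases h1 : e + 1 = m
    · rw [val_succ, val_succ, h1]
      simp only [pend, if_true]
      rw [cj false true, ck false true]; ring
    · have hd : ∀ b, clear m (m - (e + 1) + 1) (st n m b j) := fun b => by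
        have := hj.st (n := n) (by omega) b
        rwa [show m - (e + 1) + 1 = m - e + 1 - 1 by ring]
      have hd' : ∀ b, clear m (m - (e + 1) + 1) (st n m b k) := fun b => by
        have := hk.st (n := n) (by omega) b
        rwa [show m - (e + 1) + 1 = m - e + 1 - 1 by ring]
      rw [ih (by omega) (by omega) (hd true) (hd' true), ih (by omega) (by omega) (hd false) (hd' false)]
      simp only [pend, h1, if_false]
      rw [cj false true, ck false true]; ring

open Classical in
/-- The motion of the partner of card `0` in the coupling.  Its state consists of its location, of the
stored coin for its next decision, and of its distance to card `0`. -/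
noncomputable def upd (n m : ℤ) (Z : Fin 3 → ℤ) (x : ℤ × Option Bool × ℤ) (b : Bool) :
    ℤ × Option Bool × ℤ :=
  match x.2.1 with
  | none =>
    if Z 0 = m then (x.1 + 1, some b, x.2.2)
    else if Z 0 < 0 ∧ ∀ y, y ≠ 0 → 0 < Z y ∧ Z y < m then
      (st n m (!b) x.1, none, x.2.2 + 2 * sgn b)
    else (st n m b x.1, none, st n m b (Z 0) - st n m b x.1)
  | some true => if x.1 = m then (1, none, x.2.2) else (x.1 + 1, some true, x.2.2)
  | some false =>
    if x.1 = m then (2 * m + 1 - 2 * n, none, x.2.2 + sgn b)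
    else (x.1 + 1, some false, x.2.2 + sgn b)

/-- Card `0` at `z` is ahead of its partner by the recorded distance. -/
def Linked (n m z : ℤ) (x : ℤ × Option Bool × ℤ) : Prop :=
  Valid n m x.1 ∧
  match x.2.1 with
  | none => z - x.1 = x.2.2
  | some true => 0 < x.1 ∧ 0 < z ∧ z - x.1 + m = x.2.2
  | some false => 0 < x.1 ∧ z < 0 ∧ z + 2 * n - m - x.1 = x.2.2

/-- The distance cannot jump over `0`: steps of size `2` occur only when both cards are in the lower
part, where the distance is even. The bounds on `R` prevent a card from getting ahead by a whole
passage of the upper or the lower part. Distance `0` with no stored coin means that the decks agree.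
-/
theorem linked_upd (hm : 2 ≤ m) (hn : m < n) {R : ℤ} (hR : R ≤ m) (hR' : R ≤ n - m) {Z : Fin 3 → ℤ}
    (hZ : Valid n m (Z 0)) {x : ℤ × Option Bool × ℤ} (h : Linked n m (Z 0) x) (h0 : 0 < x.2.2)
    (h1 : x.2.2 < R) (b : Bool) :
    Linked n m (st n m b (Z 0)) (upd n m Z x b) ∧ 0 ≤ (upd n m Z x b).2.2 ∧
      (upd n m Z x b).2.2 ≤ x.2.2 + 2 ∧ ((upd n m Z x b).2.2 = 0 → (upd n m Z x b).2.1 = none) := by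
  obtain ⟨e, d, g⟩ := x
  obtain ⟨hv, hl⟩ := h
  simp only at *
  rcases d with _ | _ | _
  · simp only at hl
    simp only [upd]
    split_ifs with c1 c2
    · cases b <;> simp [Linked, Valid, st] at * <;> split_ifs <;> omega
    · cases b <;> simp [Linked, Valid, st, sgn] at * <;> split_ifs <;> omega
    · clear c2
      cases b <;> simp [Linked, Valid, st] at * <;> split_ifs <;> omega
  · simp only at hl
    simp only [upd]
    split_ifs with c1
    · cases b <;> simp [Linked, Valid, st, sgn] at * <;> split_ifs <;> omega
    · cases b <;> simp [Linked, Valid, st, sgn] at * <;> split_ifs <;> omega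
  · simp only at hl
    simp only [upd]
    split_ifs with c1
    · cases b <;> simp [Linked, Valid, st] at * <;> split_ifs <;> omega
    · cases b <;> simp [Linked, Valid, st] at * <;> split_ifs <;> omega

/-- The two coins change the distance by opposite amounts, so it is a martingale, and it moves
whenever card `0` is alone in the lower part. -/
theorem upd_increment (hm : 2 ≤ m) (hn : m < n) {R : ℤ} (hR : R ≤ m) {Z : Fin 3 → ℤ}
    (hZ : Valid n m (Z 0)) {x : ℤ × Option Bool × ℤ} (h : Linked n m (Z 0) x) (h0 : 0 < x.2.2)
    (h1 : x.2.2 < R) :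
    ∃ c : ℤ, (upd n m Z x true).2.2 = x.2.2 - c ∧ (upd n m Z x false).2.2 = x.2.2 + c ∧
      alone m 0 Z ≤ (c : ℝ) ^ 2 := by
  classical
  obtain ⟨e, d, g⟩ := x
  obtain ⟨hv, hl⟩ := h
  have ha : alone m 0 Z ≤ 1 := by unfold alone; split_ifs <;> norm_num
  simp only at *
  rcases d with _ | _ | _
  · simp only at hl
    simp only [upd]
    split_ifs with c1 c2
    · refine ⟨0, by simp, by simp, ?_⟩
      have : ¬ Z 0 < 0 := by omega
      simp [alone, this]
    · exact ⟨2, by simp [sgn]; ring, by simp [sgn], ha.trans (by norm_num)⟩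
    · have : alone m 0 Z = 0 := by unfold alone; rw [if_neg c2]
      rw [this]
      by_cases c3 : 0 < Z 0 ∧ e < 0
      · refine ⟨-1, ?_, ?_, by norm_num⟩ <;> simp [Valid, st] at * <;> split_ifs <;> omega
      · refine ⟨0, ?_, ?_, by norm_num⟩ <;> simp [Valid, st] at * <;> split_ifs <;> omega
  · refine ⟨1, ?_, ?_, by simpa using ha⟩ <;> simp only [upd] <;> split_ifs <;> simp [sgn] <;> ring
  · refine ⟨0, ?_, ?_, ?_⟩
    · simp only [upd]; split_ifs <;> simp
    · simp only [upd]; split_ifs <;> simp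
    · have : ¬ Z 0 < 0 := by simp only at hl; omega
      simp [alone, this]

/-- The states of the coupling: the tracked cards with their flag, and the partner of card `0`. -/
abbrev Coupled : Type := ((Fin 3 → Card) × Bool) × (ℤ × Option Bool × ℤ)

/-- The coupling still runs. -/
def Active (R : ℤ) (s : Coupled) : Prop := 0 < s.2.2.2 ∧ s.2.2.2 < R ∧ s.1.2 = false

open Classical in
/-- One round of the coupling. -/
noncomputable def coupleStep (n m R : ℤ) (α υ : ℝ) (s : Coupled) (b : Bool) : Coupled :=
  (flagStep n m α υ s.1 b, if Active R s then upd n m (locs s.1.1) s.2 b else s.2)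

/-- The invariant of the coupling. -/
def CoupleInv (n m R : ℤ) (α υ : ℝ) (Z : Fin 3 → ℤ) (s : Coupled) : Prop :=
  Good n m (locs s.1.1) ∧ (∃ t, Rel n m Z t s.1.1) ∧ (s.1.2 = false → ¬ Exceeds α υ s.1.1) ∧
    0 ≤ s.2.2.2 ∧ s.2.2.2 ≤ R + 1 ∧ (Active R s → Linked n m (s.1.1 0).loc s.2)

variable {R : ℤ} {α υ : ℝ} {Z : Fin 3 → ℤ}

theorem not_active_coupleStep {s : Coupled} (h : ¬ Active R s) (b : Bool) :
    ¬ Active R (coupleStep n m R α υ s b) ∧ (coupleStep n m R α υ s b).2 = s.2 := by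
  have e : (coupleStep n m R α υ s b).2 = s.2 := by simp only [coupleStep, if_neg h]
  refine ⟨fun ha => h ?_, e⟩
  simp only [Active, e] at ha
  refine ⟨ha.1, ha.2.1, ?_⟩
  have := ha.2.2
  simp only [coupleStep, flagStep, Bool.or_eq_false_iff] at this
  exact this.1

theorem CoupleInv.step (hm : 2 ≤ m) (hn : m < n) (hR : R ≤ m) (hR' : R ≤ n - m)
    {s : Coupled} (h : CoupleInv n m R α υ Z s) (b : Bool) :
    CoupleInv n m R α υ Z (coupleStep n m R α υ s b) := by
  obtain ⟨h1, ⟨t, h2⟩, h3, h4, h5, h6⟩ := h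
  have hl : Active R s → _ := fun ha => linked_upd hm hn hR hR' (Z := locs s.1.1) (h1.1 0) (h6 ha)
    ha.1 ha.2.1 b
  refine ⟨h1.stv hm hn b, ⟨t + 1, h2.step hm h1.1 b⟩, ?_, ?_, ?_, ?_⟩
  · intro hb
    simp only [coupleStep, flagStep, Bool.or_eq_false_iff, decide_eq_false_iff_not] at hb
    exact hb.2
  · simp only [coupleStep]
    split_ifs with ha
    · exact (hl ha).2.1
    · exact h4
  · simp only [coupleStep]
    split_ifs with ha
    · have := (hl ha).2.2.1; have := ha.2.1; omega
    · exact h5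
  · intro ha'
    have ha : Active R s := by
      by_contra ha
      exact (not_active_coupleStep ha b).1 ha'
    have e : (coupleStep n m R α υ s b).2 = upd n m (locs s.1.1) s.2 b := by
      simp only [coupleStep, if_pos ha]
    rw [e]
    exact (hl ha).1

/-- The mean of `F` for the copy of the deck in which card `0` is replaced by its partner. -/
noncomputable def partnerVal (n m : ℤ) (F : (Fin 3 → ℤ) → ℝ) (t : ℕ) (s : Coupled) : ℝ :=
  match s.2.2.1 with
  | none => val n m F t s.2.1 (s.1.1 1).loc (s.1.1 2).loc
  | some d => pend n m F t d s.2.1 (s.1.1 1).loc (s.1.1 2).loc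

/-- A card that is not clear is just above `m`, at small distance from `m`, or about to come to the
top, and then `m - φ` is `m` plus a small number. Both contradict separation from a card at `m`. -/
theorem clear_of_sep {ρ : ℝ} {φ r : ℤ} (hφ : Valid n m φ)
    (hs : Sep n m ρ (m - φ)) (hr : r ≤ R + 1) (hρ : 2 * (R : ℝ) + 4 + √n ≤ ρ) (hR0 : 0 < R) :
    clear m r φ := by
  by_contra hc
  unfold clear at hc
  push Not at hc
  have hs0 := Real.sqrt_nonneg (n : ℝ)
  have hRr : (0 : ℝ) < R := by exact_mod_cast hR0
  rcases hφ with h | h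
  · have h1 := hs (m - φ) 0 0 (by ring)
    have h2 : |((m - φ : ℤ) : ℝ)| ≤ R + 1 := by
      have := hc.1 h.1
      exact_mod_cast (by rw [abs_le]; omega : |m - φ| ≤ R + 1)
    simp at h1 h2
    linarith
  · have h1 := hs (-φ) 1 0 (by ring)
    have h2 : |((-φ : ℤ) : ℝ)| ≤ 2 * R + 2 := by
      have := hc.2
      exact_mod_cast (by rw [abs_le]; omega : |-φ| ≤ 2 * R + 2)
    simp at h1 h2
    linarith

/-- The mean for the replaced deck obeys its own averaging recursion along the coupling, so the two
means differ at most by the probability of not having met. The stopped states need only the trivial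
bound `1`. -/
theorem abs_partner_le {F : (Fin 3 → ℤ) → ℝ} (hF : ∀ Z, 0 ≤ F Z ∧ F Z ≤ 1) {ρ : ℝ} (hm : 2 ≤ m)
    (hn : m < n) (hR : R ≤ m) (hR' : R ≤ n - m) (hρ : 2 * (R : ℝ) + 4 + √n + loss n α υ ≤ ρ)
    (hZ : ∀ x, Valid n m (Z x))
    (h1 : Sep n m ρ (Z 0 - Z 1)) (h2 : Sep n m ρ (Z 0 - Z 2)) (t : ℕ) (s : Coupled)
    (hs : CoupleInv n m R α υ Z s) (hmet : s.2.2.2 = 0 → s.2.2.1 = none ∧ s.2.1 = (s.1.1 0).loc) :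
    |Ex (stv n m) t F (locs s.1.1) - partnerVal n m F t s| ≤
      Ex (coupleStep n m R α υ) t (fun s => if s.2.2.2 = 0 then 0 else 1) s := by
  have hv : ∀ t Z, 0 ≤ Ex (stv n m) t F Z ∧ Ex (stv n m) t F Z ≤ 1 := fun t Z =>
    ⟨Ex_nonneg (fun Z => (hF Z).1) _ _, by
      simpa [Ex_const] using Ex_mono (f := stv n m) (fun Z => (hF Z).2) t Z⟩
  have hp : ∀ t s, 0 ≤ partnerVal n m F t s ∧ partnerVal n m F t s ≤ 1 := by
    intro t s
    unfold partnerVal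
    split
    · exact hv _ _
    · exact pend_abs_le hF _ _ _ _ _
  have hfail : ∀ t s, (0 : ℝ) ≤ Ex (coupleStep n m R α υ) t
      (fun s => if s.2.2.2 = 0 then 0 else 1) s := fun t s =>
    Ex_nonneg (fun s => by split_ifs <;> norm_num) t s
  have hone : ∀ t s, |Ex (stv n m) t F (locs s.1.1) - partnerVal n m F t s| ≤ 1 := fun t s => by
    rw [abs_le]
    constructor <;> linarith [hv t (locs s.1.1), hp t s]
  have hlocs : ∀ s : Coupled, locs s.1.1 = ![(s.1.1 0).loc, (s.1.1 1).loc, (s.1.1 2).loc] :=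
    fun s => (vec_eta _).symm
  induction t generalizing s with
  | zero =>
    by_cases hg : s.2.2.2 = 0
    · obtain ⟨e1, e2⟩ := hmet hg
      simp [partnerVal, e1, e2, val, hlocs s, hg]
    · simpa [hg] using hone 0 s
  | succ t ih =>
    by_cases hg : s.2.2.2 = 0
    · obtain ⟨e1, e2⟩ := hmet hg
      have : |Ex (stv n m) (t + 1) F (locs s.1.1) - partnerVal n m F (t + 1) s| = 0 := by
        simp [partnerVal, e1, e2, val, hlocs s]
      rw [this]; exact hfail _ _
    · by_cases ha : Active R s
      · have hl := hs.2.2.2.2.2 ha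
        have hmet' : ∀ b, (coupleStep n m R α υ s b).2.2.2 = 0 →
            (coupleStep n m R α υ s b).2.2.1 = none ∧
              (coupleStep n m R α υ s b).2.1 = ((coupleStep n m R α υ s b).1.1 0).loc := by
          intro b h0
          have hu := linked_upd hm hn hR hR' (Z := locs s.1.1) (hs.1.1 0) hl ha.1 ha.2.1 b
          simp only [coupleStep, if_pos ha] at h0 ⊢
          have hd := hu.2.2.2 h0
          refine ⟨hd, ?_⟩
          have := hu.1.2
          rw [hd] at this
          simp only at this
          simp only [flagStep, cstv, cst, locs] at this ⊢
          omega
        have i1 := ih _ (hs.step hm hn hR hR' true) (hmet' true)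
        have i2 := ih _ (hs.step hm hn hR hR' false) (hmet' false)
        have main : partnerVal n m F (t + 1) s = (partnerVal n m F t (coupleStep n m R α υ s true) +
            partnerVal n m F t (coupleStep n m R α υ s false)) / 2 := by
          have ec : ∀ b, (coupleStep n m R α υ s b).2 = upd n m (locs s.1.1) s.2 b := fun b => by
            simp only [coupleStep, if_pos ha]
          have ec1 : ∀ b x, ((coupleStep n m R α υ s b).1.1 x).loc = st n m b (s.1.1 x).loc :=
            fun b x => rfl
          obtain ⟨c, e, d, g⟩ := s
          have hRpos : 0 < R := by have := ha.1; have := ha.2.1; omega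
          simp only [partnerVal, ec, ec1]
          rcases d with _ | _ | _
          · simp only [upd]
            by_cases c1 : locs c.1 0 = m
            · simp only [c1, if_true]
              have hgR := ha.2.1
              have hg0 := ha.1
              have hl2 := hl.2
              obtain ⟨⟨hgood, _⟩, ⟨u, hrel⟩, hex, -⟩ := hs
              simp only [locs] at *
              have hgR' : g ≤ R := by omega
              -- The replacement is `g` rounds short of its decision, so the window has `g + 1 ≤ R +
              -- 1` rounds; separation makes it clear for cards `1` and `2`.
              apply val_eq_pend
              · omega
              · omega
              · have := h1.of_rel hm hn hrel hZ hgood (hex ha.2.2)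
                rw [c1] at this
                exact clear_of_sep (hgood 1) this (R := R) (by omega) (by linarith) hRpos
              · have := h2.of_rel hm hn hrel hZ hgood (hex ha.2.2)
                rw [c1] at this
                exact clear_of_sep (hgood 2) this (R := R) (by omega) (by linarith) hRpos
            · simp only [c1, if_false]
              -- When card `0` is alone in the lower part, cards `1` and `2` advance by `1` under
              -- both coins, so exchanging the coins does not affect the mean of the replaced deck.
              by_cases c2 : locs c.1 0 < 0 ∧ ∀ y, y ≠ 0 → 0 < locs c.1 y ∧ locs c.1 y < m
              · have hj := c2.2 1 (by decide)
                have hk := c2.2 2 (by decide)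
                simp only [locs] at hj hk
                have key : ∀ b, (c.1 1).loc + 1 = st n m b (c.1 1).loc ∧
                    (c.1 2).loc + 1 = st n m b (c.1 2).loc := fun b =>
                  ⟨(st_upper hj.1 hj.2 b).symm, (st_upper hk.1 hk.2 b).symm⟩
                rw [if_pos c2, if_pos c2, val_succ]
                simp only [← (key true).1, ← (key true).2, ← (key false).1, ← (key false).2,
                  Bool.not_true, Bool.not_false]
                rw [add_comm]
              · simp only [c2, if_false, val_succ]
          · simp only [upd, pend]
            split_ifs with c1
            · have : ¬ m < 0 := by omega
              simp [st, this]
            · rfl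
          · simp only [upd, pend]
            split_ifs with c1
            · have : ¬ m < 0 := by omega
              simp [st, this]
            · rfl
        rw [Ex_succ, Ex_succ]
        have e3 : ∀ b, stv n m (locs s.1.1) b = locs (coupleStep n m R α υ s b).1.1 := fun b => rfl
        rw [e3, e3]
        rw [abs_le] at i1 i2 ⊢
        rw [main]; constructor <;> linarith
      · have : ∀ t s, s.2.2.2 ≠ 0 → ¬ Active R s → Ex (coupleStep n m R α υ) t
            (fun s => if s.2.2.2 = 0 then (0 : ℝ) else 1) s = 1 := by
          intro t
          induction t with
          | zero => intro s h _; simp [h]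
          | succ t ih =>
            intro s h h'
            have a1 := not_active_coupleStep (n := n) (m := m) (α := α) (υ := υ) h' true
            have a2 := not_active_coupleStep (n := n) (m := m) (α := α) (υ := υ) h' false
            rw [Ex_succ, ih _ (by rw [a1.2]; exact h) a1.1, ih _ (by rw [a2.2]; exact h) a2.1]
            norm_num
        rw [this _ s hg ha]
        exact hone _ s

end Coupling

end OverlappingCycles

namespace OverlappingCycles

/-! ### Bounds for the two stages of coalescence. -/

section Coalescence

variable {n m : ℤ}

/-- Two decks that differ only in one card coalesce quickly if this card and its replacement are
close. -/
theorem abs_val_sub_le_of_close {F : (Fin 3 → ℤ) → ℝ} (hF : ∀ Z, 0 ≤ F Z ∧ F Z ≤ 1)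
    {ρ α υ κ : ℝ} {R : ℤ} (hα : 0 < α) (hυ : 0 < υ) (hκ : 0 < κ) (hm : 2 ≤ m) (hn : m < n)
    (hR : R ≤ m) (hR' : R ≤ n - m) (hρ : 2 * (R : ℝ) + 4 + √n + loss n α υ ≤ ρ)
    {L : ℕ} (hL : ∀ Z, Good n m Z → κ ≤ occ (stv n m) (alone m 0) L Z) {Q t : ℕ} (hQ : 0 < Q)
    (ht : Q * L ≤ t) {i e j k : ℤ} (hZ : Good n m ![i, j, k]) (he : Valid n m e) (h0 : e < i)
    (h1 : i - e < R) (hj : Sep n m ρ (i - j)) (hk : Sep n m ρ (i - k)) :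
    |val n m F t i j k - val n m F t e j k| ≤
      ((R + 1) * (i - e : ℤ) + L) / (κ * Q) + (i - e : ℤ) / R +
        3 * (t / α ^ 2 + (t / m + 1) / υ ^ 2) := by
  classical
  set Z : Fin 3 → ℤ := ![i, j, k] with hZdef
  set s₀ : Coupled := ((fresh Z, false), (e, none, i - e)) with hs₀
  have hRpos : (0 : ℝ) < R := by exact_mod_cast (by omega : 0 < R)
  have hI := fun (s : Coupled) (b : Bool) (h : CoupleInv n m R α υ Z s) => h.step hm hn hR hR' b
  have hinv : CoupleInv n m R α υ Z s₀ := by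
    refine ⟨hZ, ⟨0, rel_fresh Z⟩, fun _ => ?_, ?_, ?_, fun _ => ⟨he, ?_⟩⟩
    · simp [Exceeds, fresh, hs₀, hα.le, hυ.le]
    · simp only [hs₀]; omega
    · simp only [hs₀]; omega
    · simp [hs₀, fresh, hZdef]
  have key := abs_partner_le hF hm hn hR hR' hρ hZ.1 hj hk t s₀ hinv (by
    intro h; simp only [hs₀] at h; omega)
  have e1 : Ex (stv n m) t F (locs s₀.1.1) = val n m F t i j k := rfl
  have e2 : partnerVal n m F t s₀ = val n m F t e j k := rfl
  rw [e1, e2] at key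
  refine key.trans ?_
  -- If the decks have not met, then the coupling is still running, or the distance has reached `R`
  -- (Markov's inequality for a martingale), or a track has been exceeded.
  have hfail : Ex (coupleStep n m R α υ) t (fun s => if s.2.2.2 = 0 then (0 : ℝ) else 1) s₀ ≤
      Ex (coupleStep n m R α υ) t (fun s => ((if Active R s then (1 : ℝ) else 0) +
        (1 / R : ℝ) * (s.2.2.2 : ℝ)) + (if s.1.2 = true then (1 : ℝ) else 0)) s₀ := by
    refine Ex_mono_of_inv hI (fun s hs => ?_) t s₀ hinv
    have hg := hs.2.2.2.1
    have hgr : (0 : ℝ) ≤ s.2.2.2 := by exact_mod_cast hg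
    have p1 : (0 : ℝ) ≤ if Active R s then (1 : ℝ) else 0 := by split_ifs <;> norm_num
    have p2 : (0 : ℝ) ≤ (1 / R : ℝ) * (s.2.2.2 : ℝ) := by positivity
    have p3 : (0 : ℝ) ≤ if s.1.2 = true then (1 : ℝ) else 0 := by split_ifs <;> norm_num
    by_cases c1 : s.2.2.2 = 0
    · rw [if_pos c1]; linarith
    · rw [if_neg c1]
      by_cases c2 : s.2.2.2 < R
      · by_cases c3 : s.1.2 = true
        · rw [if_pos c3]; linarith
        · have : Active R s := ⟨by omega, c2, by simpa using c3⟩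
          rw [if_pos this]; linarith
      · have : (1 : ℝ) ≤ (1 / R : ℝ) * (s.2.2.2 : ℝ) := by
          rw [one_div, inv_mul_eq_div, le_div_iff₀ hRpos, one_mul]
          exact_mod_cast (by omega : R ≤ s.2.2.2)
        linarith
  refine hfail.trans ?_
  rw [Ex_add (fun s : Coupled => (if Active R s then (1 : ℝ) else 0) + (1 / R : ℝ) * (s.2.2.2 : ℝ)),
    Ex_add (fun s : Coupled => (if Active R s then (1 : ℝ) else 0)), Ex_mul]
  have hrest := fun (s : Coupled) (b : Bool) (h : ¬ Active R s) =>
    not_active_coupleStep (n := n) (m := m) (α := α) (υ := υ) h b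
  have hinc : ∀ s : Coupled, CoupleInv n m R α υ Z s → Active R s → ∃ c : ℤ,
      (coupleStep n m R α υ s true).2.2.2 = s.2.2.2 - c ∧
      (coupleStep n m R α υ s false).2.2.2 = s.2.2.2 + c ∧
      alone m 0 (locs s.1.1) ≤ (c : ℝ) ^ 2 := by
    intro s hs ha
    simp only [coupleStep, if_pos ha]
    exact upd_increment hm hn hR (Z := locs s.1.1) (hs.1.1 0) (hs.2.2.2.2.2 ha) ha.1 ha.2.1
  have hmart : ∀ s : Coupled, CoupleInv n m R α υ Z s → Active R s →
      (((coupleStep n m R α υ s true).2.2.2 : ℝ) + ((coupleStep n m R α υ s false).2.2.2 : ℝ)) / 2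
        = (s.2.2.2 : ℝ) := by
    intro s hs ha
    obtain ⟨c, h1, h2, -⟩ := hinc s hs ha
    rw [h1, h2]; push_cast; ring
  have hactive := Ex_active_le (f := coupleStep n m R α υ) (I := CoupleInv n m R α υ Z) hI (Active R)
    (h := fun s => (s.2.2.2 : ℝ)) (q := fun s => alone m 0 (locs s.1.1)) (L := L) (κ := κ)
    (lam := L) (R := R + 1) hκ
    (fun s b _ ha => ⟨(hrest s b ha).1, by rw [(hrest s b ha).2]⟩) hmart
    (fun s hs ha => by
      obtain ⟨c, h1, h2, h3⟩ := hinc s hs ha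
      rw [h1, h2]; push_cast
      nlinarith)
    (fun s t hs ht => by
      refine (occ_le_of_potential (I := fun _ => True) (fun _ _ _ => trivial)
        (fun t _ => (t : ℝ)) (fun _ _ => by simp) (fun t s b _ => ?_) t s trivial).trans
        (by exact_mod_cast ht)
      push_cast; linarith [alone_le_one (m := m) 0 (locs s.1.1)])
    (fun s hs _ => by
      rw [occ_map (f' := stv n m) (fun s : Coupled => locs s.1.1) (fun _ _ => rfl) (alone m 0)]
      exact hL _ hs.1)
    (fun s hs => by exact_mod_cast hs.2.2.2.1)
    (fun s hs => by exact_mod_cast hs.2.2.2.2.1) hQ ht s₀ hinv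
  have hgmean : Ex (coupleStep n m R α υ) t (fun s => (s.2.2.2 : ℝ)) s₀ = (i - e : ℤ) := by
    refine Ex_eq_of_martingale hI (fun s hs => ?_) t s₀ hinv
    by_cases ha : Active R s
    · exact hmart s hs ha
    · rw [(hrest s true ha).2, (hrest s false ha).2]; ring
  have hflag : Ex (coupleStep n m R α υ) t (fun s => if s.1.2 = true then (1 : ℝ) else 0) s₀ ≤
      3 * (t / α ^ 2 + (t / m + 1) / υ ^ 2) := by
    rw [Ex_map (f' := flagStep n m α υ) (fun s : Coupled => s.1) (fun _ _ => rfl)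
      (fun s => if s.2 = true then (1 : ℝ) else 0)]
    have := Ex_flag_le hm hn hα hυ hZ.1 t
    simpa using this
  rw [hgmean]
  have e3 : (1 / R : ℝ) * ((i - e : ℤ) : ℝ) = (i - e : ℤ) / R := by ring
  rw [e3]
  have e4 : (s₀.2.2.2 : ℝ) = ((i - e : ℤ) : ℝ) := rfl
  rw [e4] at hactive
  linarith

/-- Four cards of the same deck with a flag, and the number of steps `y` by which card `3` lags behind
card `0` in decisions. -/
abbrev Chase : Type := ((Fin 4 → Card) × Bool) × ℤ

/-- The chase still runs. -/
def Chasing (R : ℤ) (s : Chase) : Prop := 0 < s.2 ∧ s.2 < R ∧ s.1.2 = false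

open Classical in
/-- One round of the chase. -/
noncomputable def chaseStep (n m R : ℤ) (α υ : ℝ) (s : Chase) (b : Bool) : Chase :=
  (flagStep n m α υ s.1 b,
    if Chasing R s then s.2 + dTurn m b (s.1.1 0).loc - dTurn m b (s.1.1 3).loc else s.2)

/-- The invariant of the chase. -/
def ChaseInv (n m R : ℤ) (α υ : ℝ) (Z : Fin 4 → ℤ) (s : Chase) : Prop :=
  Good n m (locs s.1.1) ∧ (∃ t, Rel n m Z t s.1.1) ∧ (s.1.2 = false → ¬ Exceeds α υ s.1.1) ∧
    0 ≤ s.2 ∧ s.2 ≤ R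

/-- The relation between card `0` and card `3` during the chase. -/
def ChaseLink (n m w : ℤ) (s : Chase) : Prop :=
  ∃ ν : ℤ, (s.1.1 3).loc - (s.1.1 0).loc =
    w + ((s.1.1 3).acc - (s.1.1 0).acc) + m * s.2 + 2 * n * ν

variable {R w : ℤ} {α υ : ℝ} {Z : Fin 4 → ℤ}

/-- Cards `0` and `3` are distinct cards of one deck and never decide together, so every decision of
either changes the lag by exactly `±1`. -/
theorem chase_increment {C : Fin 4 → Card} (h : Good n m (locs C)) :
    ∃ c : ℤ, dTurn m true (C 0).loc - dTurn m true (C 3).loc = -c ∧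
      dTurn m false (C 0).loc - dTurn m false (C 3).loc = c ∧ |c| ≤ 1 ∧
      (if (C 0).loc = m then (1 : ℝ) else 0) ≤ (c : ℝ) ^ 2 := by
  have hne : (C 0).loc ≠ (C 3).loc := fun e => by
    have := h.2 (a₁ := 0) (a₂ := 3) e; simp at this
  by_cases c0 : (C 0).loc = m
  · have c3 : (C 3).loc ≠ m := fun e => hne (c0.trans e.symm)
    exact ⟨-1, by simp [dTurn, sgn, c0, c3], by simp [dTurn, sgn, c0, c3], by simp, by simp [c0]⟩
  · by_cases c3 : (C 3).loc = m
    · exact ⟨1, by simp [dTurn, sgn, c0, c3], by simp [dTurn, sgn, c0, c3], by simp, by simp [c0]⟩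
    · exact ⟨0, by simp [dTurn, c0, c3], by simp [dTurn, c0, c3], by simp, by simp [c0]⟩

theorem ChaseInv.step (hm : 2 ≤ m) (hn : m < n) {s : Chase} (h : ChaseInv n m R α υ Z s) (b : Bool) :
    ChaseInv n m R α υ Z (chaseStep n m R α υ s b) := by
  obtain ⟨h1, ⟨t, h2⟩, h3, h4, h5⟩ := h
  obtain ⟨c, c1, c2, c3, -⟩ := chase_increment h1
  rw [abs_le] at c3
  refine ⟨h1.stv hm hn b, ⟨t + 1, h2.step hm h1.1 b⟩, ?_, ?_, ?_⟩
  · intro hb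
    simp only [chaseStep, flagStep, Bool.or_eq_false_iff, decide_eq_false_iff_not] at hb
    exact hb.2
  · simp only [chaseStep]
    split_ifs with ha
    · have := ha.1; cases b <;> omega
    · exact h4
  · simp only [chaseStep]
    split_ifs with ha
    · have := ha.2.1; cases b <;> omega
    · exact h5

theorem not_chasing_chaseStep {s : Chase} (h : ¬ Chasing R s) (b : Bool) :
    ¬ Chasing R (chaseStep n m R α υ s b) ∧ (chaseStep n m R α υ s b).2 = s.2 := by
  have e : (chaseStep n m R α υ s b).2 = s.2 := by simp only [chaseStep, if_neg h]
  refine ⟨fun ha => h ?_, e⟩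
  simp only [Chasing, e] at ha
  refine ⟨ha.1, ha.2.1, ?_⟩
  have := ha.2.2
  simp only [chaseStep, flagStep, Bool.or_eq_false_iff] at this
  exact this.1

theorem ChaseLink.step (hm : 2 ≤ m) {s : Chase} (h : ChaseLink n m w s)
    (hv : Good n m (locs s.1.1)) (ha : Chasing R s) (b : Bool) :
    ChaseLink n m w (chaseStep n m R α υ s b) := by
  obtain ⟨ν, hν⟩ := h
  obtain ⟨V, hV⟩ := st_eq hm (hv.1 0) b
  obtain ⟨V', hV'⟩ := st_eq hm (hv.1 3) b
  refine ⟨ν + V - V', ?_⟩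
  simp only [chaseStep, if_pos ha, flagStep, cstv, cst, locs] at *
  rw [hV, hV']; linear_combination hν

/-- Two decks that differ only in one card: the mean of the distance after the decisions of the card
and of its replacement have become synchronous. -/
theorem abs_val_sub_le_of_chase {F : (Fin 3 → ℤ) → ℝ} (hF : ∀ Z, 0 ≤ F Z ∧ F Z ≤ 1)
    {κ η : ℝ} (hα : 0 < α) (hυ : 0 < υ) (hκ : 0 < κ) (hm : 2 ≤ m) (hn : m < n)
    {L : ℕ} (hL : ∀ Z : Fin 3 → ℤ, Good n m Z →
      κ ≤ occ (stv n m) (fun Z => if Z 0 = m then 1 else 0) L Z)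
    {Q t t₀ : ℕ} (hQ : 0 < Q) (ht : Q * L ≤ t) (hη : 0 ≤ η) (hZ : Good n m Z) {y : ℤ}
    (hy : 0 ≤ y) (hyR : y < R) (hw : ∃ ν : ℤ, Z 3 - Z 0 = w + m * y + 2 * n * ν)
    (hclose : ∀ C : Fin 4 → Card, Good n m (locs C) → (∃ t, Rel n m Z t C) → ¬ Exceeds α υ C →
      (∃ ν : ℤ, (C 3).loc - (C 0).loc = w + ((C 3).acc - (C 0).acc) + 2 * n * ν) →
      ∀ u, t₀ ≤ u → u ≤ t₀ + t → |val n m F u (C 0).loc (C 1).loc (C 2).loc -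
        val n m F u (C 3).loc (C 1).loc (C 2).loc| ≤ η) :
    |val n m F (t₀ + t) (Z 0) (Z 1) (Z 2) - val n m F (t₀ + t) (Z 3) (Z 1) (Z 2)| ≤
      η + (R * y + (L / m + 1)) / (κ * Q) + y / R + 4 * (t / α ^ 2 + (t / m + 1) / υ ^ 2) := by
  classical
  set s₀ : Chase := ((fresh Z, false), y) with hs₀
  have hRpos : (0 : ℝ) < R := by exact_mod_cast (by omega : 0 < R)
  have hI := fun (s : Chase) (b : Bool) (h : ChaseInv n m R α υ Z s) => h.step hm hn b
  have hinv : ChaseInv n m R α υ Z s₀ := by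
    refine ⟨hZ, ⟨0, rel_fresh Z⟩, fun _ => ?_, ?_, ?_⟩
    · simp [Exceeds, fresh, hs₀, hα.le, hυ.le]
    · simp only [hs₀]; omega
    · simp only [hs₀]; omega
  have hlink : ChaseLink n m w s₀ := by
    obtain ⟨ν, hν⟩ := hw
    exact ⟨ν, by simp [hs₀, fresh, hν]⟩
  have hv : ∀ t e j k, 0 ≤ val n m F t e j k ∧ val n m F t e j k ≤ 1 := fun t e j k =>
    ⟨Ex_nonneg (fun Z => (hF Z).1) _ _, by
      simpa [Ex_const, val] using Ex_mono (f := stv n m) (fun Z => (hF Z).2) t ![e, j, k]⟩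
  let G : Chase → ℝ := fun s => ((if Chasing R s then (1 : ℝ) else 0) +
        (1 / R : ℝ) * (s.2 : ℝ)) + (if s.1.2 = true then (1 : ℝ) else 0)
  have hrest := fun (s : Chase) (b : Bool) (h : ¬ Chasing R s) =>
    not_chasing_chaseStep (n := n) (m := m) (α := α) (υ := υ) h b
  have hG0 : ∀ s, ChaseInv n m R α υ Z s → 0 ≤ G s := by
    intro s hs
    have : (0 : ℝ) ≤ s.2 := by exact_mod_cast hs.2.2.2.1
    simp only [G]; positivity
  have hG0' : ∀ t s, ChaseInv n m R α υ Z s → 0 ≤ Ex (chaseStep n m R α υ) t G s := by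
    intro t s hs
    have := Ex_mono_of_inv hI hG0 t s hs
    rwa [Ex_const] at this
  -- A chase stopped at `R` or by the flag keeps `G ≥ 1`, which pays for the trivial bound on the
  -- difference.
  have hfrozen : ∀ t s, ChaseInv n m R α υ Z s → ¬ Chasing R s → (s.2 = R ∨ s.1.2 = true) →
      1 ≤ Ex (chaseStep n m R α υ) t G s := by
    intro t
    induction t with
    | zero =>
      intro s hs _ hc
      have h2 : (0 : ℝ) ≤ s.2 := by exact_mod_cast hs.2.2.2.1
      have p1 : (0 : ℝ) ≤ if Chasing R s then (1 : ℝ) else 0 := by split_ifs <;> norm_num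
      have p2 : (0 : ℝ) ≤ (1 / R : ℝ) * (s.2 : ℝ) := by positivity
      have p3 : (0 : ℝ) ≤ if s.1.2 = true then (1 : ℝ) else 0 := by split_ifs <;> norm_num
      simp only [Ex_zero, G]
      rcases hc with hc | hc
      · have : (1 / R : ℝ) * (s.2 : ℝ) = 1 := by rw [hc]; field_simp
        linarith
      · rw [if_pos hc]; linarith
    | succ t ih =>
      intro s hs ha hc
      have h2 : ∀ b, (chaseStep n m R α υ s b).2 = R ∨ (chaseStep n m R α υ s b).1.2 = true := by
        intro b
        rcases hc with hc | hc
        · left; rw [(hrest s b ha).2, hc]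
        · right; simp [chaseStep, flagStep, hc]
      rw [Ex_succ]
      linarith [ih _ (hI s true hs) (hrest s true ha).1 (h2 true),
        ih _ (hI s false hs) (hrest s false ha).1 (h2 false)]
  have main : ∀ u, u ≤ t → ∀ s, ChaseInv n m R α υ Z s → ChaseLink n m w s →
      |val n m F (t₀ + u) (s.1.1 0).loc (s.1.1 1).loc (s.1.1 2).loc -
        val n m F (t₀ + u) (s.1.1 3).loc (s.1.1 1).loc (s.1.1 2).loc| ≤
        η + Ex (chaseStep n m R α υ) u G s := by
    intro u
    induction u with
    | zero =>
      intro _ s hs hl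
      by_cases ha : Chasing R s
      · have h1 := hv (t₀ + 0) (s.1.1 0).loc (s.1.1 1).loc (s.1.1 2).loc
        have h2 := hv (t₀ + 0) (s.1.1 3).loc (s.1.1 1).loc (s.1.1 2).loc
        have h3 : 1 ≤ Ex (chaseStep n m R α υ) 0 G s := by
          have : (0 : ℝ) ≤ s.2 := by exact_mod_cast hs.2.2.2.1
          have p2 : (0 : ℝ) ≤ (1 / R : ℝ) * (s.2 : ℝ) := by positivity
          have p3 : (0 : ℝ) ≤ if s.1.2 = true then (1 : ℝ) else 0 := by split_ifs <;> norm_num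
          simp only [Ex_zero, G, if_pos ha]; linarith
        rw [abs_le]; constructor <;> linarith [h1.1, h1.2, h2.1, h2.2]
      · by_cases hc : s.2 = R ∨ s.1.2 = true
        · have h1 := hv (t₀ + 0) (s.1.1 0).loc (s.1.1 1).loc (s.1.1 2).loc
          have h2 := hv (t₀ + 0) (s.1.1 3).loc (s.1.1 1).loc (s.1.1 2).loc
          have h3 := hfrozen 0 s hs ha hc
          rw [abs_le]; constructor <;> linarith [h1.1, h1.2, h2.1, h2.2]
        · push Not at hc
          have hb : s.1.2 = false := by simpa using hc.2
          -- The remaining way to stop is lag `0`: the decisions are synchronous, and `hclose` takes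
          -- over.
          have hy0 : s.2 = 0 := by
            by_contra h0
            exact ha ⟨lt_of_le_of_ne hs.2.2.2.1 (Ne.symm h0), lt_of_le_of_ne hs.2.2.2.2 hc.1, hb⟩
          obtain ⟨ν, hν⟩ := hl
          have := hclose s.1.1 hs.1 hs.2.1 (hs.2.2.1 hb) ⟨ν, by rw [hν, hy0]; ring⟩ (t₀ + 0)
            (by omega) (by omega)
          linarith [hG0' 0 s hs]
    | succ u ih =>
      intro hu s hs hl
      by_cases ha : Chasing R s
      · have i1 := ih (by omega) _ (hI s true hs) (hl.step hm hs.1 ha true)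
        have i2 := ih (by omega) _ (hI s false hs) (hl.step hm hs.1 ha false)
        rw [← add_assoc, val_succ, val_succ, Ex_succ]
        have e3 : ∀ b x, ((chaseStep n m R α υ s b).1.1 x).loc = st n m b (s.1.1 x).loc :=
          fun b x => rfl
        rw [e3, e3, e3, e3] at i1 i2
        rw [abs_le] at i1 i2 ⊢
        constructor <;> linarith [i1.1, i1.2, i2.1, i2.2]
      · by_cases hc : s.2 = R ∨ s.1.2 = true
        · have h1 := hv (t₀ + (u + 1)) (s.1.1 0).loc (s.1.1 1).loc (s.1.1 2).loc
          have h2 := hv (t₀ + (u + 1)) (s.1.1 3).loc (s.1.1 1).loc (s.1.1 2).loc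
          have h3 := hfrozen (u + 1) s hs ha hc
          rw [abs_le]; constructor <;> linarith [h1.1, h1.2, h2.1, h2.2]
        · push Not at hc
          have hb : s.1.2 = false := by simpa using hc.2
          have hy0 : s.2 = 0 := by
            by_contra h0
            exact ha ⟨lt_of_le_of_ne hs.2.2.2.1 (Ne.symm h0), lt_of_le_of_ne hs.2.2.2.2 hc.1, hb⟩
          obtain ⟨ν, hν⟩ := hl
          have := hclose s.1.1 hs.1 hs.2.1 (hs.2.2.1 hb) ⟨ν, by rw [hν, hy0]; ring⟩ (t₀ + (u + 1))
            (by omega) (by omega)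
          linarith [hG0' (u + 1) s hs]
  have key := main t le_rfl s₀ hinv hlink
  have e1 : ∀ x, (s₀.1.1 x).loc = Z x := fun x => rfl
  rw [e1, e1, e1, e1] at key
  refine key.trans ?_
  simp only [G]
  rw [Ex_add (fun s : Chase => (if Chasing R s then (1 : ℝ) else 0) + (1 / R : ℝ) * (s.2 : ℝ)),
    Ex_add (fun s : Chase => (if Chasing R s then (1 : ℝ) else 0)), Ex_mul]
  have hmart : ∀ s : Chase, ChaseInv n m R α υ Z s → Chasing R s →
      (((chaseStep n m R α υ s true).2 : ℝ) + ((chaseStep n m R α υ s false).2 : ℝ)) / 2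
        = (s.2 : ℝ) := by
    intro s hs ha
    obtain ⟨c, h1, h2, -⟩ := chase_increment hs.1
    simp only [chaseStep, if_pos ha, add_sub_assoc, h1, h2]
    push_cast; ring
  have hactive := Ex_active_le (f := chaseStep n m R α υ) (I := ChaseInv n m R α υ Z) hI (Chasing R)
    (h := fun s => (s.2 : ℝ)) (q := fun s => if (s.1.1 0).loc = m then (1 : ℝ) else 0) (L := L)
    (κ := κ) (lam := L / m + 1) (R := R) hκ
    (fun s b _ ha => ⟨(hrest s b ha).1, by rw [(hrest s b ha).2]⟩) hmart
    (fun s hs ha => by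
      obtain ⟨c, h1, h2, -, h3⟩ := chase_increment hs.1
      simp only [chaseStep, if_pos ha, add_sub_assoc, h1, h2]
      push_cast
      nlinarith)
    (fun s u hs hu => by
      refine le_of_eq_of_le (occ_map (f' := stv n m) (fun s : Chase => locs s.1.1) (fun _ _ => rfl)
        (fun Z => if Z 0 = m then (1 : ℝ) else 0) u s) ?_
      refine (occ_decision_le hm hn hs.1.1 0 u).trans ((potential_le hm (hs.1.1 0) u).trans ?_)
      have : (0 : ℝ) < m := by exact_mod_cast (by omega : 0 < m)
      gcongr)
    (fun s hs _ => by
      -- Cards `0`, `1`, `2` of the four form a chain of three cards by themselves.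
      refine le_of_le_of_eq ?_ (occ_map (f' := stv n m)
        (fun s : Chase => fun x : Fin 3 => locs s.1.1 x.castSucc)
        (fun _ _ => rfl) (fun Z => if Z 0 = m then (1 : ℝ) else 0) L s).symm
      exact hL _ ⟨fun x => hs.1.1 _, fun x y e => Fin.castSucc_injective _ (hs.1.2 e)⟩)
    (fun s hs => by exact_mod_cast hs.2.2.2.1)
    (fun s hs => by exact_mod_cast hs.2.2.2.2) hQ ht s₀ hinv
  have hgmean : Ex (chaseStep n m R α υ) t (fun s => (s.2 : ℝ)) s₀ = y := by
    refine Ex_eq_of_martingale hI (fun s hs => ?_) t s₀ hinv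
    by_cases ha : Chasing R s
    · exact hmart s hs ha
    · rw [(hrest s true ha).2, (hrest s false ha).2]; ring
  have hflag : Ex (chaseStep n m R α υ) t (fun s => if s.1.2 = true then (1 : ℝ) else 0) s₀ ≤
      4 * (t / α ^ 2 + (t / m + 1) / υ ^ 2) := by
    rw [Ex_map (f' := flagStep n m α υ) (fun s : Chase => s.1) (fun _ _ => rfl)
      (fun s => if s.2 = true then (1 : ℝ) else 0)]
    have := Ex_flag_le hm hn hα hυ hZ.1 t
    simpa using this
  rw [hgmean]
  have e3 : (1 / R : ℝ) * (y : ℝ) = y / R := by ring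
  rw [e3]
  have e4 : (s₀.2 : ℝ) = (y : ℝ) := rfl
  rw [e4] at hactive
  linarith

end Coalescence

end OverlappingCycles

/-! ### Choice of constants for the coupling of close cards. -/

namespace OverlappingCycles

/-- The parameters `n, m, ℓ` with `m / n` bounded away from `0` and `1`, and `√n ≪ ℓ ≤ n`. -/
structure Regime (ε c : ℝ) (n m : ℤ) (ℓ : ℝ) : Prop where
  two_le : 2 ≤ m
  lt : m < n
  le_m : ε * n ≤ m
  le_sub : ε * n ≤ n - m
  pos : 0 < ℓ
  le_sq : (n : ℝ) ≤ c * ℓ ^ 2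
  le_n : ℓ ≤ n

namespace Regime

variable {ε c c' : ℝ} {n m : ℤ} {ℓ : ℝ}

theorem mono (h : Regime ε c n m ℓ) (hc : c ≤ c') : Regime ε c' n m ℓ :=
  { h with le_sq := h.le_sq.trans (by have := h.pos; gcongr) }

theorem n_pos (h : Regime ε c n m ℓ) : (0 : ℝ) < n := by
  have := h.two_le; have := h.lt; exact_mod_cast (by omega : 0 < n)

theorem m_pos (h : Regime ε c n m ℓ) : (0 : ℝ) < m := by
  have := h.two_le; exact_mod_cast (by omega : 0 < m)

/-- From `ℓ ≤ n ≤ c ℓ²`. Thus a small `c` alone makes `ℓ` and `n` as large as desired, and no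
further largeness assumption is needed. -/
theorem inv_le (h : Regime ε c n m ℓ) (hc : 0 < c) : 1 / c ≤ ℓ := by
  have h1 := h.le_sq; have h2 := h.le_n; have h3 := h.pos
  rw [div_le_iff₀ hc]
  have : ℓ * 1 ≤ ℓ * (ℓ * c) := by nlinarith
  exact le_of_mul_le_mul_left this h3

theorem sqrt_le (h : Regime ε c n m ℓ) {d : ℝ} (hd : 0 ≤ d) (hc : c ≤ d ^ 2) : √n ≤ d * ℓ := by
  rw [Real.sqrt_le_iff]
  refine ⟨mul_nonneg hd h.pos.le, h.le_sq.trans ?_⟩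
  rw [mul_pow]; gcongr

theorem one_le_sqrt (h : Regime ε c n m ℓ) : 1 ≤ √(n : ℝ) := by
  rw [Real.one_le_sqrt]; have := h.two_le; have := h.lt; exact_mod_cast (by omega : 1 ≤ n)

theorem sqrt_sq (h : Regime ε c n m ℓ) : √(n : ℝ) ^ 2 = n := Real.sq_sqrt h.n_pos.le

/-- Fluctuations up to `ℓ` and excesses up to `ℓ / √n` cost at most `9 ℓ` of separation. -/
theorem loss_le (h : Regime ε c n m ℓ) (hc : c ≤ 1 / 16) {α υ : ℝ} (hα : α ≤ ℓ)
    (hυ : υ ≤ ℓ / √n) : loss n α υ ≤ 9 * ℓ := by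
  have h1 := h.one_le_sqrt
  have h2 := h.sqrt_le (d := 1 / 4) (by norm_num) (by linarith)
  have h3 := h.n_pos
  have h4 := h.pos
  have h5 : ℓ / n ≤ ℓ / √n := by
    apply div_le_div_of_nonneg_left h4.le (by linarith)
    have := h.sqrt_sq; nlinarith
  have h6 : √(n : ℝ) * (ℓ / √n) = ℓ := by field_simp
  have h7 : υ * √n ≤ ℓ := by
    calc υ * √n ≤ ℓ / √n * √n := by gcongr
      _ = ℓ := by rw [mul_comm]; exact h6
  have h8 : α / n ≤ ℓ / √n := (by gcongr : α / n ≤ ℓ / n).trans h5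
  unfold loss
  calc 2 * α + 2 * υ * √n + (1 + √n) * (2 + α / n + υ) ≤
        2 * ℓ + 2 * ℓ + (√n + √n) * (2 + ℓ / √n + ℓ / √n) := by
        have : (1 + √(n : ℝ)) * (2 + α / n + υ) ≤ (1 + √n) * (2 + ℓ / √n + ℓ / √n) := by
          gcongr
        have : (1 + √(n : ℝ)) * (2 + ℓ / √n + ℓ / √n) ≤ (√n + √n) * (2 + ℓ / √n + ℓ / √n) := by
          gcongr
        linarith
    _ = 4 * ℓ + 4 * √n + 4 * (√n * (ℓ / √n)) := by ring
    _ ≤ 9 * ℓ := by rw [h6]; linarith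

/-- The number of blocks of `6 n` rounds within `u` rounds. -/
theorem blocks (h : Regime ε c n m ℓ) {L : ℕ} (hL : (L : ℤ) = 6 * n) {u : ℕ}
    (hu : 12 * (n : ℝ) ≤ u) : ∃ Q : ℕ, 0 < Q ∧ Q * L ≤ u ∧ (u : ℝ) / 12 ≤ n * Q := by
  have hLr : (L : ℝ) = 6 * n := by exact_mod_cast hL
  have hn := h.n_pos
  have hLpos : 0 < L := by have := h.two_le; have := h.lt; omega
  refine ⟨u / L, ?_, Nat.div_mul_le_self u L, ?_⟩
  · apply Nat.div_pos _ hLpos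
    have : (L : ℝ) ≤ u := by rw [hLr]; linarith
    exact_mod_cast this
  · have : (u : ℝ) < ((u / L : ℕ) + 1) * L := by
      have := Nat.lt_div_mul_add (a := u) hLpos
      have : u < (u / L + 1) * L := by rw [add_mul, one_mul]; exact this
      exact_mod_cast this
    rw [hLr] at this
    nlinarith

end Regime

/-- In a time that is a small multiple of `ℓ²`, tracks rarely leave the scale `ℓ`; this fixes how
small `θ` must be. -/
theorem tracks_bound {ε c η θ : ℝ} (hε : 0 < ε) (hε1 : ε ≤ 1) {n m : ℤ} {ℓ : ℝ}
    (h : Regime ε c n m ℓ) (hθ0 : 0 < θ) (hθ : θ ≤ ε * η / 200) (hc : c ≤ η / 100) {u : ℕ}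
    (hu : (u : ℝ) ≤ 2 * θ * ℓ ^ 2) :
    3 * (u / ℓ ^ 2 + (u / m + 1) / (ℓ / √n) ^ 2) ≤ η / 8 := by
  have h1 := h.pos
  have h2 := h.n_pos
  have h3 := h.m_pos
  have e1 : u / ℓ ^ 2 ≤ 2 * θ := by rw [div_le_iff₀ (by positivity)]; exact hu
  have e2 : (u / m + 1) / (ℓ / √n) ^ 2 = u / ℓ ^ 2 * (n / m) + n / ℓ ^ 2 := by
    rw [div_pow, h.sqrt_sq]; field_simp
  have e3 : (n : ℝ) / m ≤ 1 / ε := by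
    rw [div_le_div_iff₀ h3 hε]; linarith [h.le_m]
  have e4 : (n : ℝ) / ℓ ^ 2 ≤ c := by rw [div_le_iff₀ (by positivity)]; exact h.le_sq
  have e5 : u / ℓ ^ 2 * ((n : ℝ) / m) ≤ 2 * θ * (1 / ε) := by gcongr
  have e6 : θ ≤ η / 200 := by
    have : ε * η ≤ η := by nlinarith
    linarith
  have e7 : θ * (1 / ε) ≤ η / 200 := by
    rw [mul_one_div, div_le_iff₀ hε]; linarith
  rw [e2]; linarith

/-- The three errors in `abs_val_sub_le_of_close` get `η / 8` each: still running, distance too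
large, track exceeded. -/
theorem abs_val_sub_le_of_gap {ε η θ κ : ℝ} (hε : 0 < ε) (hε1 : ε ≤ 1) (hη : 0 < η) (hη1 : η ≤ 1)
    (hθ : 0 < θ) (hθη : θ ≤ ε * η / 200) (hκ : 0 < κ) : ∃ δ : ℝ, 0 < δ ∧ δ ≤ ε ∧ ∃ c : ℝ, 0 < c ∧
    ∀ (n m : ℤ) (ℓ : ℝ), Regime ε c n m ℓ → ∀ L : ℕ, (L : ℤ) = 6 * n →
    (∀ Z, Good n m Z → κ * n ≤ occ (stv n m) (alone m 0) L Z) →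
    ∀ F : (Fin 3 → ℤ) → ℝ, (∀ Z, 0 ≤ F Z ∧ F Z ≤ 1) →
    ∀ u : ℕ, θ * ℓ ^ 2 / 2 ≤ u → (u : ℝ) ≤ 2 * θ * ℓ ^ 2 → ∀ i j k e : ℤ, Good n m ![i, j, k] →
    Valid n m e → e < i → ((i - e : ℤ) : ℝ) ≤ δ * ℓ → Sep n m (71 * ℓ) (i - j) →
    Sep n m (71 * ℓ) (i - k) → |val n m F u i j k - val n m F u e j k| ≤ 3 * η / 8 := by
  set δ : ℝ := min (ε * η / 16) (κ * θ * η / (1000 * ε)) with hδ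
  set c : ℝ := min (min (1 / 16) (η / 100)) (min (κ * θ * η / 2400) (min (θ / 24) (ε / 4))) with hc
  have hδ1 : δ ≤ ε * η / 16 := min_le_left _ _
  have hδ2 : δ ≤ κ * θ * η / (1000 * ε) := min_le_right _ _
  have hc0 : 0 < c := by positivity
  have hc1 : c ≤ 1 / 16 := (min_le_left _ _).trans (min_le_left _ _)
  have hc2 : c ≤ η / 100 := (min_le_left _ _).trans (min_le_right _ _)
  have hc3 : c ≤ κ * θ * η / 2400 := (min_le_right _ _).trans (min_le_left _ _)
  have hc4 : c ≤ θ / 24 := (min_le_right _ _).trans ((min_le_right _ _).trans (min_le_left _ _))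
  have hc5 : c ≤ ε / 4 := (min_le_right _ _).trans ((min_le_right _ _).trans (min_le_right _ _))
  have hεη : ε * η ≤ ε := by nlinarith
  refine ⟨δ, by positivity, by linarith, c, hc0, ?_⟩
  intro n m ℓ hreg L hL hocc F hF u hu1 hu2 i j k e hZ he hei hgap hj hk
  have hℓ := hreg.pos
  have hn := hreg.n_pos
  have hεℓ : 4 ≤ ε * ℓ := by
    have h1 := hreg.inv_le hc0
    have h2 : 1 / (ε / 4) ≤ 1 / c := one_div_le_one_div_of_le hc0 hc5
    have h3 : 1 / (ε / 4) ≤ ℓ := h2.trans h1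
    rw [div_le_iff₀ (by positivity)] at h3; linarith
  -- Since `ℓ ≤ n`, this is below both `m` and `n - m`, as the coupling requires, and it is far
  -- above the initial distance `δ ℓ`.
  set R : ℤ := ⌊ε * ℓ⌋ with hR
  have hR1 : (R : ℝ) ≤ ε * ℓ := Int.floor_le _
  have hR2 : ε * ℓ - 1 < R := Int.sub_one_lt_floor _
  have hεn : ε * ℓ ≤ ε * n := by have := hreg.le_n; gcongr
  have hRm : R ≤ m := by
    have : (R : ℝ) ≤ m := by linarith [hreg.le_m]
    exact_mod_cast this
  have hRn : R ≤ n - m := by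
    have : (R : ℝ) ≤ (n - m : ℤ) := by push_cast; linarith [hreg.le_sub]
    exact_mod_cast this
  have hgapR : i - e < R := by
    have : ((i - e : ℤ) : ℝ) < R := by
      have h1 : δ * ℓ ≤ ε / 16 * ℓ := by gcongr; linarith
      linarith
    exact_mod_cast this
  have hu3 : 12 * (n : ℝ) ≤ u := by
    have := hreg.le_sq
    have : c * ℓ ^ 2 ≤ θ / 24 * ℓ ^ 2 := by gcongr
    linarith
  obtain ⟨Q, hQ, hQL, hQu⟩ := hreg.blocks hL hu3
  have hυ : 0 < ℓ / √n := by have := hreg.one_le_sqrt; positivity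
  have hloss := hreg.loss_le hc1 (α := ℓ) (υ := ℓ / √n) le_rfl le_rfl
  have hsq := hreg.sqrt_le (d := 1 / 4) (by norm_num) (by linarith)
  have hεℓ' : ε * ℓ ≤ ℓ := by nlinarith
  have key := abs_val_sub_le_of_close hF (ρ := 71 * ℓ) hℓ hυ (mul_pos hκ hn) hreg.two_le hreg.lt hRm
    hRn (by linarith) hocc hQ hQL hZ he hei hgapR hj hk
  refine key.trans ?_
  have t3 := tracks_bound hε hε1 hreg hθ hθη hc2 hu2
  have hd0 : (0 : ℝ) ≤ (i - e : ℤ) := by exact_mod_cast (by omega : 0 ≤ i - e)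
  have hLr : (L : ℝ) = 6 * n := by exact_mod_cast hL
  have t2 : ((i - e : ℤ) : ℝ) / R ≤ η / 8 := by
    rw [div_le_iff₀ (by linarith)]
    have h1 : δ * ℓ ≤ ε * η / 16 * ℓ := by gcongr
    have h2 : η / 8 * (ε * ℓ / 2) ≤ η / 8 * R := by gcongr; linarith
    linarith
  have t1 : ((R + 1) * ((i - e : ℤ) : ℝ) + L) / (κ * n * Q) ≤ η / 8 := by
    have hQr : (0 : ℝ) < Q := by exact_mod_cast hQ
    rw [div_le_iff₀ (by positivity)]
    have a1 : κ * (θ * ℓ ^ 2 / 24) ≤ κ * n * Q := by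
      rw [mul_assoc]; gcongr; linarith
    have a2 : (R + 1) * ((i - e : ℤ) : ℝ) ≤ (2 * (ε * ℓ)) * (δ * ℓ) := by
      gcongr; linarith
    have a3 : (L : ℝ) ≤ 6 * (c * ℓ ^ 2) := by rw [hLr]; linarith [hreg.le_sq]
    have a4 : ε * δ ≤ κ * θ * η / 1000 := by
      calc ε * δ ≤ ε * (κ * θ * η / (1000 * ε)) := by gcongr
        _ = κ * θ * η / 1000 := by field_simp
    have a5 : (ε * δ) * ℓ ^ 2 ≤ (κ * θ * η / 1000) * ℓ ^ 2 := by gcongr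
    have a6 : c * ℓ ^ 2 ≤ κ * θ * η / 2400 * ℓ ^ 2 := by gcongr
    have a7 : η / 8 * (κ * (θ * ℓ ^ 2 / 24)) ≤ η / 8 * (κ * n * Q) := by gcongr
    have a8 : 0 ≤ κ * θ * η * ℓ ^ 2 := by positivity
    linarith
  linarith

end OverlappingCycles

/-! ### Smoothness of means under small displacements. -/

namespace OverlappingCycles

theorem Sep.mono {n m : ℤ} {ρ ρ' : ℝ} {u : ℤ} (h : Sep n m ρ u) (hρ : ρ' ≤ ρ) : Sep n m ρ' u :=
  fun a b q e => hρ.trans_lt (h a b q e)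

theorem Sep.neg {n m : ℤ} {ρ : ℝ} {u : ℤ} (h : Sep n m ρ u) : Sep n m ρ (-u) := by
  intro a b q e
  have := h (-a) (-b) (-q) (by linear_combination -e)
  simpa using this

theorem Sep.shift {n m : ℤ} {ρ : ℝ} {u u' : ℤ} (h : Sep n m ρ u) {a b q : ℤ}
    (e : u' = u + a + b * m + q * (2 * n - m + 1)) {A B : ℝ} (hA : |(a : ℝ)| ≤ A)
    (hB : |(b : ℝ)| * √n ≤ B) : Sep n m (ρ - (A + B)) u' := by
  intro a' b' q' e'
  have h1 := h (a' - a) (b' - b) (q' - q) (by linear_combination e' - e)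
  push_cast at h1
  have h2 := abs_sub (a' : ℝ) a
  have h3 := mul_le_mul_of_nonneg_right (abs_sub (b' : ℝ) b) (Real.sqrt_nonneg n)
  linarith

theorem Sep.ne_zero {n m : ℤ} {ρ : ℝ} {u : ℤ} (h : Sep n m ρ u) (hρ : 0 ≤ ρ) : u ≠ 0 := by
  rintro rfl
  have := h 0 0 0 (by ring)
  simp at this; linarith

theorem good_vec₃ {n m i j k : ℤ} (hi : Valid n m i) (hj : Valid n m j) (hk : Valid n m k)
    (h1 : i ≠ j) (h2 : i ≠ k) (h3 : j ≠ k) : Good n m ![i, j, k] := by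
  refine ⟨fun z => by fin_cases z <;> assumption, fun z z' e => ?_⟩
  fin_cases z <;> fin_cases z' <;> simp_all

theorem good_vec₄ {n m i j k e : ℤ} (h : Good n m ![i, j, k]) (he : Valid n m e)
    (h1 : e ≠ i) (h2 : e ≠ j) (h3 : e ≠ k) : Good n m ![i, j, k, e] := by
  have v0 := h.1 0
  have v1 := h.1 1
  have v2 := h.1 2
  have e0 : i ≠ j := h.2.ne (show (0 : Fin 3) ≠ 1 by decide)
  have e1 : i ≠ k := h.2.ne (show (0 : Fin 3) ≠ 2 by decide)
  have e2 : j ≠ k := h.2.ne (show (1 : Fin 3) ≠ 2 by decide)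
  refine ⟨fun z => by fin_cases z <;> assumption, fun z z' e => ?_⟩
  clear h
  fin_cases z <;> fin_cases z' <;> simp_all

/-- The three errors of the chase. The choice of `R` as about `8 y / η` bounds `y / R`; the
threshold `δ₂ ℓ / 4` for the fluctuations makes the time `θ ℓ²` of the chase much shorter than `(δ₂
ℓ)²`. -/
theorem chase_bounds {ε c η κ θ δ₂ δ : ℝ} (hε : 0 < ε) (hε1 : ε ≤ 1) (hη : 0 < η) (hη1 : η ≤ 1)
    (hκ : 0 < κ) (hθ : 0 < θ) (hδ₂ : 0 < δ₂) (hδ₂1 : δ₂ ≤ 1) (hδ0 : 0 < δ) (hδ1 : δ ≤ 1)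
    (hθδ : θ ≤ ε * η * δ₂ ^ 2 / 2048) (hδ : δ ≤ κ * η ^ 2 * θ / 4000)
    (hc1 : c ≤ η / 128) (hc2 : c ≤ κ * η * θ * ε / 2800) {n m : ℤ} {ℓ : ℝ}
    (h : Regime ε c n m ℓ) {L : ℕ} (hL : (L : ℤ) = 6 * n) {t Q : ℕ} (ht : (t : ℝ) ≤ θ * ℓ ^ 2)
    (hQ : θ * ℓ ^ 2 / 24 ≤ n * Q) (hQ0 : 0 < Q) {y R : ℤ} (hy : 0 ≤ y) (hyn : y * √n ≤ δ * ℓ)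
    (hR : R = ⌈8 * y / η⌉ + 1) :
    y < R ∧ (R * y + (L / m + 1)) / (κ * Q) + y / R + 4 * (t / (δ₂ * ℓ / 4) ^ 2 +
      (t / m + 1) / (ℓ / √n) ^ 2) ≤ 5 * η / 8 := by
  have hn := h.n_pos
  have hm := h.m_pos
  have hℓ := h.pos
  have hy0 : (0 : ℝ) ≤ y := by exact_mod_cast hy
  have hR1 : 8 * y / η + 1 ≤ (R : ℝ) := by rw [hR]; push_cast; linarith [Int.le_ceil (8 * y / η)]
  have hR2 : (R : ℝ) ≤ 8 * y / η + 2 := by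
    rw [hR]; push_cast; linarith [Int.ceil_lt_add_one (8 * y / η)]
  have hyη : 8 * y ≤ 8 * y / η := by
    rw [le_div_iff₀ hη]; have : 8 * (y : ℝ) * η ≤ 8 * y * 1 := by gcongr
    linarith
  have hRpos : (0 : ℝ) < R := by linarith
  refine ⟨by have : (y : ℝ) < R := by linarith
             exact_mod_cast this, ?_⟩
  have t2 : (y : ℝ) / R ≤ η / 8 := by
    rw [div_le_iff₀ hRpos]
    have : η / 8 * (8 * y / η) ≤ η / 8 * R := by gcongr; linarith
    have e : η / 8 * (8 * y / η) = y := by field_simp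
    linarith
  have hQr : (0 : ℝ) < Q := by exact_mod_cast hQ0
  have hnm : (n : ℝ) / m ≤ 1 / ε := by
    rw [div_le_div_iff₀ hm hε]; linarith [h.le_m]
  have t1 : (R * y + (L / m + 1)) / (κ * Q) ≤ η / 8 := by
    rw [div_le_iff₀ (by positivity)]
    have hyy : (y : ℝ) ≤ y ^ 2 := by
      rcases eq_or_lt_of_le hy with h0 | h0
      · rw [← h0]; simp
      · have : (1 : ℝ) ≤ y := by exact_mod_cast h0
        nlinarith
    have a1 : (R : ℝ) * y ≤ 10 * y ^ 2 / η := by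
      have e1 : (R : ℝ) * y ≤ (8 * y / η + 2) * y := by gcongr
      have e2 : (8 * y / η + 2) * y = 8 * y ^ 2 / η + 2 * y := by ring
      have e3 : (y : ℝ) ^ 2 ≤ y ^ 2 / η := by
        rw [le_div_iff₀ hη]
        have : (y : ℝ) ^ 2 * η ≤ y ^ 2 * 1 := by gcongr
        linarith
      have e4 : 10 * (y : ℝ) ^ 2 / η = 8 * y ^ 2 / η + 2 * (y ^ 2 / η) := by ring
      linarith
    have a2 : (L : ℝ) / m + 1 ≤ 7 / ε := by
      have hLr : (L : ℝ) = 6 * n := by exact_mod_cast hL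
      have e1 : (1 : ℝ) ≤ 1 / ε := by rw [le_div_iff₀ hε]; linarith
      have e2 : (L : ℝ) / m = 6 * (n / m) := by rw [hLr]; ring
      have e3 : 7 / ε = 6 * (1 / ε) + 1 / ε := by ring
      rw [e2, e3]; linarith
    have a3 : (y : ℝ) ^ 2 * n ≤ δ * ℓ ^ 2 := by
      have e1 : (y * √n) ^ 2 ≤ (δ * ℓ) ^ 2 := by gcongr
      rw [mul_pow, h.sqrt_sq, mul_pow] at e1
      have e2 : δ ^ 2 * ℓ ^ 2 ≤ δ * ℓ ^ 2 := by gcongr; nlinarith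
      linarith
    have b1 : n * (10 * (y : ℝ) ^ 2 / η) ≤ κ * η * θ * ℓ ^ 2 / 400 := by
      have e1 : n * (10 * (y : ℝ) ^ 2 / η) = 10 / η * (y ^ 2 * n) := by ring
      have e2 : 10 / η * ((y : ℝ) ^ 2 * n) ≤ 10 / η * (κ * η ^ 2 * θ / 4000 * ℓ ^ 2) := by
        refine mul_le_mul_of_nonneg_left (a3.trans ?_) (by positivity)
        exact mul_le_mul_of_nonneg_right hδ (by positivity)
      have e3 : 10 / η * (κ * η ^ 2 * θ / 4000 * ℓ ^ 2) = κ * η * θ * ℓ ^ 2 / 400 := by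
        field_simp; ring
      linarith
    have b2 : n * (7 / ε) ≤ κ * η * θ * ℓ ^ 2 / 400 := by
      have e1 : n * (7 / ε) ≤ (κ * η * θ * ε / 2800 * ℓ ^ 2) * (7 / ε) := by
        gcongr; exact h.le_sq.trans (by gcongr)
      have e2 : (κ * η * θ * ε / 2800 * ℓ ^ 2) * (7 / ε) = κ * η * θ * ℓ ^ 2 / 400 := by
        field_simp; ring
      linarith
    have b3 : η / 8 * κ * (θ * ℓ ^ 2 / 24) ≤ η / 8 * κ * (n * Q) := by gcongr
    have b4 : 0 ≤ κ * η * θ * ℓ ^ 2 := by positivity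
    refine le_of_mul_le_mul_left (a := (n : ℝ)) ?_ hn
    have b5 : n * (R * y + ((L : ℝ) / m + 1)) ≤ n * (10 * y ^ 2 / η) + n * (7 / ε) := by
      rw [← mul_add]; gcongr
    have b6 : (n : ℝ) * (η / 8 * (κ * Q)) = η / 8 * κ * (n * Q) := by ring
    rw [b6]; linarith
  have t3 : 4 * (t / (δ₂ * ℓ / 4) ^ 2 + (t / m + 1) / (ℓ / √n) ^ 2) ≤ η / 8 := by
    have e0 : (t : ℝ) / ℓ ^ 2 ≤ θ := by rw [div_le_iff₀ (by positivity)]; exact ht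
    have e1 : (t : ℝ) / (δ₂ * ℓ / 4) ^ 2 = t / ℓ ^ 2 * (16 / δ₂ ^ 2) := by field_simp; norm_num
    have e2 : (t / m + 1) / (ℓ / √n) ^ 2 = t / ℓ ^ 2 * (n / m) + n / ℓ ^ 2 := by
      rw [div_pow, h.sqrt_sq]; field_simp
    have e4 : (n : ℝ) / ℓ ^ 2 ≤ c := by rw [div_le_iff₀ (by positivity)]; exact h.le_sq
    have e5 : (t : ℝ) / ℓ ^ 2 * (16 / δ₂ ^ 2) ≤ η / 128 := by
      calc _ ≤ ε * η * δ₂ ^ 2 / 2048 * (16 / δ₂ ^ 2) :=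
          mul_le_mul_of_nonneg_right (e0.trans hθδ) (by positivity)
        _ = ε * η / 128 := by field_simp; norm_num
        _ ≤ _ := by have : ε * η ≤ 1 * η := by gcongr
                    linarith
    have e6 : (t : ℝ) / ℓ ^ 2 * (n / m) ≤ η / 128 := by
      calc _ ≤ ε * η * δ₂ ^ 2 / 2048 * (1 / ε) :=
          mul_le_mul (e0.trans hθδ) hnm (by positivity) (by positivity)
        _ = η * δ₂ ^ 2 / 2048 := by field_simp
        _ ≤ η * 1 ^ 2 / 2048 := by gcongr
        _ ≤ _ := by linarith
    rw [e1, e2]; linarith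
  linarith

set_option maxHeartbeats 600000 in
-- The chase takes a short initial time, and the coupling of close cards has the rest. The chase
-- must end with a gap at most `δ₂ ℓ`, so its constants are chosen after those of the coupling; the
-- errors add up as `5 η / 8 + 3 η / 8`.
theorem abs_val_sub_le_of_chase_of_regime {ε η θ κ : ℝ} (hε : 0 < ε) (hε1 : ε ≤ 1) (hη : 0 < η)
    (hη1 : η ≤ 1) (hθ : 0 < θ) (hθη : θ ≤ ε * η / 200) (hκ : 0 < κ) :
    ∃ δ : ℝ, 0 < δ ∧ δ ≤ ε ∧ ∃ c : ℝ, 0 < c ∧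
    ∀ (n m : ℤ) (ℓ : ℝ), Regime ε c n m ℓ → ∀ L : ℕ, (L : ℤ) = 6 * n →
    (∀ Z, Good n m Z → κ * n ≤ occ (stv n m) (alone m (0 : Fin 3)) L Z) →
    (∀ Z : Fin 3 → ℤ, Good n m Z → κ ≤ occ (stv n m) (fun Z => if Z 0 = m then 1 else 0) L Z) →
    ∀ F : (Fin 3 → ℤ) → ℝ, (∀ Z, 0 ≤ F Z ∧ F Z ≤ 1) →
    ∀ t : ℕ, θ * ℓ ^ 2 ≤ t → (t : ℝ) ≤ 2 * θ * ℓ ^ 2 → ∀ Z : Fin 4 → ℤ, Good n m Z →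
    ∀ w y : ℤ, 0 ≤ y → |(w : ℝ)| ≤ δ * ℓ → y * √n ≤ δ * ℓ →
    (∃ ν : ℤ, Z 3 - Z 0 = w + m * y + 2 * n * ν) →
    Sep n m (80 * ℓ) (Z 0 - Z 1) → Sep n m (80 * ℓ) (Z 0 - Z 2) →
    Sep n m (80 * ℓ) (Z 3 - Z 1) → Sep n m (80 * ℓ) (Z 3 - Z 2) →
    |val n m F t (Z 0) (Z 1) (Z 2) - val n m F t (Z 3) (Z 1) (Z 2)| ≤ η := by
  obtain ⟨δ₂, hδ₂, hδ₂ε, c₂, hc₂, gap⟩ := abs_val_sub_le_of_gap hε hε1 hη hη1 hθ hθη hκ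
  have hδ₂1 : δ₂ ≤ 1 := hδ₂ε.trans hε1
  set θ₁ : ℝ := min (θ / 2) (ε * η * δ₂ ^ 2 / 2048) with hθ₁
  have hθ₁0 : 0 < θ₁ := by positivity
  have hθ₁1 : θ₁ ≤ θ / 2 := min_le_left _ _
  have hθ₁2 : θ₁ ≤ ε * η * δ₂ ^ 2 / 2048 := min_le_right _ _
  set δ : ℝ := min (δ₂ / 8) (κ * η ^ 2 * θ₁ / 4000) with hδ
  have hδ0 : 0 < δ := by positivity
  have hδ1 : δ ≤ δ₂ / 8 := min_le_left _ _
  have hδ2 : δ ≤ κ * η ^ 2 * θ₁ / 4000 := min_le_right _ _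
  set c : ℝ := min (min (1 / 16) (η / 128)) (min (κ * η * θ₁ * ε / 2800) (min (θ₁ / 24) c₂)) with hc
  have hc0 : 0 < c := by positivity
  have hc1 : c ≤ 1 / 16 := (min_le_left _ _).trans (min_le_left _ _)
  have hc2 : c ≤ η / 128 := (min_le_left _ _).trans (min_le_right _ _)
  have hc3 : c ≤ κ * η * θ₁ * ε / 2800 := (min_le_right _ _).trans (min_le_left _ _)
  have hc4 : c ≤ θ₁ / 24 := (min_le_right _ _).trans ((min_le_right _ _).trans (min_le_left _ _))
  have hc5 : c ≤ c₂ := (min_le_right _ _).trans ((min_le_right _ _).trans (min_le_right _ _))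
  refine ⟨δ, hδ0, by linarith, c, hc0, ?_⟩
  intro n m ℓ hreg L hL halone hdec F hF t ht1 ht2 Z hZ w y hy hw hyn hν s01 s02 s31 s32
  have hℓ := hreg.pos
  have hn := hreg.n_pos
  have hn1 : (1 : ℝ) ≤ n := by
    have := hreg.two_le; have := hreg.lt; exact_mod_cast (by omega : 1 ≤ n)
  have hℓ2 : 0 ≤ ℓ ^ 2 := by positivity
  have hθ₁ℓ : θ₁ * ℓ ^ 2 ≤ θ / 2 * ℓ ^ 2 := by gcongr
  set t₁ : ℕ := ⌊θ₁ * ℓ ^ 2⌋₊ with ht₁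
  have ht₁1 : (t₁ : ℝ) ≤ θ₁ * ℓ ^ 2 := Nat.floor_le (by positivity)
  have ht₁2 : θ₁ * ℓ ^ 2 - 1 < t₁ := Nat.sub_one_lt_floor _
  have hnθ : 24 * (n : ℝ) ≤ θ₁ * ℓ ^ 2 := by
    have := hreg.le_sq
    have : c * ℓ ^ 2 ≤ θ₁ / 24 * ℓ ^ 2 := by gcongr
    linarith
  have ht₁t : t₁ ≤ t := by
    have : (t₁ : ℝ) ≤ t := by have := mul_nonneg hθ.le hℓ2; linarith
    exact_mod_cast this
  obtain ⟨t₀, rfl⟩ := Nat.exists_eq_add_of_le' ht₁t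
  push_cast at ht1 ht2
  obtain ⟨Q, hQ, hQL, hQu⟩ := hreg.blocks hL (u := t₁) (by linarith)
  have hδ₂ℓ : 0 < δ₂ * ℓ / 4 := by positivity
  have hυ : 0 < ℓ / √n := by have := hreg.one_le_sqrt; positivity
  obtain ⟨hyR, hbound⟩ := chase_bounds hε hε1 hη hη1 hκ hθ₁0 hδ₂ hδ₂1 hδ0 (by linarith) hθ₁2 hδ2 hc2
    hc3 hreg hL ht₁1 (by linarith) hQ hy hyn rfl
  have hloss : loss n (δ₂ * ℓ / 4) (ℓ / √n) ≤ 9 * ℓ :=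
    hreg.loss_le hc1 (by nlinarith) le_rfl
  have key := abs_val_sub_le_of_chase (t₀ := t₀) (η := 3 * η / 8) hF hδ₂ℓ hυ hκ hreg.two_le hreg.lt
    hdec hQ hQL (by linarith) hZ hy hyR hν ?_
  · linarith
  intro C hC ⟨r, hrel⟩ hE hlink u hu1 hu2
  have hu1' : (t₀ : ℝ) ≤ u := by exact_mod_cast hu1
  have hu2' : (u : ℝ) ≤ t₀ + t₁ := by exact_mod_cast hu2
  have hsep : ∀ {x y}, Sep n m (80 * ℓ) (Z x - Z y) → Sep n m (71 * ℓ) ((C x).loc - (C y).loc) :=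
    fun h => (Sep.of_rel hreg.two_le hreg.lt hrel hZ.1 hC.1 hE h).mono (by linarith)
  have hloc : ∀ x, Valid n m (C x).loc := hC.1
  have hne : ∀ x y, x ≠ y → (C x).loc ≠ (C y).loc := fun x y hxy e => hxy (hC.2 e)
  obtain ⟨ν, hν'⟩ := hlink
  simp only [Exceeds, not_exists, not_or, not_lt] at hE
  have a3 := (hE 3).1
  have a0 := (hE 0).1
  have hsmall : |((w + ((C 3).acc - (C 0).acc) : ℤ) : ℝ)| ≤ δ₂ * ℓ := by
    push_cast
    have t1 := abs_add_le (w : ℝ) ((C 3).acc - (C 0).acc)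
    have t2 := abs_sub ((C 3).acc : ℝ) (C 0).acc
    have t3 : δ * ℓ ≤ δ₂ / 8 * ℓ := by gcongr
    linarith
  have hm' : |w + ((C 3).acc - (C 0).acc)| ≤ m := by
    have : δ₂ * ℓ ≤ m := (by gcongr; exact hreg.le_n : δ₂ * ℓ ≤ ε * n).trans hreg.le_m
    exact_mod_cast hsmall.trans this
  -- After the chase the locations agree modulo `2 n` up to at most `m`, and as they differ by less
  -- than `2 n - m`, there is no multiple of `2 n` left.
  have hν0 : ν = 0 := by
    have := (hloc 3).abs_sub_lt (hloc 0) hreg.two_le hreg.lt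
    rw [hν'] at this
    have h2n : 0 < 2 * n := by have := hreg.two_le; have := hreg.lt; omega
    by_contra hne0
    have h1 : 1 ≤ |ν| := Int.one_le_abs hne0
    have h2 : |2 * n * ν| = 2 * n * |ν| := by rw [abs_mul, abs_of_pos h2n]
    have h3 := abs_sub (w + ((C 3).acc - (C 0).acc) + 2 * n * ν) (w + ((C 3).acc - (C 0).acc))
    rw [add_sub_cancel_left] at h3
    have h4 : 2 * n ≤ 2 * n * |ν| := le_mul_of_one_le_right h2n.le h1
    have h5 := hreg.two_le
    linarith
  rw [hν0, mul_zero, add_zero] at hν'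
  rw [← hν'] at hsmall
  have good : ∀ x, x ≠ 1 → x ≠ 2 → Good n m ![(C x).loc, (C 1).loc, (C 2).loc] := by
    intro x h1 h2
    exact good_vec₃ (hloc _) (hloc _) (hloc _) (hne x 1 h1) (hne x 2 h2) (hne 1 2 (by decide))
  rcases lt_trichotomy (C 3).loc (C 0).loc with h | h | h
  · refine gap n m ℓ (hreg.mono hc5) L hL halone F hF u (by linarith) (by linarith) _ _ _ _
      (good 0 (by decide) (by decide)) (hloc 3) h ?_ (hsep s01) (hsep s02)
    rw [abs_le] at hsmall
    push_cast at hsmall ⊢; linarith [hsmall.1]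
  · exact absurd h (hne _ _ (by decide))
  · rw [abs_sub_comm]
    refine gap n m ℓ (hreg.mono hc5) L hL halone F hF u (by linarith) (by linarith) _ _ _ _
      (good 3 (by decide) (by decide)) (hloc 0) h ?_ (hsep s31) (hsep s32)
    exact (le_abs_self _).trans hsmall

/-- The two locations differ by less than `2 n - m`, and the modulus exceeds `n`; hence `q` is
controlled by `b`. -/
theorem shift_bounds {n m : ℤ} (hm : 2 ≤ m) (hn : m < n) {i e a b q : ℤ} (hi : Valid n m i)
    (he : Valid n m e) (h : e = i + a + b * m + q * (2 * n - m + 1)) (ha : |a| ≤ n) :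
    |q| ≤ |b| + 3 := by
  have h1 := he.abs_sub_lt hi hm hn
  have h2 : |q| * n ≤ |q| * (2 * n - m + 1) := mul_le_mul_of_nonneg_left (by omega) (abs_nonneg _)
  have h3 : |q| * (2 * n - m + 1) = |(e - i) - a - b * m| := by
    rw [h, show i + a + b * m + q * (2 * n - m + 1) - i - a - b * m = q * (2 * n - m + 1) by ring,
      abs_mul, abs_of_pos (by omega : 0 < 2 * n - m + 1)]
  have h4 := abs_sub ((e - i) - a) (b * m)
  have h5 := abs_sub (e - i) a
  have h6 : |b * m| ≤ |b| * n := by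
    rw [abs_mul, abs_of_pos (by omega : 0 < m)]; exact mul_le_mul_of_nonneg_left hn.le (abs_nonneg _)
  have h7 : |q| * n ≤ (|b| + 3) * n := by linarith
  exact le_of_mul_le_mul_right h7 (by omega)

theorem abs_val_sub_le_of_shift {ε η θ κ : ℝ} (hε : 0 < ε) (hε1 : ε ≤ 1) (hη : 0 < η)
    (hη1 : η ≤ 1) (hθ : 0 < θ) (hθη : θ ≤ ε * η / 200) (hκ : 0 < κ) :
    ∃ δ : ℝ, 0 < δ ∧ δ ≤ 1 ∧ ∃ c : ℝ, 0 < c ∧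
    ∀ (n m : ℤ) (ℓ : ℝ), Regime ε c n m ℓ → ∀ L : ℕ, (L : ℤ) = 6 * n →
    (∀ Z, Good n m Z → κ * n ≤ occ (stv n m) (alone m (0 : Fin 3)) L Z) →
    (∀ Z : Fin 3 → ℤ, Good n m Z → κ ≤ occ (stv n m) (fun Z => if Z 0 = m then 1 else 0) L Z) →
    ∀ F : (Fin 3 → ℤ) → ℝ, (∀ Z, 0 ≤ F Z ∧ F Z ≤ 1) →
    ∀ t : ℕ, θ * ℓ ^ 2 ≤ t → (t : ℝ) ≤ 2 * θ * ℓ ^ 2 → ∀ i j k e : ℤ, Good n m ![i, j, k] →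
    Valid n m e → Sep n m (90 * ℓ) (i - j) → Sep n m (90 * ℓ) (i - k) →
    ∀ a b q : ℤ, e = i + a + b * m + q * (2 * n - m + 1) → |(a : ℝ)| ≤ δ * ℓ →
    |(b : ℝ)| * √n ≤ δ * ℓ → |val n m F t i j k - val n m F t e j k| ≤ η := by
  obtain ⟨δ₁, hδ₁, hδ₁ε, c₁, hc₁, chase⟩ :=
    abs_val_sub_le_of_chase_of_regime hε hε1 hη hη1 hθ hθη hκ
  set c : ℝ := min c₁ ((δ₁ / 5) ^ 2) with hc
  have hc0 : 0 < c := by positivity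
  refine ⟨δ₁ / 5, by positivity, by linarith, c, hc0, ?_⟩
  intro n m ℓ hreg L hL halone hdec F hF t ht1 ht2 i j k e hZ he hj hk a b q hab ha hb
  have hℓ := hreg.pos
  have hsq := hreg.sqrt_le (d := δ₁ / 5) (by positivity) (min_le_right _ _)
  have h1sq := hreg.one_le_sqrt
  have hδℓ : δ₁ / 5 * ℓ ≤ ℓ := by
    have : δ₁ / 5 * ℓ ≤ 1 * ℓ := by gcongr; linarith
    linarith
  rcases eq_or_ne e i with rfl | hei
  · simpa using hη.le
  have hj' : Sep n m (80 * ℓ) (e - j) :=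
    (hj.shift (u' := e - j) (a := a) (b := b) (q := q) (by rw [hab]; ring) ha hb).mono (by linarith)
  have hk' : Sep n m (80 * ℓ) (e - k) :=
    (hk.shift (u' := e - k) (a := a) (b := b) (q := q) (by rw [hab]; ring) ha hb).mono (by linarith)
  have hej : e ≠ j := sub_ne_zero.mp (hj'.ne_zero (by positivity))
  have hek : e ≠ k := sub_ne_zero.mp (hk'.ne_zero (by positivity))
  have hq : |q| ≤ |b| + 3 := by
    refine shift_bounds hreg.two_le hreg.lt (hZ.1 0) he hab ?_
    exact_mod_cast ha.trans (hδℓ.trans hreg.le_n)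
  have hqr : |(q : ℝ)| ≤ |(b : ℝ)| + 3 := by exact_mod_cast hq
  have hb1 : |(b : ℝ)| ≤ |(b : ℝ)| * √n := le_mul_of_one_le_right (abs_nonneg _) h1sq
  have hw : |((a + q : ℤ) : ℝ)| ≤ δ₁ * ℓ := by
    push_cast
    have := abs_add_le (a : ℝ) q
    linarith
  have hy : |((b - q : ℤ) : ℝ)| * √n ≤ δ₁ * ℓ := by
    push_cast
    have h1 : |(b : ℝ) - q| ≤ 2 * |(b : ℝ)| + 3 := by linarith [abs_sub (b : ℝ) q]
    have h2 := mul_le_mul_of_nonneg_right h1 (Real.sqrt_nonneg n)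
    linarith
  have hj80 : Sep n m (80 * ℓ) (i - j) := hj.mono (by linarith)
  have hk80 : Sep n m (80 * ℓ) (i - k) := hk.mono (by linarith)
  have hreg' := hreg.mono (min_le_left c₁ ((δ₁ / 5) ^ 2))
  have eij : i ≠ j := hZ.2.ne (show (0 : Fin 3) ≠ 1 by decide)
  have eik : i ≠ k := hZ.2.ne (show (0 : Fin 3) ≠ 2 by decide)
  have ejk : j ≠ k := hZ.2.ne (show (1 : Fin 3) ≠ 2 by decide)
  rcases le_total 0 (b - q) with hy0 | hy0
  · have hyr : (0 : ℝ) ≤ (b - q : ℤ) := by exact_mod_cast hy0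
    rw [abs_of_nonneg hyr] at hy
    -- `a + b m + q (2 n - m + 1) = (a + q) + m (b - q) + 2 n q`: the initial lag is `b - q`. If it
    -- is negative, the card and its replacement exchange roles.
    exact chase n m ℓ hreg' L hL halone hdec F hF t ht1 ht2 ![i, j, k, e]
      (good_vec₄ hZ he hei hej hek) (a + q) (b - q) hy0 hw hy
      ⟨q, show e - i = _ by rw [hab]; ring⟩ hj80 hk80 hj' hk'
  · have hyr : ((b - q : ℤ) : ℝ) ≤ 0 := by exact_mod_cast hy0
    rw [abs_of_nonpos hyr] at hy
    rw [abs_sub_comm]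
    refine chase n m ℓ hreg' L hL halone hdec F hF t ht1 ht2 ![e, j, k, i]
      (good_vec₄ (good_vec₃ he (hZ.1 1) (hZ.1 2) hej hek ejk) (hZ.1 0) hei.symm eij eik)
      (-(a + q)) (-(b - q)) (by omega) ?_ ?_
      ⟨-q, show i - e = _ by rw [hab]; ring⟩ hj' hk' hj80 hk80
    · rw [Int.cast_neg, abs_neg]; exact hw
    · rw [Int.cast_neg]; exact hy

theorem Ex_comp_equiv {ι : Type*} {n m : ℤ} (σ : Equiv.Perm ι) (F : (ι → ℤ) → ℝ) (t : ℕ)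
    (Z : ι → ℤ) : Ex (stv n m) t (fun Z => F (Z ∘ σ)) Z = Ex (stv n m) t F (Z ∘ σ) :=
  Ex_map (f := stv n m) (f' := stv n m) (fun Z : ι → ℤ => Z ∘ σ) (fun _ _ => rfl) F t Z

/-- The mean of a function of three separated cards changes little when one of them is moved a
little. -/
theorem abs_Ex_sub_update_le {ε η θ κ : ℝ} (hε : 0 < ε) (hε1 : ε ≤ 1) (hη : 0 < η)
    (hη1 : η ≤ 1) (hθ : 0 < θ) (hθη : θ ≤ ε * η / 200) (hκ : 0 < κ) :
    ∃ δ : ℝ, 0 < δ ∧ δ ≤ 1 ∧ ∃ c : ℝ, 0 < c ∧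
    ∀ (n m : ℤ) (ℓ : ℝ), Regime ε c n m ℓ → ∀ L : ℕ, (L : ℤ) = 6 * n →
    (∀ Z, Good n m Z → κ * n ≤ occ (stv n m) (alone m (0 : Fin 3)) L Z) →
    (∀ Z : Fin 3 → ℤ, Good n m Z → κ ≤ occ (stv n m) (fun Z => if Z 0 = m then 1 else 0) L Z) →
    ∀ F : (Fin 3 → ℤ) → ℝ, (∀ Z, 0 ≤ F Z ∧ F Z ≤ 1) →
    ∀ t : ℕ, θ * ℓ ^ 2 ≤ t → (t : ℝ) ≤ 2 * θ * ℓ ^ 2 → ∀ Z : Fin 3 → ℤ, Good n m Z →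
    ∀ (x : Fin 3) (e : ℤ), Valid n m e → (∀ y, y ≠ x → Sep n m (90 * ℓ) (Z x - Z y)) →
    ∀ a b q : ℤ, e = Z x + a + b * m + q * (2 * n - m + 1) → |(a : ℝ)| ≤ δ * ℓ →
    |(b : ℝ)| * √n ≤ δ * ℓ →
    |Ex (stv n m) t F Z - Ex (stv n m) t F (Function.update Z x e)| ≤ η := by
  obtain ⟨δ, hδ, hδ1, c, hc, main⟩ := abs_val_sub_le_of_shift hε hε1 hη hη1 hθ hθη hκ
  refine ⟨δ, hδ, hδ1, c, hc, ?_⟩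
  intro n m ℓ hreg L hL halone hdec F hF t ht1 ht2 Z hZ x e he hsep a b q hab ha hb
  -- The shuffle commutes with relabelling cards, so the moved card may be called `0`.
  set σ : Equiv.Perm (Fin 3) := Equiv.swap 0 x with hσ
  have hσσ : ∀ Z : Fin 3 → ℤ, (Z ∘ σ) ∘ σ = Z := by
    intro Z; funext y; simp [hσ]
  have h0 : σ 0 = x := by simp [hσ]
  have hne : ∀ y, y ≠ 0 → σ y ≠ x := fun y hy h => hy (σ.injective (h.trans h0.symm))
  have e1 : ∀ Z : Fin 3 → ℤ, Ex (stv n m) t F Z =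
      val n m (fun Z => F (Z ∘ σ)) t ((Z ∘ σ) 0) ((Z ∘ σ) 1) ((Z ∘ σ) 2) := by
    intro Z
    unfold val
    rw [vec_eta, Ex_comp_equiv, hσσ]
  have hg : Good n m (Z ∘ σ) := ⟨fun y => hZ.1 _, hZ.2.comp σ.injective⟩
  rw [e1, e1]
  simp only [Function.comp_apply, h0, Function.update_self,
    Function.update_of_ne (hne 1 (by decide)), Function.update_of_ne (hne 2 (by decide))]
  refine main n m ℓ hreg L hL halone hdec _ (fun Z => hF _) t ht1 ht2 (Z x) (Z (σ 1)) (Z (σ 2)) e ?_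
    he (hsep _ (hne 1 (by decide))) (hsep _ (hne 2 (by decide))) a b q hab ha hb
  rw [← vec_eta (Z ∘ σ)] at hg
  simpa only [Function.comp_apply, h0] using hg

theorem good_of_sep {n m : ℤ} {ρ : ℝ} (hρ : 0 ≤ ρ) {Z : Fin 3 → ℤ} (hZ : ∀ x, Valid n m (Z x))
    (h : ∀ x y, y ≠ x → Sep n m ρ (Z x - Z y)) : Good n m Z := by
  refine ⟨hZ, fun x y e => ?_⟩
  by_contra hxy
  exact (h x y (Ne.symm hxy)).ne_zero hρ (sub_eq_zero.mpr e)

/-- The mean of a function of three separated cards changes little when they are moved a little. -/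
theorem abs_Ex_sub_le {ε η θ κ : ℝ} (hε : 0 < ε) (hε1 : ε ≤ 1) (hη : 0 < η)
    (hη1 : η ≤ 1) (hθ : 0 < θ) (hθη : θ ≤ ε * η / 200) (hκ : 0 < κ) :
    ∃ δ : ℝ, 0 < δ ∧ δ ≤ 1 ∧ ∃ c : ℝ, 0 < c ∧
    ∀ (n m : ℤ) (ℓ : ℝ), Regime ε c n m ℓ → ∀ L : ℕ, (L : ℤ) = 6 * n →
    (∀ Z, Good n m Z → κ * n ≤ occ (stv n m) (alone m (0 : Fin 3)) L Z) →
    (∀ Z : Fin 3 → ℤ, Good n m Z → κ ≤ occ (stv n m) (fun Z => if Z 0 = m then 1 else 0) L Z) →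
    ∀ F : (Fin 3 → ℤ) → ℝ, (∀ Z, 0 ≤ F Z ∧ F Z ≤ 1) →
    ∀ t : ℕ, θ * ℓ ^ 2 ≤ t → (t : ℝ) ≤ 2 * θ * ℓ ^ 2 → ∀ Z Z' : Fin 3 → ℤ,
    (∀ x, Valid n m (Z x)) → (∀ x, Valid n m (Z' x)) →
    (∀ x y, y ≠ x → Sep n m (100 * ℓ) (Z x - Z y)) →
    (∀ x, ∃ a b q : ℤ, Z' x = Z x + a + b * m + q * (2 * n - m + 1) ∧ |(a : ℝ)| ≤ δ * ℓ ∧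
    |(b : ℝ)| * √n ≤ δ * ℓ) →
    |Ex (stv n m) t F Z - Ex (stv n m) t F Z'| ≤ 3 * η := by
  obtain ⟨δ, hδ, hδ1, c, hc, main⟩ := abs_Ex_sub_update_le hε hε1 hη hη1 hθ hθη hκ
  refine ⟨δ, hδ, hδ1, c, hc, ?_⟩
  intro n m ℓ hreg L hL halone hdec F hF t ht1 ht2 Z Z' hZ hZ' hsep hclose
  have hℓ := hreg.pos
  have hδℓ : δ * ℓ ≤ ℓ := by
    have : δ * ℓ ≤ 1 * ℓ := by gcongr
    linarith
  -- The cards are moved one at a time; configurations with some cards already moved are still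
  -- separated by `90 ℓ`.
  have hone : ∀ (Y : Fin 3 → ℤ), (∀ x, Y x = Z x ∨ Y x = Z' x) → ∀ x, Y x = Z x →
      |Ex (stv n m) t F Y - Ex (stv n m) t F (Function.update Y x (Z' x))| ≤ η := by
    intro Y hY x hx
    have hYv : ∀ x, Valid n m (Y x) := fun x => by
      rcases hY x with h | h <;> rw [h]
      exacts [hZ x, hZ' x]
    have hYc : ∀ x, ∃ a b q : ℤ, Y x = Z x + a + b * m + q * (2 * n - m + 1) ∧
        |(a : ℝ)| ≤ δ * ℓ ∧ |(b : ℝ)| * √n ≤ δ * ℓ := fun x => by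
      rcases hY x with h | h
      · exact ⟨0, 0, 0, by rw [h]; ring, by simpa using (by positivity),
          by simpa using (by positivity)⟩
      · rw [h]; exact hclose x
    have hYs : ∀ x y, y ≠ x → Sep n m (90 * ℓ) (Y x - Y y) := by
      intro x y hxy
      obtain ⟨a, b, q, e, ha, hb⟩ := hYc x
      obtain ⟨a', b', q', e', ha', hb'⟩ := hYc y
      refine ((hsep x y hxy).shift (u' := Y x - Y y) (a := a - a') (b := b - b') (q := q - q')
        (A := 2 * ℓ) (B := 2 * ℓ) (by rw [e, e']; ring) ?_ ?_).mono (by linarith)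
      · push_cast; linarith [abs_sub (a : ℝ) a']
      · push_cast
        have := mul_le_mul_of_nonneg_right (abs_sub (b : ℝ) b') (Real.sqrt_nonneg n)
        linarith
    obtain ⟨a, b, q, e, ha, hb⟩ := hclose x
    exact main n m ℓ hreg L hL halone hdec F hF t ht1 ht2 Y (good_of_sep (by positivity) hYv hYs) x _
      (hZ' x) (fun y hy => hYs x y hy) a b q (by rw [e, hx]) ha hb
  have h1 := hone Z (fun _ => Or.inl rfl) 0 rfl
  have h2 := hone (Function.update Z 0 (Z' 0)) ?_ 1 (by simp)
  have h3 := hone (Function.update (Function.update Z 0 (Z' 0)) 1 (Z' 1)) ?_ 2 (by simp)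
  · have e3 : Function.update (Function.update (Function.update Z 0 (Z' 0)) 1 (Z' 1)) 2 (Z' 2) = Z' := by
      funext x; fin_cases x <;> simp [Function.update]
    rw [e3] at h3
    rw [abs_le] at *
    constructor <;> linarith [h1.1, h1.2, h2.1, h2.2, h3.1, h3.2]
  · intro x; fin_cases x <;> simp [Function.update]
  · intro x; fin_cases x <;> simp [Function.update]

end OverlappingCycles

namespace OverlappingCycles

/-! ### Additivity of occupation times. -/

section Occupation

variable {S : Type*} {f : S → Bool → S}

theorem occ_mono_of_inv {I : S → Prop} (hI : ∀ s b, I s → I (f s b)) {g g' : S → ℝ}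
    (h : ∀ s, I s → g s ≤ g' s) (t : ℕ) (s : S) (hs : I s) : occ f g t s ≤ occ f g' t s := by
  rw [occ_eq_sum, occ_eq_sum]
  exact Finset.sum_le_sum fun u _ => Ex_mono_of_inv hI h u s hs

theorem occ_finset_sum {ι : Type*} (A : Finset ι) (g : ι → S → ℝ) (t : ℕ) (s : S) :
    occ f (fun s => ∑ x ∈ A, g x s) t s = ∑ x ∈ A, occ f (g x) t s := by
  simp only [occ_eq_sum, Ex_sum]; rw [Finset.sum_comm]

theorem occ_lin_comb (g g' : S → ℝ) (c c' : ℝ) (t : ℕ) (s : S) :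
    occ f (fun s => c * g s + c' * g' s) t s = c * occ f g t s + c' * occ f g' t s := by
  simp only [occ_eq_sum, Ex_add, Ex_mul, Finset.sum_add_distrib, Finset.mul_sum]

theorem mul_le_occ_of_blocks {I : S → Prop} (hI : ∀ s b, I s → I (f s b)) {q : S → ℝ}
    (hq : ∀ s, 0 ≤ q s) {κ : ℝ} {L : ℕ} (h : ∀ s, I s → κ ≤ occ f q L s) {Q t : ℕ}
    (hQ : Q * L ≤ t) (s : S) (hs : I s) : Q * κ ≤ occ f q t s := by
  refine le_trans ?_ (occ_le_occ hq hQ s)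
  clear hQ
  induction Q with
  | zero => simp [occ]
  | succ Q ih =>
    have h1 := Ex_mono_of_inv hI h (Q * L) s hs
    rw [Ex_const] at h1
    rw [show (Q + 1) * L = Q * L + L by ring, occ_add]
    push_cast; linarith

end Occupation

/-! ### Second and fourth moments of linear functionals of the tracks. -/

section Fluctuation

variable {n m : ℤ}

/-- The change of the functional `lin` in one round, up to the sign of the coin. -/
noncomputable def push (n m : ℤ) (v w : Fin 3 → ℝ) (Z : Fin 3 → ℤ) : ℝ :=
  ∑ x, (v x * (if Z x < 0 then 1 else 0) - √n * w x * (if Z x = m then 1 else 0))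

/-- A linear functional of the fluctuations and decision excesses of three cards. -/
noncomputable def lin (n : ℤ) (v w a b : Fin 3 → ℝ) (C : Fin 3 → Card) : ℝ :=
  ∑ x, (v x * ((C x).acc - a x) + √n * w x * ((C x).turn - b x))

/-- The squared distance of the fluctuations and decision excesses of three cards from given
values. -/
noncomputable def dsq (n : ℤ) (a b : Fin 3 → ℝ) (C : Fin 3 → Card) : ℝ :=
  ∑ x, (((C x).acc - a x) ^ 2 + n * ((C x).turn - b x) ^ 2)

theorem lin_cstv (v w a b : Fin 3 → ℝ) (C : Fin 3 → Card) (c : Bool) :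
    lin n v w a b (cstv n m C c) = lin n v w a b C + sgn c * push n m v w (locs C) := by
  simp only [lin, push, Finset.mul_sum, ← Finset.sum_add_distrib]
  refine Finset.sum_congr rfl fun x _ => ?_
  simp only [cstv, cst, dAcc, dTurn, locs]
  by_cases h1 : (C x).loc < 0 <;> by_cases h2 : (C x).loc = m <;>
    simp only [h1, h2, if_true, if_false] <;> push_cast <;> (try split_ifs) <;> ring

/-- A bound for the quadratic variation of `lin` during `t` rounds. -/
noncomputable def budget (n m : ℤ) (t : ℕ) (Z : Fin 3 → ℤ) : ℝ :=
  18 * t + 6 * n * ∑ x, potential m t (Z x)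

theorem budget_nonneg (hm : 2 ≤ m) (hn : m < n) (t : ℕ) (Z : Fin 3 → ℤ) : 0 ≤ budget n m t Z := by
  have : (0 : ℝ) ≤ n := by exact_mod_cast (by omega : 0 ≤ n)
  have h := Finset.sum_nonneg fun x (_ : x ∈ Finset.univ) => potential_nonneg hm t (Z x)
  unfold budget; positivity

theorem budget_le (hm : 2 ≤ m) (hn : m < n) {ε : ℝ} (hε : 0 < ε) (hε1 : ε ≤ 1) (h : ε * n ≤ m)
    {t : ℕ} (ht : (n : ℝ) ≤ t) {Z : Fin 3 → ℤ} (hZ : ∀ x, Valid n m (Z x)) :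
    budget n m t Z ≤ 54 / ε * t := by
  have hn0 : (0 : ℝ) < n := by exact_mod_cast (by omega : 0 < n)
  have hm0 : (0 : ℝ) < m := by exact_mod_cast (by omega : 0 < m)
  have h1 : ∑ x, potential m t (Z x) ≤ 3 * ((t : ℝ) / m + 1) := by
    refine (Finset.sum_le_sum fun x _ => potential_le hm (hZ x) t).trans ?_
    simp [mul_add]
  have h2 : (n : ℝ) / m ≤ 1 / ε := by rw [div_le_div_iff₀ hm0 hε]; linarith
  have h3 : (n : ℝ) / m * t ≤ 1 / ε * t := by gcongr
  have h4 : (1 : ℝ) * t ≤ 1 / ε * t := by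
    gcongr; rw [le_div_iff₀ hε]; linarith
  unfold budget
  calc 18 * (t : ℝ) + 6 * n * ∑ x, potential m t (Z x) ≤ 18 * t + 6 * n * (3 * ((t : ℝ) / m + 1)) := by
        gcongr
    _ = 18 * t + 18 * (n / m * t) + 18 * n := by field_simp; ring
    _ ≤ 54 * (1 / ε * t) := by linarith
    _ = _ := by ring

theorem one_add_decisions_add_budget_le (hm : 2 ≤ m) (hn : m < n) {Z : Fin 3 → ℤ}
    (hZ : ∀ x, Valid n m (Z x)) (t : ℕ) (c : Bool) :
    6 * ∑ x, (1 + n * (if Z x = m then (1 : ℝ) else 0)) + budget n m t (stv n m Z c) ≤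
      budget n m (t + 1) Z := by
  have hn0 : (0 : ℝ) < n := by exact_mod_cast (by omega : 0 < n)
  have h := Finset.sum_le_sum fun x (_ : x ∈ Finset.univ) => potential_st hm hn (hZ x) c t
  rw [Finset.sum_add_distrib] at h
  have h' := mul_le_mul_of_nonneg_left h hn0.le
  simp only [budget, stv, Finset.sum_add_distrib, ← Finset.mul_sum]
  simp only [Finset.sum_const, Finset.card_univ, Fintype.card_fin, nsmul_eq_mul]
  push_cast
  linarith

theorem push_sq_le (hn : 0 ≤ n) {v w : Fin 3 → ℝ} (hvw : ∑ x, (v x ^ 2 + w x ^ 2) = 1)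
    (Z : Fin 3 → ℤ) :
    push n m v w Z ^ 2 ≤ 6 * ∑ x, (1 + n * (if Z x = m then (1 : ℝ) else 0)) := by
  have hn0 : (0 : ℝ) ≤ n := by exact_mod_cast hn
  have h1 : ∀ x, v x ^ 2 + w x ^ 2 ≤ 1 := fun x => by
    rw [← hvw]
    exact Finset.single_le_sum (f := fun x => v x ^ 2 + w x ^ 2) (fun y _ => by positivity)
      (Finset.mem_univ x)
  unfold push
  refine (sq_sum_le_card_mul_sum_sq).trans ?_
  rw [Finset.card_univ, Fintype.card_fin]
  have h2 : ∀ x ∈ Finset.univ, (v x * (if Z x < 0 then 1 else 0) -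
      √n * w x * (if Z x = m then 1 else 0)) ^ 2 ≤ 2 * (1 + n * (if Z x = m then (1 : ℝ) else 0)) := by
    intro x _
    have hv := h1 x
    have hs := Real.sq_sqrt hn0
    have hnw : n * w x ^ 2 ≤ n * 1 := by gcongr; nlinarith [sq_nonneg (v x)]
    have e1 : (√n * w x) ^ 2 = n * w x ^ 2 := by rw [mul_pow, hs]
    have hv2 : v x ^ 2 ≤ 1 := by nlinarith [sq_nonneg (w x)]
    have h3 := sq_nonneg (v x + √n * w x)
    split_ifs <;> simp <;> nlinarith
  have h3 := Finset.sum_le_sum h2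
  rw [← Finset.mul_sum] at h3
  push_cast; linarith

theorem Ex_lin_sq_step (v w a b : Fin 3 → ℝ) (C : Fin 3 → Card) :
    (lin n v w a b (cstv n m C true) ^ 2 + lin n v w a b (cstv n m C false) ^ 2) / 2 =
      lin n v w a b C ^ 2 + push n m v w (locs C) ^ 2 := by
  rw [lin_cstv, lin_cstv]; simp [sgn]; ring

theorem good_cstv (hm : 2 ≤ m) (hn : m < n) (C : Fin 3 → Card) (c : Bool) (h : Good n m (locs C)) :
    Good n m (locs (cstv n m C c)) := by
  rw [locs_cstv]; exact h.stv hm hn c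

theorem Ex_lin (hm : 2 ≤ m) (hn : m < n) (v w a b : Fin 3 → ℝ) (t : ℕ) (C : Fin 3 → Card)
    (hC : Good n m (locs C)) : Ex (cstv n m) t (lin n v w a b) C = lin n v w a b C := by
  refine Ex_eq_of_martingale (I := fun C => Good n m (locs C)) (fun C c => good_cstv hm hn C c)
    (fun C _ => ?_) t C hC
  rw [lin_cstv, lin_cstv]; simp [sgn]; ring

theorem Ex_lin_sq (hm : 2 ≤ m) (hn : m < n) (v w a b : Fin 3 → ℝ) (t : ℕ) (C : Fin 3 → Card)
    (hC : Good n m (locs C)) : Ex (cstv n m) t (fun C => lin n v w a b C ^ 2) C =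
      lin n v w a b C ^ 2 + occ (stv n m) (fun Z => push n m v w Z ^ 2) t (locs C) := by
  rw [← occ_map (f := cstv n m) (f' := stv n m) locs (fun C c => locs_cstv n m C c)]
  exact Ex_sq_eq_of_increment (I := fun C => Good n m (locs C)) (fun C c => good_cstv hm hn C c)
    (fun C _ => Ex_lin_sq_step v w a b C) t C hC

/-- If the quadratic variation still to come is at most `B`, then `h⁴ + 6 h² B + 3 B²`, the Gaussian
fourth moment, is a supersolution. -/
theorem Ex_lin_fourth_le (hm : 2 ≤ m) (hn : m < n) {v w : Fin 3 → ℝ}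
    (hvw : ∑ x, (v x ^ 2 + w x ^ 2) = 1) (a b : Fin 3 → ℝ) (t : ℕ) (C : Fin 3 → Card)
    (hC : Good n m (locs C)) : Ex (cstv n m) t (fun C => lin n v w a b C ^ 4) C ≤
      lin n v w a b C ^ 4 + 6 * lin n v w a b C ^ 2 * budget n m t (locs C) +
        3 * budget n m t (locs C) ^ 2 := by
  refine Ex_le_of_supersolution (I := fun C => Good n m (locs C)) (fun C c => good_cstv hm hn C c)
    (fun t C => lin n v w a b C ^ 4 + 6 * lin n v w a b C ^ 2 * budget n m t (locs C) +
        3 * budget n m t (locs C) ^ 2) (fun C _ => ?_) (fun t C hC => ?_) t C hC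
  · have := budget_nonneg hm hn 0 (locs C)
    have h2 : 0 ≤ 6 * lin n v w a b C ^ 2 * budget n m 0 (locs C) := by positivity
    have h3 : 0 ≤ 3 * budget n m 0 (locs C) ^ 2 := by positivity
    linarith
  · rw [lin_cstv, lin_cstv, locs_cstv, locs_cstv]
    have p := push_sq_le (n := n) (m := m) (by omega) hvw (locs C)
    have b1 := one_add_decisions_add_budget_le hm hn hC.1 t true
    have b2 := one_add_decisions_add_budget_le hm hn hC.1 t false
    have c1 := budget_nonneg hm hn t (stv n m (locs C) true)
    have c2 := budget_nonneg hm hn t (stv n m (locs C) false)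
    generalize budget n m t (stv n m (locs C) true) = B₁ at *
    generalize budget n m t (stv n m (locs C) false) = B₂ at *
    generalize budget n m (t + 1) (locs C) = B at *
    generalize push n m v w (locs C) = ω at *
    generalize lin n v w a b C = h at *
    -- The budget left after paying for the present increment `ω`; it dominates the budgets of both
    -- successors.
    set β : ℝ := B - ω ^ 2 with hβ
    have hB : B = β + ω ^ 2 := by ring
    have d1 : B₁ ≤ β := by linarith
    have d2 : B₂ ≤ β := by linarith
    have e1 : 6 * (h - ω) ^ 2 * B₁ ≤ 6 * (h - ω) ^ 2 * β := by gcongr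
    have e2 : 6 * (h + ω) ^ 2 * B₂ ≤ 6 * (h + ω) ^ 2 * β := by gcongr
    have e3 : B₁ ^ 2 ≤ β ^ 2 := by gcongr
    have e4 : B₂ ^ 2 ≤ β ^ 2 := by gcongr
    have e5 : 0 ≤ ω ^ 4 := by positivity
    rw [hB]
    simp only [sgn, if_true, Bool.false_eq_true, if_false]
    push_cast
    rw [neg_one_mul, one_mul, ← sub_eq_add_neg]
    have e6 : ((h - ω) ^ 4 + 6 * (h - ω) ^ 2 * β + 3 * β ^ 2 + ((h + ω) ^ 4 + 6 * (h + ω) ^ 2 * β +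
        3 * β ^ 2)) / 2 + 2 * ω ^ 4 = h ^ 4 + 6 * h ^ 2 * (β + ω ^ 2) + 3 * (β + ω ^ 2) ^ 2 := by ring
    linarith

theorem Ex_dsq_le (hm : 2 ≤ m) (hn : m < n) (a b : Fin 3 → ℝ) (t : ℕ) (C : Fin 3 → Card)
    (hC : Good n m (locs C)) : Ex (cstv n m) t (dsq n a b) C ≤
      dsq n a b C + budget n m t (locs C) := by
  have hn0 : (0 : ℝ) < n := by exact_mod_cast (by omega : 0 < n)
  refine Ex_le_of_supersolution (I := fun C => Good n m (locs C)) (fun C c => good_cstv hm hn C c)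
    (fun t C => dsq n a b C + budget n m t (locs C)) (fun C _ => ?_) (fun t C hC => ?_) t C hC
  · linarith [budget_nonneg hm hn 0 (locs C)]
  · rw [locs_cstv, locs_cstv]
    have b1 := one_add_decisions_add_budget_le hm hn hC.1 t true
    have b2 := one_add_decisions_add_budget_le hm hn hC.1 t false
    have h1 : (dsq n a b (cstv n m C true) + dsq n a b (cstv n m C false)) / 2 ≤
        dsq n a b C + 6 * ∑ x, (1 + n * (if locs C x = m then (1 : ℝ) else 0)) := by
      simp only [dsq, Finset.mul_sum]
      rw [← Finset.sum_add_distrib, ← Finset.sum_add_distrib, Finset.sum_div]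
      refine Finset.sum_le_sum fun x _ => ?_
      simp only [cstv, cst, dAcc, dTurn, sgn, locs]
      by_cases h1 : (C x).loc < 0 <;> by_cases h2 : (C x).loc = m <;>
        simp only [h1, h2, if_true, if_false, Bool.false_eq_true, not_lt.mpr (by omega : 0 ≤ m)] <;>
        push_cast <;> nlinarith
    linarith

/-- Nondegeneracy in every direction. If only `x` is in the lower part and nobody decides, the
increment is `v x`. If `x` decides, the increment is `√n w x` up to an error with square at most
`3`; no two cards decide at once. -/
theorem push_sq_ge (hm : 2 ≤ m) (hn : m < n) {v w : Fin 3 → ℝ}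
    (hvw : ∑ x, (v x ^ 2 + w x ^ 2) = 1) {Z : Fin 3 → ℤ} (hZ : Good n m Z) :
    ∑ x, (v x ^ 2 * alone m x Z + (n * w x ^ 2 / 2 - 3) * (if Z x = m then 1 else 0)) ≤
      push n m v w Z ^ 2 := by
  have hn0 : (0 : ℝ) ≤ n := by exact_mod_cast (by omega : 0 ≤ n)
  have hs := Real.sq_sqrt hn0
  by_cases h1 : ∃ x, Z x = m
  · obtain ⟨x, hx⟩ := h1
    have ha : ∀ y, alone m y Z = 0 := by
      intro y
      unfold alone
      rw [if_neg]
      rintro ⟨h2, h3⟩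
      rcases eq_or_ne x y with rfl | hxy
      · omega
      · have := h3 x hxy; omega
    have hd : ∀ y, y ≠ x → Z y ≠ m := fun y hy h => hy (hZ.2 (h.trans hx.symm))
    have e1 : ∑ y, (v y ^ 2 * alone m y Z + (n * w y ^ 2 / 2 - 3) * (if Z y = m then (1 : ℝ) else 0)) =
        n * w x ^ 2 / 2 - 3 := by
      rw [Finset.sum_eq_single x]
      · rw [ha, if_pos hx]; ring
      · intro y _ hy; rw [ha, if_neg (hd y hy)]; ring
      · simp
    set A : ℝ := ∑ y, v y * (if Z y < 0 then 1 else 0) with hA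
    have e2 : push n m v w Z = A - √n * w x := by
      unfold push
      rw [Finset.sum_sub_distrib]
      congr 1
      rw [Finset.sum_eq_single x]
      · rw [if_pos hx]; ring
      · intro y _ hy; rw [if_neg (hd y hy)]; ring
      · simp
    have e3 : A ^ 2 ≤ 3 := by
      rw [hA]
      refine (sq_sum_le_card_mul_sum_sq).trans ?_
      rw [Finset.card_univ, Fintype.card_fin]
      have : ∑ y, (v y * (if Z y < 0 then (1 : ℝ) else 0)) ^ 2 ≤ ∑ y, (v y ^ 2 + w y ^ 2) := by
        refine Finset.sum_le_sum fun y _ => ?_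
        split_ifs <;> nlinarith [sq_nonneg (v y), sq_nonneg (w y)]
      push_cast; linarith
    rw [e1, e2]
    have e4 : (√n * w x) ^ 2 = n * w x ^ 2 := by rw [mul_pow, hs]
    nlinarith [sq_nonneg (2 * A - √n * w x)]
  · simp only [not_exists] at h1
    simp only [h1, if_false, mul_zero, add_zero, push, sub_zero]
    by_cases h2 : ∃ x, Z x < 0 ∧ ∀ y, y ≠ x → 0 < Z y ∧ Z y < m
    · obtain ⟨x, hx, hy⟩ := h2
      have n1 : ∀ y, y ≠ x → ¬ Z y < 0 := fun y h => by have := (hy y h).1; omega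
      have ha : ∀ y, y ≠ x → alone m y Z = 0 := fun y h => by
        unfold alone; rw [if_neg]; exact fun h' => n1 y h h'.1
      rw [Finset.sum_eq_single x (fun y _ h => by rw [ha y h, mul_zero]) (by simp),
        Finset.sum_eq_single x (fun y _ h => by rw [if_neg (n1 y h), mul_zero]) (by simp), if_pos hx]
      have := alone_le_one (m := m) x Z
      nlinarith [sq_nonneg (v x)]
    · have ha : ∀ y, alone m y Z = 0 := fun y => by
        unfold alone; rw [if_neg]; exact fun h => h2 ⟨y, h⟩
      simp only [ha, mul_zero, Finset.sum_const_zero]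
      positivity

/-- Each block of `6 n` rounds contributes `κ n` to the coefficient of `v x ^ 2`, and to that of `w
x ^ 2` at least `κ` decisions of weight `n / 2`; the subtracted term collects the errors at
decisions. -/
theorem le_occ_push_sq (hm : 2 ≤ m) (hn : m < n) {κ : ℝ} (hκ : 0 < κ) {L : ℕ}
    (hL : ∀ Z, Good n m Z → ∀ x, κ * n ≤ occ (stv n m) (alone m x) L Z ∧
      κ ≤ occ (stv n m) (fun Z => if Z x = m then 1 else 0) L Z)
    {v w : Fin 3 → ℝ} (hvw : ∑ x, (v x ^ 2 + w x ^ 2) = 1) {Q t : ℕ} (hQ : Q * L ≤ t)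
    {Z : Fin 3 → ℤ} (hZ : Good n m Z) :
    κ / 2 * (n * Q) - 9 * (t / m + 1) ≤ occ (stv n m) (fun Z => push n m v w Z ^ 2) t Z := by
  have hn0 : (0 : ℝ) ≤ n := by exact_mod_cast (by omega : 0 ≤ n)
  have hI := fun (Z : Fin 3 → ℤ) (c : Bool) (h : Good n m Z) => h.stv hm hn c
  refine le_trans ?_ (occ_mono_of_inv (I := Good n m) hI (fun Z h => push_sq_ge hm hn hvw h) t Z hZ)
  rw [occ_finset_sum]
  simp only [occ_lin_comb]
  have h1 : ∀ x, Q * (κ * n) ≤ occ (stv n m) (alone m x) t Z := fun x =>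
    mul_le_occ_of_blocks hI (alone_nonneg x) (fun Z h => (hL Z h x).1) hQ Z hZ
  have h2 : ∀ x, Q * κ ≤ occ (stv n m) (fun Z => if Z x = m then (1 : ℝ) else 0) t Z := fun x =>
    mul_le_occ_of_blocks hI (fun Z => by split_ifs <;> norm_num) (fun Z h => (hL Z h x).2) hQ Z hZ
  have h3 : ∀ x, occ (stv n m) (fun Z => if Z x = m then (1 : ℝ) else 0) t Z ≤ t / m + 1 := fun x =>
    (occ_decision_le hm hn hZ.1 x t).trans (potential_le hm (hZ.1 x) t)
  have h4 : ∑ x : Fin 3, ((v x ^ 2 + w x ^ 2) * (κ / 2 * (n * Q)) - 3 * ((t : ℝ) / m + 1)) =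
      κ / 2 * (n * Q) - 9 * (t / m + 1) := by
    rw [Finset.sum_sub_distrib, ← Finset.sum_mul, hvw]; simp; ring
  rw [← h4]
  refine Finset.sum_le_sum fun x _ => ?_
  have k1 := mul_le_mul_of_nonneg_left (h1 x) (sq_nonneg (v x))
  have k2 := mul_le_mul_of_nonneg_left (h2 x) (by positivity : 0 ≤ n * w x ^ 2 / 2)
  have k3 := h3 x
  have k4 : 0 ≤ v x ^ 2 * (κ / 2 * (n * Q)) := by positivity
  have e : v x ^ 2 * ((Q : ℝ) * (κ * n)) = 2 * (v x ^ 2 * (κ / 2 * (n * Q))) := by ring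
  have e2 : n * w x ^ 2 / 2 * ((Q : ℝ) * κ) = w x ^ 2 * (κ / 2 * (n * Q)) := by ring
  rw [e] at k1; rw [e2] at k2
  linarith

end Fluctuation

end OverlappingCycles

/-! ### Steering the tracks to prescribed values. -/

namespace OverlappingCycles

/-- Turns moments into a one-sided probability bound. The linear term has mean `0` for a martingale;
it makes the polynomial negative for moderately negative `μ`, while the quartic term wins for very
negative `μ`. -/
theorem quartic_le_indicator {g c μ : ℝ} (hg : 0 < g) (hc : 0 < c) (hc1 : c ≤ 1) :
    g⁻¹ * μ + μ ^ 2 - g ^ 2 * μ ^ 4 - c / 4 ≤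
      2 / g ^ 2 * (if c / (4 * (g⁻¹ + 1)) ≤ μ then 1 else 0) := by
  set α := g⁻¹ with hα
  have hα0 : 0 < α := inv_pos.mpr hg
  have hgα : g * α = 1 := mul_inv_cancel₀ hg.ne'
  have e : 2 / g ^ 2 = 2 * α ^ 2 := by rw [hα]; field_simp
  rw [e]
  split_ifs with h
  · have h1 : 0 ≤ (g * μ ^ 2 - α) ^ 2 := sq_nonneg _
    have h2 : (g * μ ^ 2 - α) ^ 2 = g ^ 2 * μ ^ 4 - 2 * (g * α) * μ ^ 2 + α ^ 2 := by ring
    rw [hgα] at h2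
    nlinarith [sq_nonneg (α - μ)]
  · rw [mul_zero]
    rw [not_le, lt_div_iff₀ (by positivity)] at h
    have h4 : 0 ≤ g ^ 2 * μ ^ 4 := by positivity
    rcases le_total 0 μ with h0 | h0
    · have h1 : μ ≤ 1 := by nlinarith
      nlinarith
    · rcases le_total (-μ) α with h1 | h1
      · nlinarith
      · have h2 : 1 ≤ g * (-μ) := by rw [← hgα]; gcongr
        have h3 : 1 ≤ (g * (-μ)) ^ 2 := one_le_pow₀ h2
        have h5 : 1 * μ ^ 2 ≤ (g * (-μ)) ^ 2 * μ ^ 2 := by gcongr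
        have h6 : (g * (-μ)) ^ 2 * μ ^ 2 = g ^ 2 * μ ^ 4 := by ring
        nlinarith

section Fluctuation

variable {n m : ℤ}

/-- The fluctuations of a family of tracked cards. -/
def accs (C : Fin 3 → Card) : Fin 3 → ℝ := fun x => (C x).acc

/-- The decision excesses of a family of tracked cards. -/
def turns (C : Fin 3 → Card) : Fin 3 → ℝ := fun x => (C x).turn

theorem lin_self (v w : Fin 3 → ℝ) (C : Fin 3 → Card) : lin n v w (accs C) (turns C) C = 0 := by
  simp [lin, accs, turns]

theorem dsq_self (C : Fin 3 → Card) : dsq n (accs C) (turns C) C = 0 := by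
  simp [dsq, accs, turns]

theorem dsq_nonneg (hn : 0 ≤ n) (a b : Fin 3 → ℝ) (C : Fin 3 → Card) : 0 ≤ dsq n a b C := by
  have hn0 : (0 : ℝ) ≤ n := by exact_mod_cast hn
  unfold dsq; positivity

/-- With a probability bounded from below, a block of rounds moves the tracks of three cards in any
prescribed direction. -/
theorem le_Ex_progress {ε κ : ℝ} (hε : 0 < ε) (hε1 : ε ≤ 1) (hκ : 0 < κ) (hκ1 : κ ≤ 1) :
    ∃ p₀ θ₀ K c : ℝ, 0 < p₀ ∧ p₀ ≤ 1 ∧ 0 < θ₀ ∧ θ₀ ≤ 1 ∧ 1 ≤ K ∧ 0 < c ∧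
    ∀ (n m : ℤ) (ℓ : ℝ), Regime ε c n m ℓ → ∀ L : ℕ, (L : ℤ) = 6 * n →
    (∀ Z, Good n m Z → ∀ x, κ * n ≤ occ (stv n m) (alone m x) L Z ∧
      κ ≤ occ (stv n m) (fun Z => if Z x = m then 1 else 0) L Z) →
    ∀ v w : Fin 3 → ℝ, ∑ x, (v x ^ 2 + w x ^ 2) = 1 → ∀ u : ℕ, 12 * (n : ℝ) ≤ u →
    ∀ C : Fin 3 → Card, Good n m (locs C) →
    p₀ ≤ Ex (cstv n m) u (fun C' => if θ₀ * √u ≤ lin n v w (accs C) (turns C) C' ∧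
      dsq n (accs C) (turns C) C' ≤ K * u then 1 else 0) C := by
  set c₀ : ℝ := κ / 48 with hc₀
  have hc₀0 : 0 < c₀ := by positivity
  set C₄ : ℝ := 3 * (54 / ε) ^ 2 with hC₄
  have hC₄0 : 0 < C₄ := by positivity
  -- Makes the quartic term cost at most `c₀ / 4`. With the constant `c₀ / 4`, half of the second
  -- moment `c₀` survives, and `K` is chosen so that Markov's inequality for `dsq` uses half of the
  -- remaining probability.
  set g : ℝ := √(c₀ / (4 * C₄)) with hg
  have hg0 : 0 < g := Real.sqrt_pos.mpr (by positivity)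
  have hg2 : g ^ 2 = c₀ / (4 * C₄) := Real.sq_sqrt (by positivity)
  have hg21 : g ^ 2 ≤ 1 := by
    rw [hg2, div_le_one (by positivity)]
    have : 1 ≤ 54 / ε := by rw [le_div_iff₀ hε]; linarith
    have : 1 ≤ (54 / ε) ^ 2 := one_le_pow₀ this
    linarith
  have hα : 0 < g⁻¹ := inv_pos.mpr hg0
  set K : ℝ := 432 / (ε * (g ^ 2 * c₀)) + 1 with hK
  have hK1 : 1 ≤ K := by rw [hK]; linarith [(by positivity : 0 ≤ 432 / (ε * (g ^ 2 * c₀)))]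
  set θ₀ : ℝ := c₀ / (4 * (g⁻¹ + 1)) with hθ₀
  have hθ₀0 : 0 < θ₀ := by positivity
  refine ⟨g ^ 2 * c₀ / 8, θ₀, K, ε * κ / 864, by positivity, ?_, hθ₀0, ?_, hK1, by positivity, ?_⟩
  · have : g ^ 2 * c₀ ≤ 1 * 1 := by gcongr; linarith
    linarith
  · rw [hθ₀, div_le_one (by positivity)]; linarith
  intro n m ℓ hreg L hL hocc v w hvw u hu C hC
  have hm := hreg.two_le
  have hn := hreg.lt
  have hn0 := hreg.n_pos
  have hm0 := hreg.m_pos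
  obtain ⟨Q, hQ, hQL, hQu⟩ := hreg.blocks hL hu
  have hu0 : (0 : ℝ) < u := by linarith
  have hmκ : 864 / κ ≤ m := by
    have h1 := hreg.inv_le (by positivity)
    have h2 : ε * (1 / (ε * κ / 864)) ≤ ε * n := by gcongr; exact h1.trans hreg.le_n
    have h3 : ε * (1 / (ε * κ / 864)) = 864 / κ := by field_simp
    linarith [hreg.le_m]
  rw [div_le_iff₀ hκ] at hmκ
  have hmn : (m : ℝ) ≤ n := by exact_mod_cast hn.le
  have hlow : c₀ * u ≤ occ (stv n m) (fun Z => push n m v w Z ^ 2) u (locs C) := by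
    refine le_trans ?_ (le_occ_push_sq hm hn hκ hocc hvw hQL hC)
    have h1 : (u : ℝ) / m ≤ κ / 864 * u := by
      rw [div_le_iff₀ hm0]
      have : κ / 864 * u * m = u * (m * κ / 864) := by ring
      rw [this]
      have : (u : ℝ) * 1 ≤ u * (m * κ / 864) := by gcongr; linarith
      linarith
    have h2 : 864 ≤ κ * u := by
      have : m * κ ≤ u * κ := by gcongr; linarith
      linarith
    have h3 : κ / 2 * (u / 12) ≤ κ / 2 * (n * Q) := by gcongr
    have h4 : 0 ≤ κ * u := by positivity
    rw [hc₀]; linarith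
  have hbud : budget n m u (locs C) ≤ 54 / ε * u :=
    budget_le hm hn hε hε1 hreg.le_m (by linarith) hC.1
  have hbud0 := budget_nonneg hm hn u (locs C)
  have hsq := Ex_lin_sq hm hn v w (accs C) (turns C) u C hC
  have h4 := Ex_lin_fourth_le hm hn hvw (accs C) (turns C) u C hC
  have h1 := Ex_lin hm hn v w (accs C) (turns C) u C hC
  have hd := Ex_dsq_le hm hn (accs C) (turns C) u C hC
  rw [lin_self] at hsq h4 h1
  rw [dsq_self] at hd
  have h4' : Ex (cstv n m) u (fun C' => lin n v w (accs C) (turns C) C' ^ 4) C ≤ C₄ * u ^ 2 := by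
    have : budget n m u (locs C) ^ 2 ≤ (54 / ε * u) ^ 2 := by gcongr
    rw [hC₄]; linarith
  set σ : ℝ := (√u)⁻¹ with hσ
  have hsu : 0 < √(u : ℝ) := Real.sqrt_pos.mpr hu0
  have hσ2 : σ ^ 2 = 1 / u := by rw [hσ, inv_pow, Real.sq_sqrt hu0.le, one_div]
  have hpt : ∀ C', g ^ 2 / 2 * (g⁻¹ * σ * lin n v w (accs C) (turns C) C' +
      σ ^ 2 * lin n v w (accs C) (turns C) C' ^ 2 - g ^ 2 * σ ^ 4 *
      lin n v w (accs C) (turns C) C' ^ 4 - c₀ / 4) - 1 / (K * u) * dsq n (accs C) (turns C) C' ≤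
      if θ₀ * √u ≤ lin n v w (accs C) (turns C) C' ∧
      dsq n (accs C) (turns C) C' ≤ K * u then 1 else 0 := by
    intro C'
    have hd0 := dsq_nonneg (n := n) (by omega) (accs C) (turns C) C'
    set h := lin n v w (accs C) (turns C) C'
    set d := dsq n (accs C) (turns C) C'
    have hq := quartic_le_indicator (g := g) (c := c₀) (μ := σ * h) hg0 hc₀0 (by linarith)
    rw [← hθ₀] at hq
    have e1 : θ₀ ≤ σ * h ↔ θ₀ * √u ≤ h := by
      rw [hσ, inv_mul_eq_div, le_div_iff₀ hsu]
    have e2 : g ^ 2 / 2 * (2 / g ^ 2 * (if θ₀ ≤ σ * h then (1 : ℝ) else 0)) =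
        if θ₀ * √u ≤ h then 1 else 0 := by
      rw [← mul_assoc, show g ^ 2 / 2 * (2 / g ^ 2) = 1 by field_simp, one_mul]
      simp only [e1]
    have hq' := mul_le_mul_of_nonneg_left hq (by positivity : 0 ≤ g ^ 2 / 2)
    rw [e2] at hq'
    have e3 : g⁻¹ * (σ * h) + (σ * h) ^ 2 - g ^ 2 * (σ * h) ^ 4 - c₀ / 4 =
      g⁻¹ * σ * h + σ ^ 2 * h ^ 2 - g ^ 2 * σ ^ 4 * h ^ 4 - c₀ / 4 := by ring
    rw [e3] at hq'
    refine (sub_le_sub_right hq' _).trans ?_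
    have hKu : 0 < K * u := by positivity
    have hd1 : 0 ≤ 1 / (K * u) * d := by positivity
    by_cases hh : θ₀ * √u ≤ h
    · by_cases hdd : d ≤ K * u
      · rw [if_pos hh, if_pos ⟨hh, hdd⟩]; linarith
      · rw [if_pos hh, if_neg (fun h => hdd h.2)]
        have : 1 ≤ 1 / (K * u) * d := by
          rw [one_div, inv_mul_eq_div, le_div_iff₀ hKu]; linarith
        linarith
    · rw [if_neg hh, if_neg (fun h => hh h.1)]; linarith
  refine le_trans ?_ (Ex_mono hpt u C)
  rw [Ex_sub, Ex_mul, Ex_sub, Ex_sub, Ex_add, Ex_mul, Ex_mul, Ex_mul, Ex_mul, Ex_const, h1, hsq]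
  have hu4 : σ ^ 4 = 1 / (u : ℝ) ^ 2 := by
    rw [show σ ^ 4 = (σ ^ 2) ^ 2 by ring, hσ2]; ring
  rw [hσ2, hu4]
  have k1 : c₀ ≤ 1 / u * (0 ^ 2 + occ (stv n m) (fun Z => push n m v w Z ^ 2) u (locs C)) := by
    rw [one_div, inv_mul_eq_div, le_div_iff₀ hu0]; linarith
  have k2 : g ^ 2 * (1 / (u : ℝ) ^ 2) *
      Ex (cstv n m) u (fun C' => lin n v w (accs C) (turns C) C' ^ 4) C ≤ c₀ / 4 := by
    calc _ ≤ g ^ 2 * (1 / (u : ℝ) ^ 2) * (C₄ * u ^ 2) := by gcongr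
      _ = g ^ 2 * C₄ := by field_simp
      _ = c₀ / 4 := by rw [hg2]; field_simp
  have k3 : 1 / (K * u) * Ex (cstv n m) u (dsq n (accs C) (turns C)) C ≤ g ^ 2 * c₀ / 8 := by
    calc _ ≤ 1 / (K * u) * (54 / ε * u) := by gcongr; linarith
      _ = 54 / ε / K := by field_simp
      _ ≤ _ := by
        rw [div_le_iff₀ (by linarith)]
        calc 54 / ε = g ^ 2 * c₀ / 8 * (432 / (ε * (g ^ 2 * c₀))) := by field_simp; norm_num
          _ ≤ _ := by gcongr; linarith
  have k4 : g ^ 2 / 2 * (c₀ / 2) ≤ g ^ 2 / 2 * (g⁻¹ * σ * 0 +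
      1 / u * (0 ^ 2 + occ (stv n m) (fun Z => push n m v w Z ^ 2) u (locs C)) -
      g ^ 2 * (1 / (u : ℝ) ^ 2) *
      Ex (cstv n m) u (fun C' => lin n v w (accs C) (turns C) C' ^ 4) C - c₀ / 4) := by
    gcongr; linarith
  linarith

/-- The law of cosines for the unit vector pointing from the present tracks to the target. -/
theorem dsq_eq_of_direction (hn : 0 ≤ n) {a b v w : Fin 3 → ℝ} {C C' : Fin 3 → Card} {r : ℝ}
    (hv : ∀ x, r * v x = a x - (C x).acc) (hw : ∀ x, r * w x = √n * (b x - (C x).turn)) :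
    dsq n a b C' = dsq n a b C - 2 * r * lin n v w (accs C) (turns C) C' +
      dsq n (accs C) (turns C) C' := by
  have hs := Real.mul_self_sqrt (by exact_mod_cast hn : (0 : ℝ) ≤ n)
  simp only [dsq, lin, Finset.mul_sum, ← Finset.sum_sub_distrib, ← Finset.sum_add_distrib]
  refine Finset.sum_congr rfl fun x _ => ?_
  have e : 2 * r * (v x * ((C' x).acc - accs C x) + √n * w x * ((C' x).turn - turns C x)) =
      2 * ((r * v x) * ((C' x).acc - accs C x)) + 2 * √n * (r * w x) * ((C' x).turn - turns C x) := by
    ring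
  rw [e, hv, hw]
  have e2 : 2 * √(n : ℝ) * (√n * (b x - (C x).turn)) = 2 * n * (b x - (C x).turn) := by
    linear_combination 2 * (b x - (C x).turn) * hs
  rw [e2]
  simp only [accs, turns]; ring

/-- A block of rounds brings the tracks closer to given values, or keeps them close. -/
theorem le_Ex_approach {p₀ θ₀ K : ℝ} (hθ₀ : 0 < θ₀) (hθ₀1 : θ₀ ≤ 1) (hK : 1 ≤ K)
    (hn : 0 < n) {τ u : ℕ} (hτ : 0 < τ) (hτu : τ ≤ u) (huτ : u ≤ 2 * τ) {C : Fin 3 → Card}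
    (h : ∀ v w : Fin 3 → ℝ, ∑ x, (v x ^ 2 + w x ^ 2) = 1 →
      p₀ ≤ Ex (cstv n m) u (fun C' => if θ₀ * √u ≤ lin n v w (accs C) (turns C) C' ∧
        dsq n (accs C) (turns C) C' ≤ K * u then 1 else 0) C)
    (a b : Fin 3 → ℝ) {ρ : ℝ} (hρ : 4 * K / θ₀ * √τ ≤ ρ)
    (hC : √(dsq n a b C) ≤ ρ + θ₀ * √τ / 2) :
    p₀ ≤ Ex (cstv n m) u (fun C' => if √(dsq n a b C') ≤ ρ then 1 else 0) C := by
  set r := √(dsq n a b C) with hr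
  set s : ℝ := θ₀ * √τ / 2 with hs
  have hτr : (0 : ℝ) < τ := by exact_mod_cast hτ
  have hsτ : 0 < √(τ : ℝ) := Real.sqrt_pos.mpr hτr
  have hs0 : 0 < s := by positivity
  have hd0 := dsq_nonneg hn.le a b C
  have hr2 : r ^ 2 = dsq n a b C := Real.sq_sqrt hd0
  have hr0 : 0 ≤ r := Real.sqrt_nonneg _
  have hn0 : (0 : ℝ) < n := by exact_mod_cast hn
  have hsn : √(n : ℝ) ^ 2 = n := Real.sq_sqrt hn0.le
  have hτ2 : √(τ : ℝ) ^ 2 = τ := Real.sq_sqrt hτr.le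
  have hρ0 : 0 ≤ ρ := le_trans (by positivity) hρ
  have hmono : √(τ : ℝ) ≤ √u := Real.sqrt_le_sqrt (by exact_mod_cast hτu)
  have hKu : K * u ≤ 2 * K * τ := by
    have : (u : ℝ) ≤ 2 * τ := by exact_mod_cast huτ
    have := mul_le_mul_of_nonneg_left this (by linarith : 0 ≤ K)
    linarith
  have hKs : 2 * K * √τ / θ₀ * s = K * τ := by
    have : 2 * K * √τ / θ₀ * s = K * √τ ^ 2 := by rw [hs]; field_simp
    rw [this, hτ2]
  have hρ2 : 16 * K * τ ≤ ρ ^ 2 := by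
    calc 16 * K * τ ≤ 16 * K * τ * (K / θ₀ ^ 2) := by
          refine le_mul_of_one_le_right (by positivity) ?_
          rw [le_div_iff₀ (by positivity)]
          have : θ₀ ^ 2 ≤ 1 := pow_le_one₀ hθ₀.le hθ₀1
          linarith
      _ = (4 * K / θ₀ * √τ) ^ 2 := by rw [mul_pow, hτ2]; ring
      _ ≤ ρ ^ 2 := by gcongr
  -- If the target is already close, it is enough not to move far, and any direction serves.
  -- Otherwise the move towards the target yields `r² - 4 r s + 2 K τ ≤ (r - s)²`, because `K τ ≤ r
  -- s`.
  rcases le_total r (2 * K * √τ / θ₀) with hcase | hcase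
  · refine (h ![1, 0, 0] ![0, 0, 0] (by simp [Fin.sum_univ_three])).trans (Ex_mono (fun C' => ?_) u C)
    by_cases hh : dsq n (accs C) (turns C) C' ≤ K * u
    · have : √(dsq n a b C') ≤ ρ := by
        refine Real.sqrt_le_iff.mpr ⟨hρ0, ?_⟩
        have h1 : dsq n a b C' ≤ 2 * dsq n a b C + 2 * dsq n (accs C) (turns C) C' := by
          simp only [dsq, Finset.mul_sum, ← Finset.sum_add_distrib]
          refine Finset.sum_le_sum fun x _ => ?_
          simp only [accs, turns]
          have t1 : ((C' x).acc - a x) ^ 2 ≤ 2 * ((C x).acc - a x) ^ 2 +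
              2 * (((C' x).acc : ℝ) - (C x).acc) ^ 2 := by
            nlinarith [sq_nonneg (((C x).acc - a x) - (((C' x).acc : ℝ) - (C x).acc))]
          have t2 : ((C' x).turn - b x) ^ 2 ≤ 2 * ((C x).turn - b x) ^ 2 +
              2 * (((C' x).turn : ℝ) - (C x).turn) ^ 2 := by
            nlinarith [sq_nonneg (((C x).turn - b x) - (((C' x).turn : ℝ) - (C x).turn))]
          have t3 := mul_le_mul_of_nonneg_left t2 hn0.le
          linarith
        have h2 : r ^ 2 ≤ (ρ / 2) ^ 2 := by
          gcongr
          have e : 4 * K / θ₀ * √τ = 2 * (2 * K * √τ / θ₀) := by ring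
          linarith
        rw [← hr2] at h1
        linarith
      rw [if_pos this]; split_ifs <;> norm_num
    · rw [if_neg (fun h => hh h.2)]; split_ifs <;> norm_num
  · have hrpos : 0 < r := lt_of_lt_of_le (by positivity) hcase
    set v : Fin 3 → ℝ := fun x => (a x - (C x).acc) / r with hv
    set w : Fin 3 → ℝ := fun x => √n * (b x - (C x).turn) / r with hw
    have hvw : ∑ x, (v x ^ 2 + w x ^ 2) = 1 := by
      have e : ∀ x, v x ^ 2 + w x ^ 2 = (((C x).acc - a x) ^ 2 + n * ((C x).turn - b x) ^ 2) / r ^ 2 := by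
        intro x
        simp only [hv, hw]
        rw [div_pow, div_pow, mul_pow, hsn, ← add_div]; congr 1; ring
      simp only [e]
      rw [← Finset.sum_div, hr2]
      refine div_self ?_
      change dsq n a b C ≠ 0
      rw [← hr2]; positivity
    have hv' : ∀ x, r * v x = a x - (C x).acc := fun x => by simp only [hv]; field_simp
    have hw' : ∀ x, r * w x = √n * (b x - (C x).turn) := fun x => by simp only [hw]; field_simp
    refine (h v w hvw).trans (Ex_mono (fun C' => ?_) u C)
    by_cases hh : θ₀ * √u ≤ lin n v w (accs C) (turns C) C' ∧
        dsq n (accs C) (turns C) C' ≤ K * u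
    · have : √(dsq n a b C') ≤ ρ := by
        refine Real.sqrt_le_iff.mpr ⟨hρ0, ?_⟩
        rw [dsq_eq_of_direction hn.le hv' hw', ← hr2]
        have h1 : 2 * s ≤ lin n v w (accs C) (turns C) C' := by
          refine le_trans ?_ hh.1
          rw [hs]
          have := mul_le_mul_of_nonneg_left hmono hθ₀.le
          linarith
        have h2 : 2 * r * (2 * s) ≤ 2 * r * lin n v w (accs C) (turns C) C' := by gcongr
        have h3 : K * τ ≤ r * s := by rw [← hKs]; gcongr
        have h4 : s ≤ r := by
          refine le_trans ?_ hcase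
          rw [hs, le_div_iff₀ hθ₀]
          have : θ₀ * θ₀ ≤ 1 * 1 := by gcongr
          have h5 : θ₀ * θ₀ * √τ ≤ 1 * √τ := by gcongr; linarith
          have h6 : 1 * √τ ≤ K * √(τ : ℝ) := by gcongr
          linarith
        have h5 : (r - s) ^ 2 ≤ ρ ^ 2 := by
          have : 0 ≤ r - s := by linarith
          gcongr; linarith
        nlinarith [hh.2, sq_nonneg s]
      rw [if_pos this, if_pos hh]
    · rw [if_neg hh]; split_ifs <;> norm_num

/-- Each block gains `θ₀ √τ / 2` with probability at least `p₀`. All blocks have length `τ` except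
the last one, which may be up to twice as long to use up `t`. -/
theorem pow_le_Ex_close {p₀ θ₀ K : ℝ} (hp0 : 0 < p₀) (hθ₀ : 0 < θ₀) (hθ₀1 : θ₀ ≤ 1) (hK : 1 ≤ K)
    (hm : 2 ≤ m) (hn : m < n) {τ : ℕ} (hτ : 0 < τ)
    (h : ∀ u, τ ≤ u → u ≤ 2 * τ → ∀ C : Fin 3 → Card, Good n m (locs C) → ∀ v w : Fin 3 → ℝ,
      ∑ x, (v x ^ 2 + w x ^ 2) = 1 →
      p₀ ≤ Ex (cstv n m) u (fun C' => if θ₀ * √u ≤ lin n v w (accs C) (turns C) C' ∧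
        dsq n (accs C) (turns C) C' ≤ K * u then 1 else 0) C) (a b : Fin 3 → ℝ) (j : ℕ) :
    ∀ t, (j + 1) * τ ≤ t → t ≤ (j + 2) * τ → ∀ C, Good n m (locs C) →
    √(dsq n a b C) ≤ 4 * K / θ₀ * √τ + (j + 1) * (θ₀ * √τ / 2) →
    p₀ ^ (j + 1) ≤ Ex (cstv n m) t
      (fun C' => if √(dsq n a b C') ≤ 4 * K / θ₀ * √τ then 1 else 0) C := by
  have hn0 : 0 < n := by omega
  induction j with
  | zero =>
    intro t h1 h2 C hC hr
    simp only [Nat.cast_zero, zero_add, one_mul, pow_one] at *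
    exact le_Ex_approach hθ₀ hθ₀1 hK hn0 hτ h1 h2 (h t h1 h2 C hC) a b le_rfl hr
  | succ j ih =>
    intro t h1 h2 C hC hr
    have h3 : τ ≤ t := by nlinarith
    obtain ⟨t', rfl⟩ := Nat.exists_eq_add_of_le h3
    have h4 : (j + 1) * τ ≤ t' := by
      have : (j + 1 + 1) * τ = τ + (j + 1) * τ := by ring
      omega
    have h5 : t' ≤ (j + 2) * τ := by
      have : (j + 1 + 2) * τ = τ + (j + 2) * τ := by ring
      omega
    push_cast at hr
    have hs0 : 0 ≤ θ₀ * √τ / 2 := by positivity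
    have step := le_Ex_approach hθ₀ hθ₀1 hK hn0 hτ le_rfl (by omega)
      (h τ le_rfl (by omega) C hC) a b (ρ := 4 * K / θ₀ * √τ + (j + 1) * (θ₀ * √τ / 2))
      (by linarith [mul_nonneg (by positivity : (0 : ℝ) ≤ j + 1) hs0]) (by linarith)
    rw [Ex_comp, pow_succ]
    calc p₀ ^ (j + 1) * p₀ ≤ p₀ ^ (j + 1) * _ := by gcongr
      _ = Ex (cstv n m) τ (fun C' => p₀ ^ (j + 1) * if √(dsq n a b C') ≤ 4 * K / θ₀ * √τ +
          (j + 1) * (θ₀ * √τ / 2) then 1 else 0) C := (Ex_mul _ _ _ _).symm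
      _ ≤ _ := by
        refine Ex_mono_of_inv (I := fun C => Good n m (locs C)) (fun C c => good_cstv hm hn C c)
          (fun C' hC' => ?_) τ C hC
        split_ifs with hr'
        · rw [mul_one]; exact ih t' h4 h5 C' hC' hr'
        · rw [mul_zero]; exact Ex_nonneg (fun _ => by split_ifs <;> norm_num) _ _

/-- The tracks of three cards come close to any prescribed values of the right order, with a
probability bounded from below. -/
theorem le_Ex_close {ε κ δ : ℝ} (hε : 0 < ε) (hε1 : ε ≤ 1) (hκ : 0 < κ) (hκ1 : κ ≤ 1)
    (hδ : 0 < δ) : ∃ p : ℝ, 0 < p ∧ ∃ c : ℝ, 0 < c ∧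
    ∀ (n m : ℤ) (ℓ : ℝ), Regime ε c n m ℓ → ∀ L : ℕ, (L : ℤ) = 6 * n →
    (∀ Z, Good n m Z → ∀ x, κ * n ≤ occ (stv n m) (alone m x) L Z ∧
      κ ≤ occ (stv n m) (fun Z => if Z x = m then 1 else 0) L Z) →
    ∀ t : ℕ, ℓ ^ 2 / 2 ≤ t → (t : ℝ) ≤ 2 * ℓ ^ 2 → ∀ C : Fin 3 → Card, Good n m (locs C) →
    ∀ a b : Fin 3 → ℝ, dsq n a b C ≤ (100 * ℓ) ^ 2 →
    p ≤ Ex (cstv n m) t (fun C' => if dsq n a b C' ≤ (δ * ℓ) ^ 2 then 1 else 0) C := by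
  obtain ⟨p₀, θ₀, K, c₀, hp0, hp1, hθ0, hθ1, hK, hc₀, prog⟩ := le_Ex_progress hε hε1 hκ hκ1
  -- Blocks have about `lam ℓ²` rounds. They must fit into `t`, end within `δ ℓ`, and together cover
  -- `100 ℓ`. The last holds for short blocks, since about `ℓ² / τ` steps of order `√τ` cover `ℓ² /
  -- √τ`.
  set lam : ℝ := min (min 1 (1 / 2)) (min ((δ * θ₀ / (4 * K)) ^ 2) ((θ₀ / 800) ^ 2)) with hlam
  have hlam0 : 0 < lam := by positivity
  have hl1 : lam ≤ 1 / 2 := (min_le_left _ _).trans (min_le_right _ _)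
  have hl2 : lam ≤ (δ * θ₀ / (4 * K)) ^ 2 := (min_le_right _ _).trans (min_le_left _ _)
  have hl3 : lam ≤ (θ₀ / 800) ^ 2 := (min_le_right _ _).trans (min_le_right _ _)
  refine ⟨p₀ ^ (⌈4 / lam⌉₊), by positivity, min c₀ (lam / 24), by positivity, ?_⟩
  intro n m ℓ hreg L hL hocc t ht1 ht2 C hC a b hd
  have hreg' := hreg.mono (min_le_left c₀ (lam / 24))
  have hℓ := hreg.pos
  have hn0 := hreg.n_pos
  have hn1 : (1 : ℝ) ≤ n := by
    have := hreg.two_le; have := hreg.lt; exact_mod_cast (by omega : 1 ≤ n)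
  have hnl : 24 * (n : ℝ) ≤ lam * ℓ ^ 2 := by
    have := (hreg.mono (min_le_right c₀ (lam / 24))).le_sq
    linarith
  set τ : ℕ := ⌊lam * ℓ ^ 2⌋₊ with hτ
  have hτ1 : (τ : ℝ) ≤ lam * ℓ ^ 2 := Nat.floor_le (by positivity)
  have hτ2 : lam * ℓ ^ 2 - 1 < τ := Nat.sub_one_lt_floor _
  have hτn : 12 * (n : ℝ) ≤ τ := by linarith
  have hτ0r : (0 : ℝ) < τ := by linarith
  have hτ0 : 0 < τ := by exact_mod_cast hτ0r
  have hτt : τ ≤ t := by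
    have : (τ : ℝ) ≤ t := by
      have : lam * ℓ ^ 2 ≤ 1 / 2 * ℓ ^ 2 := by gcongr
      linarith
    exact_mod_cast this
  obtain ⟨j, hj⟩ : ∃ j, t / τ = j + 1 :=
    Nat.exists_eq_add_of_lt (Nat.div_pos hτt hτ0) |>.imp fun j h => by omega
  have hj1 : (j + 1) * τ ≤ t := by rw [← hj]; exact Nat.div_mul_le_self t τ
  have hj2 : t ≤ (j + 2) * τ := by
    have := Nat.lt_div_mul_add (a := t) hτ0
    rw [hj] at this
    have e : (j + 2) * τ = (j + 1) * τ + τ := by ring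
    omega
  have hsq2 : √(τ : ℝ) ^ 2 = τ := Real.sq_sqrt hτ0r.le
  have hsτ : 0 < √(τ : ℝ) := Real.sqrt_pos.mpr hτ0r
  have hroot : ∀ {d : ℝ}, 0 ≤ d → lam ≤ d ^ 2 → √(τ : ℝ) ≤ d * ℓ := by
    intro d hd0 h
    rw [Real.sqrt_le_iff]
    refine ⟨by positivity, hτ1.trans ?_⟩
    rw [mul_pow]; gcongr
  have r1 := hroot (by positivity) hl2
  have r2 := hroot (by positivity) hl3
  have hfar : 100 * ℓ ≤ (j + 1) * (θ₀ * √τ / 2) := by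
    have h1 : (t : ℝ) ≤ (j + 2) * τ := by exact_mod_cast hj2
    have h2 : (j + 2 : ℝ) * τ ≤ 2 * (j + 1) * τ := by gcongr; linarith
    have h3 : ℓ ^ 2 / 4 ≤ (j + 1) * √τ * √(τ : ℝ) := by
      rw [mul_assoc, ← sq, hsq2]; linarith
    have h4 : (j + 1) * √τ * √(τ : ℝ) ≤ (j + 1) * √τ * (θ₀ / 800 * ℓ) := by gcongr
    have h5 : ℓ * (200 * ℓ) ≤ ℓ * ((j + 1) * √τ * θ₀) := by nlinarith
    have h6 := le_of_mul_le_mul_left h5 hℓ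
    linarith
  have key := pow_le_Ex_close (n := n) (m := m) hp0 hθ0 hθ1 hK hreg.two_le hreg.lt hτ0
    (fun u h1 _ C hC v w hvw => prog n m ℓ hreg' L hL hocc v w hvw u
      (by have : (τ : ℝ) ≤ u := by exact_mod_cast h1
          linarith) C hC) a b j t hj1 hj2 C hC (by
        have : √(dsq n a b C) ≤ 100 * ℓ := Real.sqrt_le_iff.mpr ⟨by positivity, hd⟩
        have : 0 ≤ 4 * K / θ₀ * √τ := by positivity
        linarith)
  have hpow : p₀ ^ (⌈4 / lam⌉₊) ≤ p₀ ^ (j + 1) := by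
    apply pow_le_pow_of_le_one hp0.le hp1
    have h1 : ((j + 1 : ℕ) : ℝ) * τ ≤ t := by exact_mod_cast hj1
    have h2 : ((j + 1 : ℕ) : ℝ) * (lam * ℓ ^ 2 / 2) ≤ ((j + 1 : ℕ) : ℝ) * τ := by gcongr; linarith
    have h3 : ((j + 1 : ℕ) : ℝ) ≤ 4 / lam := by
      rw [le_div_iff₀ hlam0]
      have h4 : ℓ ^ 2 * (((j + 1 : ℕ) : ℝ) * lam) ≤ ℓ ^ 2 * 4 := by linarith
      exact le_of_mul_le_mul_left h4 (by positivity)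
    exact_mod_cast h3.trans (Nat.le_ceil _)
  refine hpow.trans (key.trans (Ex_mono (fun C' => ?_) t C))
  by_cases hh : √(dsq n a b C') ≤ 4 * K / θ₀ * √τ
  · have hK0 : 0 < K := by linarith
    have : dsq n a b C' ≤ (δ * ℓ) ^ 2 := by
      rw [← Real.sqrt_le_left (by positivity)]
      refine hh.trans ?_
      calc 4 * K / θ₀ * √τ ≤ 4 * K / θ₀ * (δ * θ₀ / (4 * K) * ℓ) := by gcongr
        _ = δ * ℓ := by field_simp
    rw [if_pos hh, if_pos this]
  · rw [if_neg hh]; split_ifs <;> norm_num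

end Fluctuation

end OverlappingCycles

namespace OverlappingCycles

/-! ### Cardinalities of neighbourhoods. -/

section Neighbourhood

variable {n m : ℤ}

open Classical in
/-- The locations near `s`. -/
noncomputable def near (n m : ℤ) (r : ℝ) (s : ℤ) : Finset ℤ :=
  (Finset.Icc (-(2 * n)) (2 * n)).filter fun φ => Valid n m φ ∧
    ∃ a b q : ℤ, φ = s + a + b * m + q * (2 * n - m + 1) ∧ |(a : ℝ)| ≤ r ∧ |(b : ℝ)| * √n ≤ r

theorem mem_near (hm : 2 ≤ m) (hn : m < n) {r : ℝ} {s φ : ℤ} : φ ∈ near n m r s ↔ Valid n m φ ∧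
    ∃ a b q : ℤ, φ = s + a + b * m + q * (2 * n - m + 1) ∧ |(a : ℝ)| ≤ r ∧ |(b : ℝ)| * √n ≤ r := by
  simp only [near, Finset.mem_filter, and_iff_right_iff_imp, Finset.mem_Icc]
  exact fun h => abs_le.mp (h.1.abs_le hm hn)

/-- Distinct locations have distinct residues modulo `2 n - m + 1`, so congruences determine
positions. -/
theorem Valid.eq_of_sub_eq (hm : 2 ≤ m) (hn : m < n) {φ ψ q : ℤ} (h : Valid n m φ)
    (h' : Valid n m ψ) (e : φ - ψ = q * (2 * n - m + 1)) : φ = ψ := by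
  have h1 := h.abs_sub_lt h' hm hn
  rcases eq_or_ne q 0 with rfl | hq
  · linarith
  · have h2 : 1 ≤ |q| := Int.one_le_abs hq
    rw [e, abs_mul, abs_of_pos (by omega : 0 < 2 * n - m + 1)] at h1
    nlinarith

theorem exists_rev_eq (φ : ℤ) : ∃ q : ℤ, rev n m φ = m + 1 - φ + q * (2 * n - m + 1) := by
  unfold rev
  split_ifs
  · exact ⟨-1, by ring⟩
  · exact ⟨0, by ring⟩

/-- Of two successive residues at least one belongs to a location. -/
theorem exists_valid_near (hm : 2 ≤ m) (hn : m < n) (u : ℤ) :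
    ∃ (d q : ℤ), (d = 0 ∨ d = 1) ∧ Valid n m (u + d + q * (2 * n - m + 1)) := by
  set M := 2 * n - m + 1 with hM
  have hMpos : 0 < M := by omega
  set k := (u - (2 * m - 2 * n)) / M with hk
  have h1 := Int.emod_nonneg (u - (2 * m - 2 * n)) hMpos.ne'
  have h2 := Int.emod_lt_of_pos (u - (2 * m - 2 * n)) hMpos
  have h3 := Int.emod_add_mul_ediv (u - (2 * m - 2 * n)) M
  rw [← hk] at h3
  set φ := u - M * k with hφ
  have h4 : 2 * m - 2 * n ≤ φ := by linarith
  have h5 : φ ≤ m := by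
    have : φ < 2 * m - 2 * n + M := by linarith
    omega
  have e : ∀ d, u + d + -k * M = φ + d := fun d => by rw [hφ]; ring
  clear_value φ
  by_cases h6 : Valid n m φ
  · exact ⟨0, -k, Or.inl rfl, by rw [e]; simpa using h6⟩
  · refine ⟨1, -k, Or.inr rfl, ?_⟩
    rw [e]
    clear e h1 h2 h3 hφ hk
    unfold Valid at *
    omega

theorem ediv_mem_Icc {x A : ℤ} {k : ℕ} {r : ℝ} (hA : 0 < A) (h : |(x : ℝ)| ≤ r) (hr : r ≤ k * A) :
    x / A ∈ Finset.Icc (-(k : ℤ)) k := by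
  have h1 : |x| ≤ k * A := by exact_mod_cast h.trans hr
  rw [abs_le] at h1
  rw [Finset.mem_Icc]
  constructor
  · rw [Int.le_ediv_iff_mul_le hA]; linarith
  · exact (Int.ediv_le_ediv hA h1.2).trans_eq (Int.mul_ediv_cancel _ hA.ne')

/-- Division of the coefficients with remainder cuts the large box into translates of a small one,
and `25 · 13 · 2 = 650`. The factor `2` arises because a translate of a location may have to be
shifted by `1` to be a location again. -/
theorem card_near_le (hm : 2 ≤ m) (hn : m < n) {ℓ : ℝ} (hℓ : 2 ≤ ℓ) (hs : √n ≤ ℓ) (s s' : ℤ) :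
    ((near n m (3 * ℓ) s').card : ℝ) ≤ 650 * (near n m ℓ s).card := by
  classical
  have hn0 : (0 : ℝ) < n := by exact_mod_cast (by omega : 0 < n)
  have hsn : 0 < √(n : ℝ) := Real.sqrt_pos.mpr hn0
  -- Half of `ℓ` leaves room for the shift by `1` in the bound on the remainder.
  set A : ℤ := ⌊ℓ / 2⌋ with hA
  set B : ℤ := ⌊ℓ / √n⌋ with hB
  have hA1 : (1 : ℤ) ≤ A := Int.le_floor.mpr (by push_cast; linarith)
  have hB1 : (1 : ℤ) ≤ B := Int.le_floor.mpr (by push_cast; rw [le_div_iff₀ hsn]; linarith)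
  have hA1r : (1 : ℝ) ≤ A := by exact_mod_cast hA1
  have hB1r : (1 : ℝ) ≤ B := by exact_mod_cast hB1
  have hA2 : (A : ℝ) ≤ ℓ / 2 := Int.floor_le _
  have hB2 : (B : ℝ) * √n ≤ ℓ := by rw [← le_div_iff₀ hsn]; exact Int.floor_le _
  have hA3 : ℓ / 2 < A + 1 := Int.lt_floor_add_one _
  have hB3 : ℓ / √n < B + 1 := Int.lt_floor_add_one _
  have hrep : ∀ x ∈ near n m (3 * ℓ) s', ∃ (i : ℤ × ℤ × ℤ) (f : ℤ) (q : ℤ), i ∈ Finset.Icc (-(12 : ℤ)) 12 ×ˢ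
      Finset.Icc (-(6 : ℤ)) 6 ×ˢ ({0, 1} : Finset ℤ) ∧ f ∈ near n m ℓ s ∧
      x = f + (s' - s) + A * i.1 + B * i.2.1 * m - i.2.2 + q * (2 * n - m + 1) := by
    intro x hx
    obtain ⟨hxv, a, b, q, e, ha, hb⟩ := (mem_near hm hn).mp hx
    obtain ⟨d, q', hd, hv⟩ := exists_valid_near (n := n) (m := m) hm hn (s + a % A + b % B * m)
    have r1 := Int.emod_nonneg a (by omega : A ≠ 0)
    have r2 := Int.emod_lt_of_pos a (by omega : 0 < A)
    have r3 := Int.emod_nonneg b (by omega : B ≠ 0)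
    have r4 := Int.emod_lt_of_pos b (by omega : 0 < B)
    have r5 := Int.emod_add_mul_ediv a A
    have r6 := Int.emod_add_mul_ediv b B
    refine ⟨(a / A, b / B, d), s + a % A + b % B * m + d + q' * (2 * n - m + 1), q - q', ?_, ?_, ?_⟩
    · simp only [Finset.mem_product]
      refine ⟨ediv_mem_Icc (k := 12) (by omega) ha (by push_cast; linarith), ediv_mem_Icc (k := 6)
        (r := 3 * ℓ / √n) (by omega) (by rw [le_div_iff₀ hsn]; exact hb) ?_, by simpa using hd⟩
      have : 3 * ℓ / √n = 3 * (ℓ / √n) := by ring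
      rw [this]; push_cast; linarith
    · refine (mem_near hm hn).mpr ⟨hv, a % A + d, b % B, q', by ring, ?_, ?_⟩
      · have : |((a % A + d : ℤ) : ℝ)| ≤ A := by
          rw [← Int.cast_abs]
          exact_mod_cast (by rw [abs_le]; omega : |a % A + d| ≤ A)
        linarith
      · have : |((b % B : ℤ) : ℝ)| ≤ B := by
          rw [← Int.cast_abs]
          exact_mod_cast (by rw [abs_le]; omega : |b % B| ≤ B)
        exact (mul_le_mul_of_nonneg_right this hsn.le).trans hB2
    · simp only
      rw [e]
      linear_combination -r5 - m * r6
  choose! I f q hI hf hx using hrep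
  have hinj : Set.InjOn (fun x => (I x, f x)) (near n m (3 * ℓ) s') := by
    intro x hx' y hy' hxy
    simp only [Prod.mk.injEq] at hxy
    have v1 := ((mem_near hm hn).mp hx').1
    have v2 := ((mem_near hm hn).mp hy').1
    refine v1.eq_of_sub_eq hm hn v2 (q := q x - q y) ?_
    have e1 := hx x hx'
    have e2 := hx y hy'
    rw [hxy.1, hxy.2] at e1
    linear_combination e1 - e2
  obtain ⟨J, hJ⟩ : ∃ J, J = Finset.Icc (-(12 : ℤ)) 12 ×ˢ Finset.Icc (-(6 : ℤ)) 6 ×ˢ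
    ({0, 1} : Finset ℤ) := ⟨_, rfl⟩
  have e : J.card = 650 := by
    rw [hJ, Finset.card_product, Finset.card_product, Int.card_Icc, Int.card_Icc]; rfl
  rw [← hJ] at hI
  have hcard := Finset.card_le_card_of_injOn (t := J ×ˢ near n m ℓ s) (fun x => (I x, f x))
      (fun x hx => Finset.mem_product.mpr ⟨hI x hx, hf x hx⟩) hinj
  rw [Finset.card_product] at hcard
  rw [e] at hcard
  exact_mod_cast hcard

/-- Many representations of `0` limit the number of locations near `s`. -/
theorem card_near_mul_le (hm : 2 ≤ m) (hn : m < n) {ℓ : ℝ} (hℓ : 1 ≤ ℓ) (hs : √n ≤ ℓ) (s : ℤ)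
    (K : Finset ℕ) (hK : ∀ k ∈ K, (k : ℝ) * √n ≤ ℓ ∧
      ∃ a q : ℤ, |(a : ℝ)| ≤ ℓ ∧ (k : ℤ) * m = a + q * (2 * n - m + 1)) :
    ((near n m ℓ s).card : ℝ) * K.card ≤ 25 * ℓ ^ 2 / √n := by
  classical
  have hn0 : (0 : ℝ) < n := by exact_mod_cast (by omega : 0 < n)
  have hsn : 0 < √(n : ℝ) := Real.sqrt_pos.mpr hn0
  have h1 := fun φ (h : φ ∈ near n m ℓ s) => ((mem_near hm hn).mp h).2
  choose! a b q e ha hb using h1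
  choose! hk a' q' ha' e' using hK
  set A : ℤ := ⌊2 * ℓ⌋ with hA
  set B : ℤ := ⌊2 * ℓ / √n⌋ with hB
  have hA0 : 0 ≤ A := Int.floor_nonneg.mpr (by linarith)
  have hB0 : 0 ≤ B := Int.floor_nonneg.mpr (by positivity)
  -- Modulo `2 n - m + 1`, `φ ≡ s + (a - a') + (b + k) m`. Thus the image determines `φ`, then its
  -- chosen `b`, and then `k`.
  have key := Finset.card_le_card_of_injOn (s := near n m ℓ s ×ˢ K)
    (t := Finset.Icc (-A) A ×ˢ Finset.Icc (-B) B)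
    (fun x => (a x.1 - a' x.2, b x.1 + x.2)) ?_ ?_
  · rw [Finset.card_product, Finset.card_product, Int.card_Icc, Int.card_Icc] at key
    have e1 : ((A + 1 - -A).toNat : ℝ) = 2 * A + 1 := by
      have : (((A + 1 - -A).toNat : ℤ) : ℝ) = ((A + 1 - -A : ℤ) : ℝ) := by
        rw [Int.toNat_of_nonneg (by omega)]
      push_cast at this; rw [this]; ring
    have e2 : ((B + 1 - -B).toNat : ℝ) = 2 * B + 1 := by
      have : (((B + 1 - -B).toNat : ℤ) : ℝ) = ((B + 1 - -B : ℤ) : ℝ) := by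
        rw [Int.toNat_of_nonneg (by omega)]
      push_cast at this; rw [this]; ring
    have key' : ((near n m ℓ s).card : ℝ) * K.card ≤ (2 * A + 1) * (2 * B + 1) := by
      rw [← e1, ← e2]; exact_mod_cast key
    have f1 : 2 * (A : ℝ) + 1 ≤ 5 * ℓ := by
      have : (A : ℝ) ≤ 2 * ℓ := Int.floor_le _
      linarith
    have f2 : 2 * (B : ℝ) + 1 ≤ 5 * (ℓ / √n) := by
      have h1 : (B : ℝ) ≤ 2 * ℓ / √n := Int.floor_le _
      have h2 : 2 * ℓ / √n = 2 * (ℓ / √n) := by ring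
      have h3 : 1 ≤ ℓ / √n := by rw [le_div_iff₀ hsn]; linarith
      linarith
    have hB0r : (0 : ℝ) ≤ B := by exact_mod_cast hB0
    calc _ ≤ _ := key'
      _ ≤ 5 * ℓ * (5 * (ℓ / √n)) := by gcongr
      _ = _ := by ring
  · rintro ⟨φ, k⟩ hφk
    obtain ⟨hφ, hk'⟩ := Finset.mem_product.mp hφk
    simp only at hφ hk'
    simp only [Finset.coe_product, Finset.coe_Icc, Set.mem_prod, Set.mem_Icc]
    rw [← abs_le, ← abs_le]
    constructor
    · refine Int.le_floor.mpr ?_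
      push_cast
      linarith [abs_sub (a φ : ℝ) (a' k), ha φ hφ, ha' k hk']
    · refine Int.le_floor.mpr ?_
      push_cast
      rw [le_div_iff₀ hsn]
      have h2 := abs_add_le (b φ : ℝ) k
      rw [Nat.abs_cast] at h2
      have h3 := mul_le_mul_of_nonneg_right h2 hsn.le
      linarith [hb φ hφ, hk k hk']
  · rintro ⟨φ, k⟩ hφk ⟨ψ, k'⟩ hψk h
    obtain ⟨hφ, hk1⟩ := Finset.mem_product.mp hφk
    obtain ⟨hψ, hk2⟩ := Finset.mem_product.mp hψk
    simp only [Prod.mk.injEq] at h hφ hψ hk1 hk2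
    have hφψ : φ = ψ := by
      refine Valid.eq_of_sub_eq hm hn ((mem_near hm hn).mp hφ).1 ((mem_near hm hn).mp hψ).1
        (q := (q φ - q' k) - (q ψ - q' k')) ?_
      linear_combination e φ hφ - e ψ hψ + h.1 + m * h.2 - e' k hk1 + e' k' hk2
    subst hφψ
    have : (k : ℤ) = k' := by linarith [h.2]
    rw [Prod.mk.injEq]
    exact ⟨rfl, by exact_mod_cast this⟩

end Neighbourhood

/-! ### Time reversal. -/

section Duality

variable {ι : Type*} {n m : ℤ}

/-- The reversal of the locations of a family of cards. -/
def revv (n m : ℤ) (Z : ι → ℤ) : ι → ℤ := fun x => rev n m (Z x)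

theorem eq_revv_iff {Z Y : ι → ℤ} (hZ : ∀ x, Valid n m (Z x)) (hY : ∀ x, Valid n m (Y x)) :
    Z = revv n m Y ↔ Y = revv n m Z := by
  constructor <;> rintro rfl <;> funext x <;> simp only [revv]
  · rw [rev_rev (hY x)]
  · rw [rev_rev (hZ x)]

open Classical in
/-- The shuffle is reversed by a reflection of the deck. -/
theorem Ex_eq_indicator (hm : 2 ≤ m) (hn : m < n) (t : ℕ) {Z Y : ι → ℤ}
    (hZ : ∀ x, Valid n m (Z x)) (hY : ∀ x, Valid n m (Y x)) :
    Ex (stv n m) t (fun X => if X = Y then (1 : ℝ) else 0) Z =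
      Ex (stv n m) t (fun X => if X = revv n m Z then 1 else 0) (revv n m Y) := by
  induction t generalizing Z with
  | zero =>
    simp only [Ex_zero]
    congr 1
    have h := eq_revv_iff hZ (Y := revv n m Y) fun x => (hY x).rev
    have : revv n m (revv n m Y) = Y := funext fun x => rev_rev (hY x)
    rw [this] at h
    exact propext h
  | succ t ih =>
    have hst : ∀ b x, Valid n m (stv n m Z b x) := fun b x => (hZ x).st hm hn b
    rw [Ex_succ, ih (hst true), ih (hst false), Ex_succ_right, ← Ex_add,
      div_eq_inv_mul, ← Ex_mul]
    refine Ex_congr_of_inv (I := fun X : ι → ℤ => ∀ x, Valid n m (X x))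
      (fun X b hX x => (hX x).st hm hn b) (fun X hX => ?_) t _ (fun x => (hY x).rev)
    have h : ∀ b, X = revv n m (stv n m Z b) ↔ stv n m X b = revv n m Z := by
      intro b
      rw [eq_revv_iff hX (hst b)]
      simp only [funext_iff, stv, revv]
      exact forall_congr' fun x => (st_eq_rev_iff hm hn (hZ x) (hX x) b)
    simp only [h]; ring

end Duality

end OverlappingCycles

namespace OverlappingCycles

/-! ### Backward runs and averaging over starting points. -/

section Return

variable {n m : ℤ}

theorem abs_ediv_sub_le {t d : ℤ} (hd : 0 < d) : |((t / d : ℤ) : ℝ) - t / d| ≤ 1 := by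
  have hd0 : (0 : ℝ) < d := by exact_mod_cast hd
  have h1 : ((t / d : ℤ) : ℝ) * d ≤ t := by exact_mod_cast Int.ediv_mul_le t hd.ne'
  have h2 : (t : ℝ) < (((t / d : ℤ) : ℝ) + 1) * d := by exact_mod_cast Int.lt_ediv_add_one_mul_self t hd
  rw [abs_le]
  have h3 : ((t / d : ℤ) : ℝ) ≤ t / d := by rwa [le_div_iff₀ hd0]
  have h4 : (t : ℝ) / d ≤ ((t / d : ℤ) : ℝ) + 1 := by rw [div_le_iff₀ hd0]; exact h2.le
  constructor <;> linarith

theorem Valid.abs_sub_le_real (hm : 2 ≤ m) (hn : m < n) {φ ψ : ℤ} (h : Valid n m φ)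
    (h' : Valid n m ψ) : |(φ : ℝ) - ψ| ≤ 2 * n := by
  have h1 := h.abs_sub_lt h' hm hn
  exact_mod_cast (by omega : |φ - ψ| ≤ 2 * n)

/-- Running back `t₂` rounds from a location near `s` leads near the typical location at time `t₁`,
because by the congruence `hT` the typical location at time `t₁ + t₂` is `s`. -/
theorem mem_near_of_rev {ε c ℓ : ℝ} (hreg : Regime ε c n m ℓ) (hc : c ≤ 1 / 16) (hℓ2 : 2 ≤ ℓ)
    {s φ ψ t₁ t₂ acc turn V k : ℤ} (hφ : φ ∈ near n m ℓ s) (hψ : Valid n m ψ)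
    (e : ψ = rev n m φ + t₂ + acc - m * turn - 2 * n * V) (ht0 : 0 ≤ t₂)
    (ht₂ : (t₂ : ℝ) ≤ ℓ ^ 2 / 2)
    (hT : t₁ + t₂ - (t₁ + t₂) / (2 * n) * m = k * (2 * n - m + 1))
    (hacc : |(acc : ℝ)| ≤ ℓ / 4) (hturn : |(turn : ℝ)| * √n ≤ ℓ / 4) :
    rev n m ψ ∈ near n m (3 * ℓ) (s + t₁ - t₁ / (2 * n) * m) := by
  have hm := hreg.two_le
  have hn := hreg.lt
  have hn0 := hreg.n_pos
  have hm0 := hreg.m_pos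
  have hs := hreg.sqrt_le (d := 1 / 4) (by norm_num) (by linarith)
  have hs1 := hreg.one_le_sqrt
  have hmn : (m : ℝ) ≤ n := by exact_mod_cast hn.le
  have hℓn := hreg.le_n
  obtain ⟨hφv, a, b, q, eφ, ha, hb⟩ := (mem_near hm hn).mp hφ
  obtain ⟨q₁, e₁⟩ := exists_rev_eq (n := n) (m := m) φ
  obtain ⟨q₂, e₂⟩ := exists_rev_eq (n := n) (m := m) ψ
  have hd : 0 < 2 * n := by omega
  have b1 := abs_ediv_sub_le (t := t₁) hd
  have b2 := abs_ediv_sub_le (t := t₁ + t₂) hd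
  set β₁ := t₁ / (2 * n)
  set β := (t₁ + t₂) / (2 * n)
  -- The `V` backward laps are close to `t₂ / (2 n)`, hence to `β - β₁`, so `V + β₁ - β` stays
  -- small.
  refine (mem_near hm hn).mpr ⟨hψ.rev, a - acc - V, b + turn + (V + β₁ - β),
    q + q₂ - q₁ + V - k, ?_, ?_, ?_⟩
  · rw [e₂, e, e₁, eφ]; linear_combination -hT
  all_goals
    have hV : |2 * (n : ℝ) * V - t₂| ≤ 2 * n + n + n * |(turn : ℝ)| := by
      have e3 : 2 * (n : ℝ) * V - t₂ = (rev n m φ - ψ) + acc - m * turn := by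
        have : 2 * n * V - t₂ = (rev n m φ - ψ) + acc - m * turn := by linarith
        exact_mod_cast this
      rw [e3]
      have t1 := hφv.rev.abs_sub_le_real hm hn hψ
      have t2 := abs_sub ((rev n m φ : ℝ) - ψ + acc) (m * turn)
      have t3 := abs_add_le ((rev n m φ : ℝ) - ψ) acc
      have t4 : |(m : ℝ) * turn| ≤ n * |(turn : ℝ)| := by
        rw [abs_mul, abs_of_pos hm0]; gcongr
      linarith
    have hV' : |(V : ℝ) - t₂ / (2 * n)| ≤ 2 + |(turn : ℝ)| / 2 := by
      have : (V : ℝ) - t₂ / (2 * n) = (2 * (n : ℝ) * V - t₂) / (2 * n) := by field_simp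
      rw [this, abs_div, abs_of_pos (by positivity : 0 < 2 * (n : ℝ)), div_le_iff₀ (by positivity)]
      linarith
    have hturn1 : |(turn : ℝ)| ≤ ℓ / 4 := (le_mul_of_one_le_right (abs_nonneg _) hs1).trans hturn
  · have hq : |(t₂ : ℝ) / (2 * n)| ≤ ℓ / 4 := by
      have : (0 : ℝ) ≤ t₂ := by exact_mod_cast ht0
      rw [abs_of_nonneg (by positivity), div_le_iff₀ (by positivity)]
      nlinarith
    push_cast
    have t1 := abs_sub ((a : ℝ) - acc) V
    have t2 := abs_sub (a : ℝ) acc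
    have t3 := abs_add_le ((V : ℝ) - t₂ / (2 * n)) (t₂ / (2 * n))
    rw [sub_add_cancel] at t3
    linarith
  · push_cast at b1 b2 ⊢
    have e4 : (V : ℝ) + β₁ - β = (V - t₂ / (2 * n)) + (β₁ - t₁ / (2 * n)) -
        (β - (t₁ + t₂) / (2 * n)) := by ring
    have t1 := abs_add_le ((b : ℝ) + turn) (V + β₁ - β)
    have t2 := abs_add_le (b : ℝ) turn
    have t3 := abs_sub ((V - t₂ / (2 * n)) + (β₁ - t₁ / (2 * n)) : ℝ) (β - (t₁ + t₂) / (2 * n))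
    have t4 := abs_add_le (V - t₂ / (2 * n) : ℝ) (β₁ - t₁ / (2 * n))
    rw [← e4] at t3
    have t5 : |(b : ℝ) + turn + (V + β₁ - β)| ≤ |(b : ℝ)| + 3 / 2 * |(turn : ℝ)| + 4 := by linarith
    have t6 := mul_le_mul_of_nonneg_right t5 (Real.sqrt_nonneg n)
    linarith

theorem abs_le_of_dsq_le (hn : 0 < n) {a b : Fin 3 → ℝ} {C : Fin 3 → Card} {r : ℝ} (hr : 0 ≤ r)
    (h : dsq n a b C ≤ r ^ 2) (x : Fin 3) : |(C x).acc - a x| ≤ r ∧ |(C x).turn - b x| * √n ≤ r := by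
  have hn0 : (0 : ℝ) < n := by exact_mod_cast hn
  have h1 : ((C x).acc - a x) ^ 2 + n * ((C x).turn - b x) ^ 2 ≤ r ^ 2 := by
    refine le_trans ?_ h
    exact Finset.single_le_sum
      (f := fun x => ((C x).acc - a x) ^ 2 + n * ((C x).turn - b x) ^ 2)
      (fun y _ => by positivity) (Finset.mem_univ x)
  have h2 : 0 ≤ n * ((C x).turn - b x) ^ 2 := by positivity
  constructor
  · exact abs_le_of_sq_le_sq (by nlinarith) hr
  · refine le_of_sq_le_sq ?_ hr
    rw [mul_pow, sq_abs, Real.sq_sqrt hn0.le]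
    nlinarith [sq_nonneg ((C x).acc - a x)]

/-- A tracked family is reached from its start in a known way. -/
theorem Ex_mono_of_rel (hm : 2 ≤ m) (hn : m < n) {g g' : (Fin 3 → Card) → ℝ} {Z : Fin 3 → ℤ}
    (hZ : Good n m Z) (t : ℕ) (h : ∀ C, Good n m (locs C) → Rel n m Z t C → g C ≤ g' C) :
    Ex (cstv n m) t g (fresh Z) ≤ Ex (cstv n m) t g' (fresh Z) :=
  Ex_mono_of_clock (I := fun (k : ℕ) C => Good n m (locs C) ∧ Rel n m Z k C)
    (fun k C b h => ⟨good_cstv hm hn C b h.1, by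
      have := h.2.step hm h.1.1 b
      push_cast; exact this⟩) t 0 (fun C hC => by rw [zero_add] at hC; exact h C hC.1 hC.2) _
    ⟨hZ, by simpa using rel_fresh Z⟩

theorem Ex_eq_Ex_fresh (g : (Fin 3 → ℤ) → ℝ) (t : ℕ) (Z : Fin 3 → ℤ) :
    Ex (stv n m) t g Z = Ex (cstv n m) t (fun C => g (locs C)) (fresh Z) :=
  (Ex_map (f := cstv n m) (f' := stv n m) locs (fun C c => locs_cstv n m C c) g t (fresh Z)).symm

open Classical in
-- Chebyshev for the tracks of the reversed run: in `t₂ ≤ 2 θ ℓ²` rounds the mean of `dsq` is at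
-- most `ℓ² / 32`, so it exceeds `(ℓ / 4)²` with probability at most `1/2`.
theorem half_le_Ex_return {ε c ℓ θ : ℝ} (hε : 0 < ε) (hε1 : ε ≤ 1) (hreg : Regime ε c n m ℓ)
    (hc : c ≤ 1 / 16) (hℓ2 : 2 ≤ ℓ) (hθ : θ ≤ ε / 3456) {f s : Fin 3 → ℤ}
    (hf : Good n m f) (hfs : ∀ x, f x ∈ near n m ℓ (s x)) {t₁ t₂ : ℕ} {k : ℤ} (hnt : (n : ℝ) ≤ t₂)
    (ht₂ : (t₂ : ℝ) ≤ 2 * θ * ℓ ^ 2)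
    (hT : (t₁ + t₂ : ℤ) - (t₁ + t₂ : ℤ) / (2 * n) * m = k * (2 * n - m + 1)) :
    1 / 2 ≤ Ex (stv n m) t₂ (fun X => if ∀ x, revv n m X x ∈
      near n m (3 * ℓ) (s x + t₁ - (t₁ : ℤ) / (2 * n) * m) then 1 else 0) (revv n m f) := by
  have hm := hreg.two_le
  have hn := hreg.lt
  have hn0 := hreg.n_pos
  have hℓ := hreg.pos
  have hrf : Good n m (revv n m f) := ⟨fun x => (hf.1 x).rev, fun x y h => hf.2 (by
    rw [← rev_rev (hf.1 x), ← rev_rev (hf.1 y)]; exact congrArg (rev n m) h)⟩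
  rw [Ex_eq_Ex_fresh]
  have hpt : ∀ C, Good n m (locs C) → Rel n m (revv n m f) t₂ C →
      1 - 16 / ℓ ^ 2 * dsq n (accs (fresh (revv n m f))) (turns (fresh (revv n m f))) C ≤
      if ∀ x, revv n m (locs C) x ∈
        near n m (3 * ℓ) (s x + t₁ - (t₁ : ℤ) / (2 * n) * m) then 1 else 0 := by
    intro C hC hrel
    have hd := dsq_nonneg (n := n) (by omega) (accs (fresh (revv n m f)))
      (turns (fresh (revv n m f))) C
    by_cases h : dsq n (accs (fresh (revv n m f))) (turns (fresh (revv n m f))) C ≤ (ℓ / 4) ^ 2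
    · rw [if_pos]
      · have : 0 ≤ 16 / ℓ ^ 2 * dsq n (accs (fresh (revv n m f))) (turns (fresh (revv n m f))) C := by
          positivity
        linarith
      · intro x
        obtain ⟨h1, h2⟩ := abs_le_of_dsq_le (by omega) (by positivity) h x
        obtain ⟨V, hV⟩ := hrel x
        simp only [accs, turns, fresh, Int.cast_zero, sub_zero] at h1 h2
        refine mem_near_of_rev hreg hc hℓ2 (hfs x) (hC.1 x) hV (by positivity) ?_ hT h1 h2
        push_cast
        refine ht₂.trans ?_
        have : 2 * θ ≤ 1 / 2 := by linarith
        calc 2 * θ * ℓ ^ 2 ≤ 1 / 2 * ℓ ^ 2 := by gcongr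
          _ = _ := by ring
    · have h3 : 1 ≤ 16 / ℓ ^ 2 * dsq n (accs (fresh (revv n m f))) (turns (fresh (revv n m f))) C := by
        rw [not_le] at h
        calc 1 = 16 / ℓ ^ 2 * (ℓ / 4) ^ 2 := by field_simp; norm_num
          _ ≤ _ := by gcongr
      split_ifs <;> linarith
  refine le_trans ?_ (Ex_mono_of_rel hm hn hrf t₂ hpt)
  rw [Ex_sub, Ex_const, Ex_mul]
  have h1 := Ex_dsq_le hm hn (accs (fresh (revv n m f))) (turns (fresh (revv n m f))) t₂
    (fresh (revv n m f)) hrf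
  rw [dsq_self] at h1
  have h2 : budget n m t₂ (locs (fresh (revv n m f))) ≤ 54 / ε * t₂ :=
    budget_le hm hn hε hε1 hreg.le_m hnt hrf.1
  have h3 : 54 / ε * t₂ ≤ ℓ ^ 2 / 32 := by
    calc 54 / ε * t₂ ≤ 54 / ε * (2 * (ε / 3456) * ℓ ^ 2) := by
          gcongr; exact ht₂.trans (by gcongr)
      _ = ℓ ^ 2 / 32 := by field_simp; norm_num
  have h4 : 16 / ℓ ^ 2 * Ex (cstv n m) t₂ (dsq n (accs (fresh (revv n m f)))
      (turns (fresh (revv n m f)))) (fresh (revv n m f)) ≤ 16 / ℓ ^ 2 * (ℓ ^ 2 / 32) := by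
    gcongr; linarith
  have h5 : 16 / ℓ ^ 2 * (ℓ ^ 2 / 32) = 1 / 2 := by field_simp; norm_num
  linarith

open Classical in
/-- Some starting point in a box has at least the average probability of reaching a given set. -/
theorem exists_le_Ex_of_return (hm : 2 ≤ m) (hn : m < n) (A : Finset (Fin 3 → ℤ))
    (hA : ∀ f ∈ A, ∀ x, Valid n m (f x)) (B : Fin 3 → Finset ℤ)
    (hB : ∀ x, ∀ φ ∈ B x, Valid n m φ) (hBne : (Fintype.piFinset B).Nonempty) (t : ℕ)
    (h : ∀ f ∈ A, 1 / 2 ≤ Ex (stv n m) t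
      (fun X => if ∀ x, revv n m X x ∈ B x then 1 else 0) (revv n m f)) :
    ∃ z ∈ Fintype.piFinset B, (A.card : ℝ) / 2 ≤ (Fintype.piFinset B).card *
      Ex (stv n m) t (fun X => if X ∈ A then 1 else 0) z := by
  -- The probabilities summed over the box are, by reversal, the sum over `f ∈ A` of the probability
  -- of returning to the box, which is at least `|A| / 2`.
  by_contra! hcon
  have h1 := Finset.sum_lt_sum_of_nonempty hBne hcon
  rw [← Finset.mul_sum, Finset.sum_const, nsmul_eq_mul] at h1
  have hcard : (0 : ℝ) < (Fintype.piFinset B).card := by exact_mod_cast hBne.card_pos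
  have h2 := lt_of_mul_lt_mul_left h1 hcard.le
  refine absurd h2 (not_lt.mpr ?_)
  have e1 : ∀ z ∈ Fintype.piFinset B, Ex (stv n m) t (fun X => if X ∈ A then (1 : ℝ) else 0) z =
      ∑ f ∈ A, Ex (stv n m) t (fun X => if X = revv n m z then 1 else 0) (revv n m f) := by
    intro z hz
    have hzv : ∀ x, Valid n m (z x) := fun x => hB x _ (Fintype.mem_piFinset.mp hz x)
    have : (fun X => if X ∈ A then (1 : ℝ) else 0) = fun X => ∑ f ∈ A, if X = f then 1 else 0 := by
      funext X; rw [Finset.sum_ite_eq]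
    rw [this, Ex_sum]
    refine Finset.sum_congr rfl fun f hf => ?_
    convert Ex_eq_indicator hm hn t hzv (hA f hf)
  rw [Finset.sum_congr rfl e1, Finset.sum_comm]
  have e2 : ∀ f ∈ A, (1 / 2 : ℝ) ≤ ∑ z ∈ Fintype.piFinset B,
      Ex (stv n m) t (fun X => if X = revv n m z then 1 else 0) (revv n m f) := by
    intro f hf
    refine (h f hf).trans ?_
    rw [← Ex_sum]
    refine Ex_mono_of_inv (I := fun X : Fin 3 → ℤ => ∀ x, Valid n m (X x))
      (fun X b hX x => (hX x).st hm hn b) (fun X hX => ?_) t _ fun x => (hA f hf x).rev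
    split_ifs with h1
    · have hmem : revv n m X ∈ Fintype.piFinset B := Fintype.mem_piFinset.mpr h1
      have e3 : X = revv n m (revv n m X) := funext fun x => (rev_rev (hX x)).symm
      refine le_trans ?_ (Finset.single_le_sum
        (f := fun z => if X = revv n m z then (1 : ℝ) else 0)
        (fun z _ => by split_ifs <;> norm_num) hmem)
      rw [if_pos e3]
    · exact Finset.sum_nonneg fun z _ => by split_ifs <;> norm_num
  refine le_trans ?_ (Finset.sum_le_sum e2)
  rw [Finset.sum_const, nsmul_eq_mul]; linarith

end Return

/-! ### Targets for the tracks. -/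

section Approach

variable {n m : ℤ}

/-- The fluctuation and the decision excess that lead a card near a given location. -/
theorem exists_target {ε c ℓ δ : ℝ} (hreg : Regime ε c n m ℓ) (hδ0 : 0 < δ) (hδ : δ ≤ 1)
    (hc : c ≤ (δ / 40) ^ 2) {s z t : ℤ} (hs : Valid n m s) (ht0 : 0 ≤ t) (ht : (t : ℝ) ≤ 2 * ℓ ^ 2)
    (hz : z ∈ near n m (3 * ℓ) (s + t - t / (2 * n) * m)) : ∃ α υ : ℝ,
    α ^ 2 + n * υ ^ 2 ≤ 1000 * ℓ ^ 2 ∧ ∀ φ acc turn V : ℤ, Valid n m φ →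
    φ = s + t + acc - m * turn - 2 * n * V → |acc - α| ≤ δ / 4 * ℓ → |turn - υ| * √n ≤ δ / 4 * ℓ →
    ∃ a b q : ℤ, φ = z + a + b * m + q * (2 * n - m + 1) ∧ |(a : ℝ)| ≤ δ * ℓ ∧
      |(b : ℝ)| * √n ≤ δ * ℓ := by
  have hm := hreg.two_le
  have hn := hreg.lt
  have hn0 := hreg.n_pos
  have hm0 := hreg.m_pos
  have hℓ := hreg.pos
  have hℓn := hreg.le_n
  have hsq := hreg.sqrt_le (d := δ / 40) (by positivity) hc
  have hs1 := hreg.one_le_sqrt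
  have hmn : (m : ℝ) ≤ n := by exact_mod_cast hn.le
  have hδℓ : δ * ℓ ≤ ℓ := mul_le_of_le_one_left hℓ.le hδ
  obtain ⟨hzv, a, b, q, ez, ha, hb⟩ := (mem_near hm hn).mp hz
  have b1 := abs_ediv_sub_le (t := t) (d := 2 * n) (by omega)
  set β := t / (2 * n)
  push_cast at b1
  set D : ℝ := β - b - t / (2 * n) with hD
  have hd : (0 : ℝ) < 2 * n - m := by linarith
  -- Reaching `z` means `acc + V ≈ a` and `turn + V ≈ β - b`. The laps obey `2 n V ≈ t + acc - m
  -- turn` up to `O(n)`, with `acc` of order at most `n`; so the second condition reads `(2 n - m)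
  -- turn ≈ 2 n (β - b) - t`, which gives `υ`, and then the first gives `α`.
  set υ : ℝ := 2 * n * D / (2 * n - m) with hυ
  have hυD : (2 * n - m) * υ = 2 * n * D := by rw [hυ]; field_simp
  set α : ℝ := a - (β - b) + υ with hα
  have hDs : |D| * √n ≤ 4 * ℓ := by
    have e : D = (β - t / (2 * n)) - b := by rw [hD]; ring
    have h1 : |D| ≤ 1 + |(b : ℝ)| := by
      rw [e]; exact (abs_sub _ _).trans (by linarith)
    have h2 := mul_le_mul_of_nonneg_right h1 (Real.sqrt_nonneg n)
    linarith
  have hυ2 : |υ| ≤ 2 * |D| := by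
    rw [hυ, abs_div, abs_of_pos hd, div_le_iff₀ hd, abs_mul, abs_of_pos (by positivity : 0 < 2 * (n : ℝ))]
    have : |D| * (2 * (n : ℝ)) ≤ |D| * (2 * (2 * n - m)) := by gcongr; linarith
    linarith
  have hυs : |υ| * √n ≤ 8 * ℓ := by
    have := mul_le_mul_of_nonneg_right hυ2 (Real.sqrt_nonneg n)
    linarith
  have hD1 : |D| ≤ 4 * ℓ := (le_mul_of_one_le_right (abs_nonneg _) hs1).trans hDs
  have hυ1 : |υ| ≤ 8 * ℓ := (le_mul_of_one_le_right (abs_nonneg _) hs1).trans hυs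
  have hq : |(t : ℝ) / (2 * n)| ≤ ℓ := by
    have : (0 : ℝ) ≤ t := by exact_mod_cast ht0
    rw [abs_of_nonneg (by positivity), div_le_iff₀ (by positivity)]
    nlinarith
  have hα1 : |α| ≤ 16 * ℓ := by
    have e : α = a - D - t / (2 * n) + υ := by rw [hα, hD]; ring
    rw [e]
    have t1 := abs_add_le (a - D - t / (2 * n)) υ
    have t2 := abs_sub (a - D) (t / (2 * n))
    have t3 := abs_sub (a : ℝ) D
    linarith
  refine ⟨α, υ, ?_, ?_⟩
  · have h1 : α ^ 2 ≤ (16 * ℓ) ^ 2 := sq_le_sq.mpr (by rwa [abs_of_pos (by positivity : 0 < 16 * ℓ)])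
    have h2 : (|υ| * √n) ^ 2 ≤ (8 * ℓ) ^ 2 := by gcongr
    rw [mul_pow, sq_abs, hreg.sqrt_sq] at h2
    nlinarith
  · intro φ acc turn V hφ e hacc hturn
    have hacc1 : |(acc : ℝ)| ≤ 17 * ℓ := by
      have := abs_add_le ((acc : ℝ) - α) α
      rw [sub_add_cancel] at this; linarith
    have hturn1 : |(turn : ℝ) - υ| ≤ δ / 4 * ℓ :=
      (le_mul_of_one_le_right (abs_nonneg _) hs1).trans hturn
    have hB : |(turn : ℝ) + V - (β - b)| ≤ |(turn : ℝ) - υ| + 10 := by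
      have e1 : 2 * (n : ℝ) * (turn + V - (β - b)) =
          (2 * n - m) * (turn - υ) + ((s - φ) + acc) := by
        have : 2 * n * V = s - φ + t + acc - m * turn := by linarith
        have : 2 * (n : ℝ) * V = s - φ + t + acc - m * turn := by exact_mod_cast this
        have e2 : 2 * (n : ℝ) * (t / (2 * n)) = t := by field_simp
        linear_combination this + hυD + 2 * n * hD - e2
      have t1 := hs.abs_sub_le_real hm hn hφ
      have t2 := abs_add_le ((2 * n - m) * ((turn : ℝ) - υ)) ((s - φ) + acc)
      have t3 := abs_add_le ((s : ℝ) - φ) acc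
      have t4 : |(2 * (n : ℝ) - m) * (turn - υ)| ≤ 2 * n * |turn - υ| := by
        rw [abs_mul, abs_of_pos hd]; gcongr; linarith
      rw [← e1, abs_mul, abs_of_pos (by positivity : 0 < 2 * (n : ℝ))] at t2
      have t5 : 2 * (n : ℝ) * |(turn : ℝ) + V - (β - b)| ≤ 2 * n * (|(turn : ℝ) - υ| + 10) := by
        linarith
      exact le_of_mul_le_mul_left t5 (by positivity)
    refine ⟨acc + V - a, -(turn + V - (β - b)), -V - q, ?_, ?_, ?_⟩
    · rw [e, ez]; ring
    · push_cast
      have e1 : (acc : ℝ) + V - a = (acc - α) + ((turn + V - (β - b)) - (turn - υ)) := by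
        rw [hα]; ring
      rw [e1]
      have t1 := abs_add_le ((acc : ℝ) - α) ((turn + V - (β - b)) - (turn - υ))
      have t2 := abs_sub ((turn : ℝ) + V - (β - b)) (turn - υ)
      linarith
    · push_cast
      rw [abs_neg]
      have := mul_le_mul_of_nonneg_right hB (Real.sqrt_nonneg n)
      linarith

end Approach

end OverlappingCycles

/-! ### Hitting sets that fill a quarter of the box. -/

namespace OverlappingCycles

theorem Sep.of_near {n m : ℤ} (hm : 2 ≤ m) (hn : m < n) {ρ r : ℝ} {s s' u u' φ φ' : ℤ}
    (h : Sep n m ρ (s - s')) (e : u - u' = s - s') (hφ : φ ∈ near n m r u)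
    (hφ' : φ' ∈ near n m r u') : Sep n m (ρ - 4 * r) (φ - φ') := by
  obtain ⟨-, a, b, q, e1, ha, hb⟩ := (mem_near hm hn).mp hφ
  obtain ⟨-, a', b', q', e2, ha', hb'⟩ := (mem_near hm hn).mp hφ'
  refine (h.shift (u' := φ - φ') (a := a - a') (b := b - b') (q := q - q') (A := 2 * r) (B := 2 * r)
    (by linear_combination e1 - e2 + e) ?_ ?_).mono (by linarith)
  · push_cast; linarith [abs_sub (a : ℝ) a']
  · push_cast
    have := mul_le_mul_of_nonneg_right (abs_sub (b : ℝ) b') (Real.sqrt_nonneg n)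
    linarith

theorem near_nonempty {n m : ℤ} (hm : 2 ≤ m) (hn : m < n) {r : ℝ} (hr : 1 ≤ r) (s : ℤ) :
    (near n m r s).Nonempty := by
  obtain ⟨d, q, hd, hv⟩ := exists_valid_near (n := n) (m := m) hm hn s
  refine ⟨_, (mem_near hm hn).mpr ⟨hv, d, 0, q, by ring, ?_, by simp; linarith⟩⟩
  rcases hd with rfl | rfl <;> simp <;> linarith

theorem card_piFinset_near_le {n m : ℤ} (hm : 2 ≤ m) (hn : m < n) {ℓ : ℝ} (hℓ : 2 ≤ ℓ)
    (hs : √n ≤ ℓ) (s s' : Fin 3 → ℤ) :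
    ((Fintype.piFinset fun x => near n m (3 * ℓ) (s' x)).card : ℝ) ≤
      650 ^ 3 * (Fintype.piFinset fun x => near n m ℓ (s x)).card := by
  rw [Fintype.card_piFinset, Fintype.card_piFinset]
  push_cast
  have h : ∏ x : Fin 3, ((near n m (3 * ℓ) (s' x)).card : ℝ) ≤
      ∏ x : Fin 3, (650 * ((near n m ℓ (s x)).card : ℝ)) :=
    Finset.prod_le_prod (fun x _ => by positivity) fun x _ => card_near_le hm hn hℓ hs (s x) (s' x)
  rw [Finset.prod_mul_distrib] at h
  simpa using h

set_option maxHeartbeats 400000 in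
open Classical in
/-- Three separated cards hit every set that fills a quarter of their neighbourhoods, with a
probability bounded from below. -/
theorem le_Ex_mem {ε : ℝ} (hε : 0 < ε) (hε1 : ε ≤ 1) : ∃ p : ℝ, 0 < p ∧ ∃ c : ℝ, 0 < c ∧ c ≤ 1 / 16 ∧
    ∀ (n m : ℤ) (ℓ : ℝ), Regime ε c n m ℓ → ∀ s : Fin 3 → ℤ, (∀ x, Valid n m (s x)) →
    (∀ x y, y ≠ x → Sep n m (199 * ℓ) (s x - s y)) → ∀ T : ℕ, ℓ ^ 2 ≤ T → (T : ℝ) ≤ 2 * ℓ ^ 2 →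
    (∃ k : ℤ, (T : ℤ) - T / (2 * n) * m = k * (2 * n - m + 1)) →
    ∀ A : Finset (Fin 3 → ℤ), A ⊆ Fintype.piFinset (fun x => near n m ℓ (s x)) →
    ((Fintype.piFinset fun x => near n m ℓ (s x)).card : ℝ) ≤ 4 * A.card →
    p ≤ Ex (stv n m) T (fun X => if X ∈ A then 1 else 0) s := by
  obtain ⟨κ₀, hκ₀, n₀, hocc⟩ := occ_alone_and_decision ε hε
  set κ := min κ₀ 1 with hκdef
  have hκ : 0 < κ := by positivity
  have hκ1 : κ ≤ 1 := min_le_right _ _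
  have hκ2 : κ ≤ κ₀ := min_le_left _ _
  -- A quarter of the box, a factor `1 / 2` from averaging, and a loss of `650` per card for the
  -- larger box. Later `η = c' / 6`, so that three displaced cards cost `3 η = c' / 2`.
  obtain ⟨c', hc'⟩ : ∃ c' : ℝ, c' = 1 / (8 * 650 ^ 3) := ⟨_, rfl⟩
  have hc'0 : 0 < c' := by rw [hc']; positivity
  have hc'1 : c' ≤ 1 / 8 := by rw [hc']; norm_num
  set η := c' / 6 with hη
  have hη0 : 0 < η := by positivity
  set θ := ε * η / 200 with hθ
  have hθ0 : 0 < θ := by positivity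
  have hθε : θ ≤ ε / 3456 := by
    have : ε * η ≤ ε * (1 / 48) := by gcongr; linarith
    linarith
  obtain ⟨δ, hδ, hδ1, cG, hcG, grad⟩ := abs_Ex_sub_le hε hε1 hη0 (by linarith) hθ0 le_rfl hκ
  obtain ⟨p, hp, cH, hcH, close⟩ := le_Ex_close hε hε1 hκ hκ1 (by positivity : 0 < δ / 4)
  set c := min (min (min cG cH) (min ((δ / 40) ^ 2) (1 / 16))) (min θ (1 / (|n₀| + 1))) with hc
  have hcpos : 0 < c := by positivity
  have hc1 : c ≤ cG := (min_le_left _ _).trans ((min_le_left _ _).trans (min_le_left _ _))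
  have hc2 : c ≤ cH := (min_le_left _ _).trans ((min_le_left _ _).trans (min_le_right _ _))
  have hc3 : c ≤ (δ / 40) ^ 2 := (min_le_left _ _).trans ((min_le_right _ _).trans (min_le_left _ _))
  have hc4 : c ≤ 1 / 16 := (min_le_left _ _).trans ((min_le_right _ _).trans (min_le_right _ _))
  have hc5 : c ≤ θ := (min_le_right _ _).trans (min_le_left _ _)
  have hc6 : c ≤ 1 / (|n₀| + 1) := (min_le_right _ _).trans (min_le_right _ _)
  refine ⟨c' / 2 * p, by positivity, c, hcpos, hc4, ?_⟩
  intro n m ℓ hreg s hs hsep T hT1 hT2 ⟨k, hk⟩ A hAN hA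
  have hm := hreg.two_le
  have hn := hreg.lt
  have hn0 := hreg.n_pos
  have hℓ := hreg.pos
  have hn1 : (1 : ℝ) ≤ n := by exact_mod_cast (by omega : 1 ≤ n)
  have hinv := hreg.inv_le hcpos
  have hℓ2 : 2 ≤ ℓ := by
    have : 1 / (1 / 16 : ℝ) ≤ 1 / c := one_div_le_one_div_of_le hcpos hc4
    norm_num at this hinv; linarith
  have hn₀ : n₀ ≤ n := by
    have : 1 / (1 / (|n₀| + 1)) ≤ 1 / c := one_div_le_one_div_of_le hcpos hc6
    rw [one_div_one_div] at this
    linarith [le_abs_self n₀, hreg.le_n]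
  have hsℓ : √(n : ℝ) ≤ ℓ := by
    have := hreg.sqrt_le (d := 1 / 4) (by norm_num) (by linarith)
    linarith
  obtain ⟨L, hL⟩ : ∃ L : ℕ, (L : ℤ) = 6 * n := ⟨(6 * n).toNat, by omega⟩
  have hoccn : ∀ Z, Good n m Z → ∀ x, κ * n ≤ occ (stv n m) (alone m x) L Z ∧
      κ ≤ occ (stv n m) (fun Z => if Z x = m then 1 else 0) L Z := by
    intro Z hZ x
    obtain ⟨h1, h2⟩ := hocc n m hm hn hreg.le_m hreg.le_sub hn₀ L hL Z hZ x
    exact ⟨le_trans (by gcongr) h1, hκ2.trans h2⟩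
  have hnθ : (n : ℝ) ≤ θ * ℓ ^ 2 := hreg.le_sq.trans (by gcongr)
  set t₂ : ℕ := ⌈θ * ℓ ^ 2⌉₊ with ht₂
  have ht₂1 : θ * ℓ ^ 2 ≤ t₂ := Nat.le_ceil _
  have ht₂2 : (t₂ : ℝ) ≤ 2 * θ * ℓ ^ 2 := by
    have := Nat.ceil_lt_add_one (by positivity : 0 ≤ θ * ℓ ^ 2)
    linarith
  have hθℓ : 2 * θ * ℓ ^ 2 ≤ 1 / 2 * ℓ ^ 2 := by gcongr; linarith
  have ht₂T : t₂ ≤ T := by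
    have : (t₂ : ℝ) ≤ T := by linarith [sq_nonneg ℓ]
    exact_mod_cast this
  obtain ⟨t₁, rfl⟩ := Nat.exists_eq_add_of_le' ht₂T
  push_cast at hT1 hT2 hk
  have hnt₂ : (n : ℝ) ≤ t₂ := hnθ.trans ht₂1
  set B : Fin 3 → Finset ℤ := fun x => near n m (3 * ℓ) (s x + t₁ - (t₁ : ℤ) / (2 * n) * m) with hB
  have hBv : ∀ x, ∀ φ ∈ B x, Valid n m φ := fun x φ h => ((mem_near hm hn).mp h).1
  have hBne : (Fintype.piFinset B).Nonempty :=
    Fintype.piFinset_nonempty.mpr fun x => near_nonempty hm hn (by linarith) _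
  have hAv : ∀ f ∈ A, ∀ x, f x ∈ near n m ℓ (s x) := fun f hf => Fintype.mem_piFinset.mp (hAN hf)
  have hAval : ∀ f ∈ A, ∀ x, Valid n m (f x) := fun f hf x => ((mem_near hm hn).mp (hAv f hf x)).1
  obtain ⟨z, hz, hzA⟩ := exists_le_Ex_of_return hm hn A hAval B hBv hBne t₂ (fun f hf =>
    half_le_Ex_return hε hε1 hreg hc4 hℓ2 hθε
      (good_of_sep (ρ := 199 * ℓ - 4 * ℓ) (by linarith) (hAval f hf)
        fun x y hxy => (hsep x y hxy).of_near hm hn rfl (hAv f hf x) (hAv f hf y))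
      (hAv f hf) hnt₂ ht₂2 hk)
  set v : (Fin 3 → ℤ) → ℝ := Ex (stv n m) t₂ (fun X => if X ∈ A then 1 else 0) with hv
  have hA0 : (0 : ℝ) < A.card := by
    have : (Fintype.piFinset fun x => near n m ℓ (s x)).Nonempty :=
      Fintype.piFinset_nonempty.mpr fun x => near_nonempty hm hn (by linarith) _
    have : (0 : ℝ) < (Fintype.piFinset fun x => near n m ℓ (s x)).card := by
      exact_mod_cast this.card_pos
    linarith
  have hvz0 : 0 ≤ v z := Ex_nonneg (fun X => by split_ifs <;> norm_num) _ _
  have hvz : c' ≤ v z := by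
    have h1 := card_piFinset_near_le hm hn hℓ2 hsℓ s (fun x => s x + t₁ - (t₁ : ℤ) / (2 * n) * m)
    have h2 : ((Fintype.piFinset B).card : ℝ) * v z ≤ (650 ^ 3 * (4 * A.card)) * v z := by
      refine mul_le_mul_of_nonneg_right (h1.trans ?_) hvz0
      exact mul_le_mul_of_nonneg_left hA (by positivity)
    have h3 : (A.card : ℝ) * c' ≤ A.card * v z := by
      have h4 : (A.card : ℝ) / 2 ≤ (650 ^ 3 * (4 * A.card)) * v z := hzA.trans h2
      have h5 : (A.card : ℝ) * c' = A.card / 2 * (1 / (4 * 650 ^ 3)) := by rw [hc']; ring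
      have h6 := mul_le_mul_of_nonneg_right h4 (by norm_num : (0 : ℝ) ≤ 1 / (4 * 650 ^ 3))
      have h7 : (650 ^ 3 * (4 * (A.card : ℝ))) * v z * (1 / (4 * 650 ^ 3)) = A.card * v z := by ring
      linarith
    exact le_of_mul_le_mul_left h3 hA0
  have hzB : ∀ x, z x ∈ B x := Fintype.mem_piFinset.mp hz
  have ht₁ : (t₁ : ℝ) ≤ 2 * ℓ ^ 2 := by linarith [Nat.cast_nonneg (α := ℝ) t₂]
  have htar := fun x => exists_target hreg hδ hδ1 hc3 (hs x) (t := (t₁ : ℤ)) (by positivity)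
    (by push_cast; exact ht₁) (hzB x)
  choose α υ hαυ htar using htar
  have hgs : Good n m s := good_of_sep (by positivity) hs hsep
  have hclose := close n m ℓ (hreg.mono hc2) L hL hoccn t₁ (by linarith) ht₁ (fresh s) hgs α υ (by
    have h1 := Finset.sum_le_sum fun x (_ : x ∈ Finset.univ) => hαυ x
    simp only [dsq, fresh, Int.cast_zero, zero_sub, neg_sq]
    simp only [Finset.sum_const, Finset.card_univ, Fintype.card_fin, nsmul_eq_mul] at h1
    push_cast at h1
    linarith [sq_nonneg ℓ])
  rw [Ex_comp, Ex_eq_Ex_fresh]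
  have hfin : Ex (cstv n m) t₁ (fun C => c' / 2 * if dsq n α υ C ≤ (δ / 4 * ℓ) ^ 2 then 1 else 0)
      (fresh s) ≤ Ex (cstv n m) t₁ (fun C => v (locs C)) (fresh s) := by
    refine Ex_mono_of_rel hm hn hgs t₁ fun C hC hrel => ?_
    split_ifs with hd
    -- If the tracks are near their targets, all locations are within `δ ℓ` of `z`; then `v` is at
    -- least `c' - 3 η = c' / 2` there.
    · have hg := grad n m ℓ (hreg.mono hc1) L hL (fun Z hZ => (hoccn Z hZ 0).1)
        (fun Z hZ => (hoccn Z hZ 0).2) (fun X => if X ∈ A then 1 else 0)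
        (fun X => by split_ifs <;> norm_num) t₂ ht₂1 ht₂2 z (locs C) (fun x => hBv x _ (hzB x)) hC.1
        (fun x y hxy => ((hsep x y hxy).of_near hm hn (by ring) (hzB x) (hzB y)).mono (by linarith))
        (fun x => by
          obtain ⟨h1, h2⟩ := abs_le_of_dsq_le (by omega) (by positivity) hd x
          obtain ⟨V, hV⟩ := hrel x
          exact htar x _ _ _ V (hC.1 x) hV h1 h2)
      have := (abs_le.mp hg).2
      rw [mul_one]
      linarith
    · rw [mul_zero]
      exact Ex_nonneg (fun X => by split_ifs <;> norm_num) _ _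
  rw [Ex_mul] at hfin
  exact le_trans (by gcongr) hfin

end OverlappingCycles

namespace OverlappingCycles

/-! ### From the coin measure to means of the chain. -/

section Coins

/-- The coins with given values before time `k`. -/
def cyl (w : ℕ → Bool) (k : ℕ) : Set (ℕ → Bool) := {c | ∀ i < k, c i = w i}

instance isProbabilityMeasure_coinLaw : IsProbabilityMeasure coinLaw := by
  unfold coinLaw; infer_instance

theorem coinLaw_real_cyl (w : ℕ → Bool) (k : ℕ) : coinLaw.real (cyl w k) = (1 / 2) ^ k := by
  have e : cyl w k = Set.pi (Finset.range k : Set ℕ) (fun i => {w i}) := by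
    ext c; simp [cyl, Set.mem_pi]
  rw [e, Measure.real, coinLaw, Measure.infinitePi_pi _ (fun i _ => measurableSet_singleton _)]
  simp only [PMF.toMeasure_apply_singleton _ _ (measurableSet_singleton _),
    PMF.uniformOfFintype_apply, Finset.prod_const, Finset.card_range, ENNReal.toReal_pow]
  simp

variable {S : Type*}

/-- The state of a chain driven by a sequence of coins. -/
def run (f : S → Bool → S) (s : S) (c : ℕ → Bool) : ℕ → S
  | 0 => s
  | t + 1 => f (run f s c t) (c t)

theorem run_congr (f : S → Bool → S) (s : S) {c w : ℕ → Bool} {k : ℕ} (h : c ∈ cyl w k) :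
    run f s c k = run f s w k := by
  induction k with
  | zero => rfl
  | succ k ih => rw [run, run, ih (fun i hi => h i (by omega)), h k (by omega)]

open Classical in
-- The Markov property for cylinders: splitting by the coin at time `k` turns a cylinder of length
-- `k` into two of length `k + 1`.
theorem coinLaw_real_cyl_inter (f : S → Bool → S) (s : S) (A : Set S) (t k : ℕ) (w : ℕ → Bool) :
    coinLaw.real (cyl w k ∩ {c | run f s c (k + t) ∈ A}) =
      (1 / 2) ^ k * Ex f t (fun s => if s ∈ A then 1 else 0) (run f s w k) := by
  induction t generalizing k w with
  | zero =>
    simp only [add_zero, Ex_zero]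
    by_cases h : run f s w k ∈ A
    · have : cyl w k ∩ {c | run f s c k ∈ A} = cyl w k :=
        Set.inter_eq_left.mpr fun c hc => by simpa [run_congr f s hc] using h
      rw [this, coinLaw_real_cyl, if_pos h, mul_one]
    · have : cyl w k ∩ {c | run f s c k ∈ A} = ∅ := by
        rw [Set.eq_empty_iff_forall_notMem]
        rintro c ⟨hc, hA⟩
        rw [Set.mem_ofPred_eq, run_congr f s hc] at hA
        exact h hA
      rw [this, if_neg h]; simp
  | succ t ih =>
    have hmeas : MeasurableSet {c : ℕ → Bool | c k = true} :=
      measurableSet_eq_fun (measurable_pi_apply k) measurable_const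
    rw [← measureReal_inter_add_sdiff (s := cyl w k ∩ _) hmeas]
    have hupd : ∀ b, run f s (Function.update w k b) (k + 1) = f (run f s w k) b := by
      intro b
      rw [run, Function.update_self]
      congr 1
      exact run_congr f s fun i hi => Function.update_of_ne (by omega) _ _
    have hcyl : ∀ b c, c ∈ cyl (Function.update w k b) (k + 1) ↔ c ∈ cyl w k ∧ c k = b := by
      intro b c
      constructor
      · intro h
        refine ⟨fun i hi => ?_, by simpa using h k (by omega)⟩
        rw [h i (by omega), Function.update_of_ne (by omega)]
      · rintro ⟨h1, h2⟩ i hi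
        rcases Nat.lt_succ_iff_lt_or_eq.mp hi with h | rfl
        · rw [h1 i h, Function.update_of_ne (by omega)]
        · simpa using h2
    have e1 : (cyl w k ∩ {c | run f s c (k + (t + 1)) ∈ A}) ∩ {c : ℕ → Bool | c k = true} =
        cyl (Function.update w k true) (k + 1) ∩ {c | run f s c (k + 1 + t) ∈ A} := by
      ext c
      rw [show k + 1 + t = k + (t + 1) by ring]
      simp only [Set.mem_inter_iff, Set.mem_ofPred_eq, hcyl]
      tauto
    have e2 : (cyl w k ∩ {c | run f s c (k + (t + 1)) ∈ A}) \ {c : ℕ → Bool | c k = true} =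
        cyl (Function.update w k false) (k + 1) ∩ {c | run f s c (k + 1 + t) ∈ A} := by
      ext c
      rw [show k + 1 + t = k + (t + 1) by ring]
      simp only [Set.mem_inter_iff, Set.mem_sdiff, Set.mem_ofPred_eq, hcyl, Bool.not_eq_true]
      tauto
    rw [e1, e2, ih, ih, hupd, hupd, Ex_succ]
    ring

open Classical in
theorem coinLaw_real_run (f : S → Bool → S) (s : S) (A : Set S) (t : ℕ) :
    coinLaw.real {c | run f s c t ∈ A} = Ex f t (fun s => if s ∈ A then 1 else 0) s := by
  have h := coinLaw_real_cyl_inter f s A t 0 fun _ => false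
  have e : cyl (fun _ => false) 0 = Set.univ := by ext c; simp [cyl]
  rw [e, Set.univ_inter, zero_add, pow_zero, one_mul] at h
  exact h

end Coins

/-! ### Translation between positions and locations. -/

section Deck

variable {n m : ℕ}

/-- The location of a position. -/
def loc (m : ℕ) (x : Fin n) : ℤ := if (x : ℤ) + 1 ≤ m then x + 1 else 2 * (x + 1) - 2 * n - 1

theorem valid_loc (hn : m < n) (x : Fin n) : Valid n m (loc m x) := by
  have := x.2
  unfold Valid loc; split_ifs <;> omega

theorem loc_injective : Function.Injective (loc m : Fin n → ℤ) := by
  intro x y h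
  have := x.2
  have := y.2
  unfold loc at h
  ext
  split_ifs at h <;> omega

theorem exists_loc_eq (hn : m < n) {φ : ℤ} (h : Valid n m φ) : ∃ x : Fin n, loc m x = φ := by
  unfold Valid at h
  rcases h with h | h
  · refine ⟨⟨(φ - 1).toNat, by omega⟩, ?_⟩
    unfold loc; simp only; split_ifs <;> omega
  · refine ⟨⟨((φ + 2 * n - 1) / 2).toNat, by omega⟩, ?_⟩
    unfold loc; simp only; split_ifs <;> omega

/-- Locations agree with stretched positions modulo `2 n - m + 1`, so norms and neighbourhoods carry
over. -/
theorem exists_p_eq (x : Fin n) : ∃ q : ℤ, p m x = loc m x + q * (2 * n - m + 1) := by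
  unfold p loc
  split_ifs
  · exact ⟨0, by ring⟩
  · exact ⟨1, by ring⟩

theorem loc_step (hm : 2 ≤ m) (hn : m < n) (b : Bool) (x : Fin n) :
    loc m (step n m b x) = st n m b (loc m x) := by
  have hx := x.2
  have hcyc : ∀ k, 1 ≤ k → k ≤ n → (cycle n k x : ℕ) =
      if (x : ℕ) + 1 < k then (x : ℕ) + 1 else if (x : ℕ) + 1 = k then 0 else (x : ℕ) := by
    intro k h1 h2
    unfold cycle
    rw [dif_pos ⟨h1, h2⟩]
    rcases lt_trichotomy ((x : ℕ) + 1) k with h | h | h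
    · rw [if_pos h, Fin.coe_cycleRange_of_lt (by rw [Fin.lt_def]; simp only; omega)]
    · rw [if_neg (by omega), if_pos h, Fin.coe_cycleRange_of_le (by rw [Fin.le_def]; simp only; omega),
        if_pos (by ext; simp only; omega)]
    · rw [if_neg (by omega), if_neg (by omega), Fin.cycleRange_of_gt (by rw [Fin.lt_def]; simp only; omega)]
  cases b
  · have h := hcyc n (by omega) le_rfl
    have e : step n m false = cycle n n := rfl
    rw [e]
    generalize cycle n n x = y at h
    have hy := y.2
    clear hcyc e
    simp only [loc, st, Bool.false_eq_true, if_false]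
    split_ifs at h ⊢ <;> omega
  · have h := hcyc m (by omega) hn.le
    have e : step n m true = cycle n m := rfl
    rw [e]
    generalize cycle n m x = y at h
    have hy := y.2
    clear hcyc e
    simp only [loc, st, if_true]
    split_ifs at h ⊢ <;> omega

theorem deck_eq_run (c : ℕ → Bool) (t : ℕ) :
    deck n m c t = run (fun (σ : Equiv.Perm (Fin n)) b => step n m b * σ) 1 c t := by
  induction t with
  | zero => rfl
  | succ t ih => rw [deck, run, ih]

open Classical in
theorem tripleProb_eq_Ex (hm : 2 ≤ m) (hn : m < n) (T : ℕ) (i f : Fin 3 → Fin n) :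
    tripleProb m T (i 0) (i 1) (i 2) (f 0) (f 1) (f 2) =
      Ex (stv n m) T (fun X => if X = fun x => loc m (f x) then 1 else 0) (fun x => loc m (i x)) := by
  have h := Ex_map (f := fun (σ : Equiv.Perm (Fin n)) b => step n m b * σ)
    (f' := stv (ι := Fin 3) n m) (fun σ x => loc m (σ (i x)))
    (fun σ b => by funext x; exact loc_step hm hn b _)
    (fun X => if X = fun x => loc m (f x) then 1 else 0) T 1
  simp only [Equiv.Perm.coe_one, id_eq] at h
  rw [← h]
  have h2 := coinLaw_real_run (fun (σ : Equiv.Perm (Fin n)) b => step n m b * σ) 1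
    {σ | (fun x => loc m (σ (i x))) = fun x => loc m (f x)} T
  simp only [Set.mem_ofPred_eq] at h2
  refine Eq.trans ?_ (h2.trans (by congr!))
  rw [tripleProb]
  congr 1
  ext c
  simp only [Set.mem_ofPred_eq, deck_eq_run, funext_iff, loc_injective.eq_iff, Fin.forall_fin_succ]
  simp

theorem mem_nbhd_iff (hm : 2 ≤ m) (hn : m < n) {ℓ : ℝ} {i x : Fin n} :
    x ∈ nbhd m ℓ i ↔ loc m x ∈ near n m ℓ (loc m i) := by
  have hsn : 0 < √(n : ℝ) := Real.sqrt_pos.mpr (by exact_mod_cast (by omega : 0 < n))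
  obtain ⟨q₁, e₁⟩ := exists_p_eq (m := m) i
  obtain ⟨q₂, e₂⟩ := exists_p_eq (m := m) x
  rw [mem_near (by omega) (by omega)]
  simp only [nbhd, Set.mem_ofPred_eq, valid_loc hn x, true_and, Int.cast_natCast]
  constructor
  · rintro ⟨a, b, ha, hb, h⟩
    obtain ⟨k, hk⟩ := Int.modEq_iff_dvd.mp h
    rw [modulus] at hk
    exact ⟨a, b, q₁ - q₂ + k, by linear_combination hk + e₁ - e₂, ha, by rwa [← le_div_iff₀ hsn]⟩
  · rintro ⟨a, b, q, e, ha, hb⟩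
    refine ⟨a, b, ha, by rwa [le_div_iff₀ hsn], Int.modEq_iff_dvd.mpr ⟨q + q₂ - q₁, ?_⟩⟩
    rw [modulus]
    linear_combination e₂ - e₁ + e

theorem ncard_nbhd (hm : 2 ≤ m) (hn : m < n) (ℓ : ℝ) (i : Fin n) :
    (nbhd m ℓ i).ncard = (near n m ℓ (loc m i)).card := by
  rw [← Set.ncard_coe_finset, ← Set.ncard_image_of_injective _ (loc_injective (m := m))]
  congr 1
  ext φ
  constructor
  · rintro ⟨x, hx, rfl⟩
    exact (mem_nbhd_iff hm hn).mp hx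
  · intro h
    obtain ⟨x, rfl⟩ := exists_loc_eq hn ((mem_near (by omega) (by omega)).mp h).1
    exact ⟨x, (mem_nbhd_iff hm hn).mpr h, rfl⟩

theorem ncard_nbhd_mul_gamma_le (hm : 2 ≤ m) (hn : m < n) {ℓ : ℝ} (hℓ : 1 ≤ ℓ) (hs : √(n : ℝ) ≤ ℓ)
    (i : Fin n) : ((nbhd m ℓ i).ncard : ℝ) * gamma ℓ n m ≤ 25 * ℓ ^ 2 / √n := by
  have hsn : 0 < √(n : ℝ) := Real.sqrt_pos.mpr (by exact_mod_cast (by omega : 0 < n))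
  have hfin : {κ : ℕ | (circAbs n m ((κ : ℤ) * (m : ℤ)) : ℝ) < ℓ ∧ (κ : ℝ) < ℓ / √n}.Finite := by
    refine (Set.finite_Iio ⌈ℓ / √n⌉₊).subset fun κ hκ => ?_
    exact Nat.lt_ceil.mpr hκ.2
  have h := card_near_mul_le (n := n) (m := m) (by omega) (by omega) hℓ
    (by simpa using hs) (loc m i) hfin.toFinset ?_
  · rw [ncard_nbhd hm hn, gamma, Set.ncard_eq_toFinset_card _ hfin]
    simpa using h
  · intro κ hκ
    rw [Set.Finite.mem_toFinset, Set.mem_ofPred_eq] at hκ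
    refine ⟨?_, ?_⟩
    · have := hκ.2.le
      rw [le_div_iff₀ hsn] at this
      simpa using this
    · have hne : {d : ℕ | ∃ a : ℤ, (κ : ℤ) * m ≡ a [ZMOD modulus n m] ∧ d = a.natAbs}.Nonempty :=
        ⟨_, (κ : ℤ) * m, rfl, rfl⟩
      obtain ⟨a, ha, hd⟩ := Nat.sInf_mem hne
      obtain ⟨k, hk⟩ := Int.modEq_iff_dvd.mp ha
      have h1 := hκ.1.le
      rw [circAbs, hd, Nat.cast_natAbs] at h1
      refine ⟨a, -k, by simpa using h1, ?_⟩
      rw [modulus] at hk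
      linear_combination -hk

theorem sep_of_deckNorm {ρ : ℝ} {i j : Fin n}
    (h : ρ < deckNorm n m ((p m i - p m j : ℤ) : ℝ)) : Sep n m ρ (loc m i - loc m j) := by
  intro a b q e
  obtain ⟨q₁, e₁⟩ := exists_p_eq (m := m) i
  obtain ⟨q₂, e₂⟩ := exists_p_eq (m := m) j
  refine h.trans_le (csInf_le ⟨0, ?_⟩ ⟨a, b, q + q₁ - q₂, ?_, by simp⟩)
  · rintro s ⟨a, b, q, -, rfl⟩; positivity
  · rw [modulus]
    have : p m i - p m j = a + b * m + (q + q₁ - q₂) * (2 * n - m + 1) := by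
      linear_combination e₁ - e₂ + e
    rw [this]; push_cast; ring

/-- By the trivial representation with `b = 0`. It gives `ℓ ≤ n`, which the statement does not
assume. -/
theorem Sep.lt_two_mul (hm : 2 ≤ m) (hn : m < n) {ρ : ℝ} {i j : Fin n}
    (h : Sep n m ρ (loc m i - loc m j)) : ρ < 2 * n := by
  have h1 := h (loc m i - loc m j) 0 0 (by ring)
  have h2 := (valid_loc hn i).abs_sub_le_real (by omega) (by omega) (valid_loc hn j)
  push_cast at h1 h2
  simp only [abs_zero, zero_mul, add_zero] at h1
  linarith

end Deck

end OverlappingCycles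

/-! ### The proposition. -/

namespace OverlappingCycles

theorem mul_cube_le {D ℓ w g x y z : ℝ} (hD : 0 ≤ D) (hℓ : 0 < ℓ) (hw : 0 < w) (hg : 0 ≤ g)
    (hy : 0 ≤ y) (hz : 0 ≤ z) (h1 : x * g ≤ 25 * ℓ ^ 2 / w)
    (h2 : y * g ≤ 25 * ℓ ^ 2 / w) (h3 : z * g ≤ 25 * ℓ ^ 2 / w) :
    x * (y * z) * (D * g ^ 3 * w ^ 3 / ℓ ^ 6) ≤ 25 ^ 3 * D := by
  calc x * (y * z) * (D * g ^ 3 * w ^ 3 / ℓ ^ 6) =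
        D * w ^ 3 / ℓ ^ 6 * ((x * g) * (y * g) * (z * g)) := by ring
    _ ≤ D * w ^ 3 / ℓ ^ 6 * ((25 * ℓ ^ 2 / w) * (25 * ℓ ^ 2 / w) * (25 * ℓ ^ 2 / w)) := by gcongr
    _ = 25 ^ 3 * D := by field_simp

end OverlappingCycles

set_option maxHeartbeats 1000000 in
theorem mainTheorem6 (ε : ℝ) (hε : 0 < ε) (hε' : ε < 1 / 2) :
    ∃ C D : ℝ, 0 < C ∧ 0 < D ∧
      ∀ n m : ℕ, 2 ≤ m → m < n → ε < (m : ℝ) / (n : ℝ) → (m : ℝ) / (n : ℝ) < 1 - ε →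
      ∀ ℓ : ℝ, C * Real.sqrt n < ℓ →
      ∀ i j k : Fin n,
        199 * ℓ < OverlappingCycles.deckNorm n m
          ((OverlappingCycles.p m i - OverlappingCycles.p m j : ℤ) : ℝ) →
        199 * ℓ < OverlappingCycles.deckNorm n m
          ((OverlappingCycles.p m i - OverlappingCycles.p m k : ℤ) : ℝ) →
        199 * ℓ < OverlappingCycles.deckNorm n m
          ((OverlappingCycles.p m j - OverlappingCycles.p m k : ℤ) : ℝ) →
      ∀ T : ℕ, ℓ ^ 2 ≤ (T : ℝ) → (T : ℝ) ≤ ℓ ^ 2 + 4 * (n : ℝ) →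
        (T : ℤ) - ((T / (2 * n) : ℕ) : ℤ) * (m : ℤ) ≡ 0 [ZMOD OverlappingCycles.modulus n m] →
      3 / 4 * (Set.ncard (OverlappingCycles.nbhd m ℓ i ×ˢ
          OverlappingCycles.nbhd m ℓ j ×ˢ OverlappingCycles.nbhd m ℓ k) : ℝ) ≤
        (Set.ncard {f : Fin n × Fin n × Fin n |
          f ∈ OverlappingCycles.nbhd m ℓ i ×ˢ
            OverlappingCycles.nbhd m ℓ j ×ˢ OverlappingCycles.nbhd m ℓ k ∧
          D * (OverlappingCycles.gamma ℓ n m : ℝ) ^ 3 * (n : ℝ) ^ (3 / 2 : ℝ) / ℓ ^ 6 ≤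
            OverlappingCycles.tripleProb m T i j k f.1 f.2.1 f.2.2} : ℝ) := by
  classical
  open OverlappingCycles in
  obtain ⟨p₀, hp₀, c, hc, hc16, main⟩ := le_Ex_mem hε (by linarith)
  -- `C` ensures `n ≤ c ℓ²`. `D` makes the total mass of the bad triples at most `p₀ / 2`, given `25
  -- ℓ² / √n` for each of three neighbourhoods.
  refine ⟨1 / √c, p₀ / (2 * 25 ^ 3), by positivity, by positivity, ?_⟩
  intro n m hm hn hmn1 hmn2 ℓ hCℓ i j k hij hik hjk T hT1 hT2 hTmod
  set D : ℝ := p₀ / (2 * 25 ^ 3) with hD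
  have hn0 : (0 : ℝ) < n := by exact_mod_cast (by omega : 0 < n)
  have hn1 : (1 : ℝ) ≤ n := by exact_mod_cast (by omega : 1 ≤ n)
  have hsn : 0 < √(n : ℝ) := Real.sqrt_pos.mpr hn0
  have hsc : 0 < √c := Real.sqrt_pos.mpr hc
  have hℓ : 0 < ℓ := lt_trans (by positivity) hCℓ
  have hsℓ : √(n : ℝ) < √c * ℓ := by
    rw [one_div, inv_mul_eq_div, div_lt_iff₀ hsc] at hCℓ; linarith
  have hle_sq : (n : ℝ) ≤ c * ℓ ^ 2 := by
    have h : √(n : ℝ) ^ 2 ≤ (√c * ℓ) ^ 2 := by gcongr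
    rwa [Real.sq_sqrt hn0.le, mul_pow, Real.sq_sqrt hc.le] at h
  have sij := sep_of_deckNorm hij
  have sik := sep_of_deckNorm hik
  have sjk := sep_of_deckNorm hjk
  have hℓn : ℓ ≤ n := by linarith [sij.lt_two_mul hm hn]
  have hreg : Regime ε c n m ℓ := by
    rw [lt_div_iff₀ hn0] at hmn1
    rw [div_lt_iff₀ hn0] at hmn2
    refine ⟨by omega, by omega, ?_, ?_, hℓ, ?_, ?_⟩
    · push_cast; exact hmn1.le
    · push_cast; linarith
    · push_cast; exact hle_sq
    · push_cast; exact hℓn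
  have hsℓ4 := hreg.sqrt_le (d := 1 / 4) (by norm_num) (by linarith)
  have hsℓ1 : √(n : ℝ) ≤ ℓ := by push_cast at hsℓ4; linarith
  have hℓ1 : 1 ≤ ℓ := by
    have := hreg.one_le_sqrt
    push_cast at this; linarith
  set s : Fin 3 → ℤ := fun x => loc m (![i, j, k] x) with hs
  have hsep : ∀ x y, y ≠ x → Sep n m (199 * ℓ) (s x - s y) := by
    intro x y hxy
    have sji := sij.neg
    have ski := sik.neg
    have skj := sjk.neg
    rw [neg_sub] at sji ski skj
    fin_cases x <;> fin_cases y <;> first | exact absurd rfl hxy | assumption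
  have hTk : ∃ k : ℤ, (T : ℤ) - T / (2 * n) * m = k * (2 * n - m + 1) := by
    obtain ⟨k, hk⟩ := Int.modEq_iff_dvd.mp hTmod
    refine ⟨-k, ?_⟩
    rw [modulus] at hk
    push_cast at hk
    linear_combination -hk
  have hT3 : (T : ℝ) ≤ 2 * ℓ ^ 2 := by
    have : c * ℓ ^ 2 ≤ 1 / 16 * ℓ ^ 2 := by gcongr
    linarith
  set N : Set (Fin n × Fin n × Fin n) := nbhd m ℓ i ×ˢ nbhd m ℓ j ×ˢ nbhd m ℓ k with hN
  set b : ℝ := D * (gamma ℓ n m : ℝ) ^ 3 * (n : ℝ) ^ (3 / 2 : ℝ) / ℓ ^ 6 with hb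
  have hb0 : 0 ≤ b := by positivity
  -- Otherwise the bad triples `E` fill at least a quarter of the box and must be hit with
  -- probability `p₀`.
  by_contra! hcon
  set G : Set (Fin n × Fin n × Fin n) := {f | f ∈ N ∧ b ≤ tripleProb m T i j k f.1 f.2.1 f.2.2}
    with hG
  set E : Finset (Fin n × Fin n × Fin n) := (N \ G).toFinset with hE
  have hEcard : (N.ncard : ℝ) ≤ 4 * E.card := by
    have h1 : (N \ G).ncard + G.ncard = N.ncard :=
      Set.ncard_sdiff_add_ncard_of_subset (fun f hf => hf.1) (Set.toFinite _)
    rw [Set.ncard_eq_toFinset_card' (N \ G)] at h1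
    have h2 : (E.card : ℝ) + G.ncard = N.ncard := by exact_mod_cast h1
    linarith
  let Φ : Fin n × Fin n × Fin n → Fin 3 → ℤ := fun f x => loc m (![f.1, f.2.1, f.2.2] x)
  have hΦ : Function.Injective Φ := by
    rintro ⟨a, a', a''⟩ ⟨b, b', b''⟩ h
    have h0 := loc_injective (congrFun h 0)
    have h1 := loc_injective (congrFun h 1)
    have h2 := loc_injective (congrFun h 2)
    simp at h0 h1 h2
    rw [h0, h1, h2]
  have hNcard : N.ncard = (Fintype.piFinset fun x => near n m ℓ (s x)).card := by
    rw [hN, Set.ncard_prod, Set.ncard_prod, ncard_nbhd hm hn, ncard_nbhd hm hn, ncard_nbhd hm hn,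
      Fintype.card_piFinset, Fin.prod_univ_three]
    simp only [hs]
    simp [mul_assoc]
  have hsub : E.image Φ ⊆ Fintype.piFinset fun x => near n m ℓ (s x) := by
    intro X hX
    obtain ⟨f, hf, rfl⟩ := Finset.mem_image.mp hX
    have hfN : f ∈ N := (Set.mem_toFinset.mp hf).1
    refine Fintype.mem_piFinset.mpr fun x => ?_
    fin_cases x
    · exact (mem_nbhd_iff hm hn).mp hfN.1
    · exact (mem_nbhd_iff hm hn).mp hfN.2.1
    · exact (mem_nbhd_iff hm hn).mp hfN.2.2
  have key := main n m ℓ hreg s (fun x => valid_loc hn _) hsep T hT1 hT3 hTk (E.image Φ) hsub (by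
    rw [Finset.card_image_of_injective _ hΦ, ← hNcard]; exact hEcard)
  have hprob : Ex (stv n m) T (fun X => if X ∈ E.image Φ then 1 else 0) s =
      ∑ f ∈ E, tripleProb m T i j k f.1 f.2.1 f.2.2 := by
    have e1 : (fun X => if X ∈ E.image Φ then (1 : ℝ) else 0) =
        fun X => ∑ f ∈ E, if X = Φ f then 1 else 0 := by
      funext X
      rw [← Finset.sum_image (f := fun Y => if X = Y then (1 : ℝ) else 0) (fun _ _ _ _ h => hΦ h),
        Finset.sum_ite_eq]
    rw [e1, Ex_sum]
    refine Finset.sum_congr rfl fun f _ => ?_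
    have := tripleProb_eq_Ex hm hn T ![i, j, k] ![f.1, f.2.1, f.2.2]
    simp only [Matrix.cons_val_zero, Matrix.cons_val_one, Matrix.cons_val] at this
    rw [this]
  have hup : ∑ f ∈ E, tripleProb m T i j k f.1 f.2.1 f.2.2 ≤ E.card * b := by
    rw [← nsmul_eq_mul]
    refine Finset.sum_le_card_nsmul _ _ _ fun f hf => ?_
    obtain ⟨h1, h2⟩ := Set.mem_toFinset.mp hf
    by_contra! h
    exact h2 ⟨h1, h.le⟩
  have hEN : (E.card : ℝ) ≤ N.ncard := by
    rw [hE, ← Set.ncard_eq_toFinset_card']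
    exact_mod_cast Set.ncard_le_ncard Set.sdiff_subset (Set.toFinite _)
  have hNb : (N.ncard : ℝ) * b ≤ p₀ / 2 := by
    have g1 := ncard_nbhd_mul_gamma_le hm hn hℓ1 hsℓ1 i
    have g2 := ncard_nbhd_mul_gamma_le hm hn hℓ1 hsℓ1 j
    have g3 := ncard_nbhd_mul_gamma_le hm hn hℓ1 hsℓ1 k
    have hpow : (n : ℝ) ^ (3 / 2 : ℝ) = √n ^ 3 := by
      rw [Real.sqrt_eq_rpow, ← Real.rpow_natCast, ← Real.rpow_mul hn0.le]; norm_num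
    have h := mul_cube_le (by positivity : 0 ≤ D) hℓ hsn (Nat.cast_nonneg _)
      (Nat.cast_nonneg _) (Nat.cast_nonneg _) g1 g2 g3
    have e : 25 ^ 3 * D = p₀ / 2 := by rw [hD]; ring
    rw [hb, hpow, hN, Set.ncard_prod, Set.ncard_prod, ← e]
    push_cast
    exact h
  rw [hprob] at key
  have : (E.card : ℝ) * b ≤ N.ncard * b := by gcongr
  linarith
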